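/- Write points of $\mathbb R^6$ as $z=(x,y)$ with $x,y\in\mathbb R^3$, and put $r_i=\frac12(x_i^2+y_i^2)$ for $i=1,2,3$. Let $\omega_0=(\omega_{0,1},\omega_{0,2},\omega_{0,3})\in\mathbb R^3$ and let $k\in\{1,2,3\}$. There exist a function $H\in C^\infty(\mathbb R^6)$ with $$H(z)=\langle\omega_0,r\rangle+O(|z|^3)\quad (z\to0),$$ whose Hamiltonian vector field $X_H=(\partial_yH,-\partial_xH)$ has a flow $\Phi^t_H$ defined for all $t\in\mathbb R$, and a strictly increasing sequence $(a_n)_{n\in\mathbb Z}$ of positive real numbers with $\lim_{n\to-\infty}a_n=0$ and $\lim_{n\to+\infty}a_n=+\infty$, such that the following hold. 1. The sets $\{r_k=a_n\}$, $n\in\mathbb Z$, and $\{r_i=0\}$, $i=1,2,3$, are foliated by invariant tori: every flat torus $\{r=c\}$ (of dimension equal to the number of nonzero $c_i$) contained in one of these sets is invariant under $\Phi_H^t$, and $\Phi_H^t$ acts on it by a linear flow, i.e. it rotates the planes $(x_i,y_i)$ by the angles $t\Omega_i$ for some $\Omega\in\mathbb R^3$ depending on the torus. 2. Every other orbit accumulates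 on the union of these sets or at infinity: if $z$ lies in none of these sets, then there are times $t_j\in\mathbb R$ such that either $\Phi_H^{t_j}(z)$ converges to a point of one of these sets, or $|\Phi_H^{t_j}(z)|\to\infty$. 3. The origin is not KAM-stable: it has a neighbourhood $U$ such that the union of the invariant Lagrangian tori contained in $U$ has Lebesgue measure zero. (Here an invariant Lagrangian torus is a Lagrangian embedded $3$-dimensional torus of class $C^1$, invariant under $\Phi_H^t$, on which the flow is conjugate, through the embedding, to a linear flow on $\mathbb T^3$.) 4. If $\omega_{0,i}\,\omega_{0,j}<0$, where $i,j$ are the two indices different from $k$, then $\Phi_H^t$ is diffusive: for every $A>0$ there are $p\in\mathbb R^6$ and $t_1,t_2\in\mathbb R$ with $|\Phi_H^{t_1}(p)|\le A^{-1}$ and $|\Phi_H^{t_2}(p)|\ge A$. In particular, if the coordinates of $\omega_0$ are not all of the same sign (two of them have a negative product), then, with $k$ the remaining index (so $k=3$ after a relabelling of the coordinates), $H$ can be chosen so that 1--3 hold and $\Phi_H^t$ is diffusive. -/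

import Mathlib

open Filter Topology MeasureTheory
open scoped ContDiff

noncomputable section

/-- The phase space `ℝ^{2d}`; `z (Sum.inl i) = x_i` and `z (Sum.inr i) = y_i`. -/
abbrev Phase (d : ℕ) : Type := EuclideanSpace ℝ (Fin d ⊕ Fin d)

/-- The actions `r_i = (x_i² + y_i²) / 2`. -/
def action {d : ℕ} (z : Phase d) (i : Fin d) : ℝ :=
  (z (Sum.inl i) ^ 2 + z (Sum.inr i) ^ 2) / 2

/-- `H(z) = ⟨ω₀, r⟩ + O(|z|³)` at the origin. -/
def IsEllipticWithFrequency {d : ℕ} (ω₀ : Fin d → ℝ) (H : Phase d → ℝ) : Prop :=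
  (fun z : Phase d => H z - ∑ i, ω₀ i * action z i) =O[𝓝 0] (fun z : Phase d => ‖z‖ ^ 3)

/-- The Hamiltonian vector field `X_H = (∂_y H, -∂_x H)`. -/
def hamVectorField {d : ℕ} (H : Phase d → ℝ) (z : Phase d) : Phase d :=
  WithLp.toLp 2 (Sum.elim
    (fun i => fderiv ℝ H z (EuclideanSpace.single (Sum.inr i) 1))
    (fun i => -fderiv ℝ H z (EuclideanSpace.single (Sum.inl i) 1)))

/-- `Φ` is the (globally defined) flow of the Hamiltonian vector field of `H`. -/
def IsHamiltonianFlow {d : ℕ} (H : Phase d → ℝ) (Φ : ℝ → Phase d → Phase d) : Prop :=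
  (∀ z, Φ 0 z = z) ∧
    ∀ z t, HasDerivAt (fun s => Φ s z) (hamVectorField H (Φ t z)) t

/-- The rotation by the angle `θ_i` in each plane `(x_i, y_i)`, in the sense in which the flow of
`⟨ω, r⟩` rotates: that flow is `t ↦ rotate (t • ω)`. -/
def rotate {d : ℕ} (θ : Fin d → ℝ) (z : Phase d) : Phase d :=
  WithLp.toLp 2 (Sum.elim
    (fun i => Real.cos (θ i) * z (Sum.inl i) + Real.sin (θ i) * z (Sum.inr i))
    (fun i => -Real.sin (θ i) * z (Sum.inl i) + Real.cos (θ i) * z (Sum.inr i)))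

/-- The flat torus `{r = r(z)}` through `z`; its dimension is the number of nonzero actions
of `z`. -/
def flatTorus {d : ℕ} (z : Phase d) : Set (Phase d) :=
  {w | ∀ i, action w i = action z i}

/-- `S` is a union of flat tori, each of which is invariant under `Φ`, with linear dynamics. -/
def FoliatedByInvariantTori {d : ℕ} (Φ : ℝ → Phase d → Phase d) (S : Set (Phase d)) : Prop :=
  ∀ z ∈ S, flatTorus z ⊆ S ∧
    ∃ Ω : Fin d → ℝ, ∀ w ∈ flatTorus z, ∀ t : ℝ, Φ t w = rotate (t • Ω) w

/-- The orbit of `z` accumulates on `S`. -/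
def AccumulatesOn {d : ℕ} (Φ : ℝ → Phase d → Phase d) (z : Phase d) (S : Set (Phase d)) : Prop :=
  ∃ w ∈ S, ∃ t : ℕ → ℝ, Tendsto (fun j => Φ (t j) z) atTop (𝓝 w)

/-- The orbit of `z` accumulates at infinity. -/
def AccumulatesAtInfinity {d : ℕ} (Φ : ℝ → Phase d → Phase d) (z : Phase d) : Prop :=
  ∃ t : ℕ → ℝ, Tendsto (fun j => ‖Φ (t j) z‖) atTop atTop

/-- There are orbits from arbitrarily close to the origin to arbitrarily far away. -/
def IsDiffusive {d : ℕ} (Φ : ℝ → Phase d → Phase d) : Prop :=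
  ∀ A : ℝ, 0 < A → ∃ (z : Phase d) (t₁ t₂ : ℝ), ‖Φ t₁ z‖ ≤ A⁻¹ ∧ A ≤ ‖Φ t₂ z‖

/-- The standard symplectic form `∑ dx_i ∧ dy_i`. -/
def symplecticForm {d : ℕ} (u v : Phase d) : ℝ :=
  ∑ i, (u (Sum.inl i) * v (Sum.inr i) - u (Sum.inr i) * v (Sum.inl i))

/-- `T` is an invariant Lagrangian (KAM) torus of `Φ`: an embedded `C¹` torus of dimension `d`,
parametrized by a map `φ` on `ℝ^d / (2πℤ)^d`, on which the symplectic form vanishes and on which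
the flow is conjugate by `φ` to a linear flow. -/
def IsInvariantLagrangianTorus {d : ℕ} (Φ : ℝ → Phase d → Phase d) (T : Set (Phase d)) : Prop :=
  ∃ (φ : EuclideanSpace ℝ (Fin d) → Phase d) (Ω : EuclideanSpace ℝ (Fin d)),
    ContDiff ℝ 1 φ ∧
    (∀ u v, φ u = φ v ↔ ∀ i, ∃ n : ℤ, v i = u i + 2 * Real.pi * n) ∧
    (∀ u, Function.Injective (fderiv ℝ φ u)) ∧
    (∀ u v w, symplecticForm (fderiv ℝ φ u v) (fderiv ℝ φ u w) = 0) ∧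
    (∀ t u, Φ t (φ u) = φ (u + t • Ω)) ∧
    T = Set.range φ

/-- The origin is accumulated by a positive measure set of invariant Lagrangian tori: in every
neighbourhood of the origin, the invariant Lagrangian tori that it contains fill a set of positive
(outer) Lebesgue measure. -/
def IsKAMStable {d : ℕ} (Φ : ℝ → Phase d → Phase d) : Prop :=
  ∀ U ∈ 𝓝 (0 : Phase d),
    0 < volume (⋃₀ {T : Set (Phase d) | IsInvariantLagrangianTorus Φ T ∧ T ⊆ U})

/-- The union of the sets `{r_i = 0}`, over all `i`, and `{r_k = a_n}`, over all `n`. -/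
def exceptionalSet {d : ℕ} (k : Fin d) (a : ℤ → ℝ) : Set (Phase d) :=
  {z | (∃ i, action z i = 0) ∨ ∃ n, action z k = a n}

end

/-!
The construction is by successive conjugations, in the manner of Anosov and Katok. Every
approximation is `h ∘ action ∘ G` with `h` a function of the actions and `G` a symplectic
diffeomorphism that is the identity unless all actions are positive and `r_k` avoids the levels
`a_n`. If the frequency `∇h` is orthogonal to an integer vector `κ` on an open set of actions, then
the flow of `h ∘ action` commutes there with the symplectic maps generated by `f(r) · Re M`, where
`M` is the monomial of exponent `κ`. Inserting such a map `Γ` into the conjugacy does not change the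
flow. Where `M` is purely imaginary, `Γ` moves the actions along `κ` as far as one likes. Once the
resonance is broken by a small change of `h`, each orbit of `h ∘ action` in this open set crosses
`{Re M = 0}`, so in the new coordinates its actions make an excursion along `κ` and leave a given
compact set. This persists under small perturbations, hence holds for the limit flow, and an orbit
that leaves every compact set of actions accumulates on the exceptional set or at infinity.

To keep every `a_n`, the resonances have to be available on the whole domain at once, although `∇h`
is almost constant near the origin. The actions are covered by zones, two families of pairwise
disjoint ones, treated in alternate steps. In the `m`-th zone `κ i = 2 ^ m κ k`, and `κ j` is
adjusted so that `⟨κ, ω₀⟩` vanishes after a small shift of `ω_k`; this is possible if `ω₀ j ≠ 0`.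
The boundary of the zone is made of lines parallel to `κ`, and the shift is chosen zone by zone. If
`ω₀ i` and `ω₀ j` have opposite signs and `m` is large, then `κ` is nonnegative and the excursions
lead from a neighbourhood of the origin to infinity. If `ω₀ i = ω₀ j = 0`, the Hamiltonians
`⟨ω₀, r⟩ + r_k (r_i + t r_j)` with `t` rational provide a single zone instead.
-/

noncomputable section

section PhaseSpace

variable {d : ℕ}

lemma phase_ext {u v : Phase d} (hx : ∀ i, u (Sum.inl i) = v (Sum.inl i))
    (hy : ∀ i, u (Sum.inr i) = v (Sum.inr i)) : u = v := by
  ext j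
  rcases j with i | i
  · exact hx i
  · exact hy i

lemma hasDerivAt_phase {γ : ℝ → Phase d} {γ' : Phase d} {t : ℝ}
    (h : ∀ j, HasDerivAt (fun s => γ s j) (γ' j) t) : HasDerivAt γ γ' t := by
  have hcoord : HasDerivAt (fun s => (fun j => γ s j : Fin d ⊕ Fin d → ℝ)) (fun j => γ' j) t :=
    hasDerivAt_pi.2 h
  exact (PiLp.continuousLinearEquiv 2 ℝ
    (fun _ : Fin d ⊕ Fin d => ℝ)).symm.hasFDerivAt.comp_hasDerivAt t hcoord

lemma contDiff_action : ContDiff ℝ ∞ (fun z : Phase d => action z) := by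
  refine contDiff_pi.2 fun i => ?_
  unfold action
  fun_prop

lemma continuous_action : Continuous (fun z : Phase d => action z) := contDiff_action.continuous

lemma action_nonneg (z : Phase d) (i : Fin d) : 0 ≤ action z i := by
  unfold action
  positivity

lemma norm_sq_eq_sum_action (z : Phase d) : ‖z‖ ^ 2 = 2 * ∑ i, action z i := by
  rw [EuclideanSpace.norm_sq_eq, Fintype.sum_sum_type, Finset.mul_sum, ← Finset.sum_add_distrib]
  refine Finset.sum_congr rfl fun i _ => ?_
  simp only [Real.norm_eq_abs, sq_abs, action]
  ring

/-- The frequency vector `∇h` of the integrable Hamiltonian `h(r)`, as its list of partial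
derivatives; it is `0` where `h` is not differentiable. -/
def grad (h : (Fin d → ℝ) → ℝ) (r : Fin d → ℝ) (i : Fin d) : ℝ :=
  fderiv ℝ h r (Pi.single i 1)

lemma fderiv_eq_sum_grad (h : (Fin d → ℝ) → ℝ) (r v : Fin d → ℝ) :
    fderiv ℝ h r v = ∑ i, v i * grad h r i := by
  conv_lhs => rw [pi_eq_sum_univ' v]
  simp [grad, map_sum]

lemma continuous_grad {h : (Fin d → ℝ) → ℝ} (hh : ContDiff ℝ ∞ h) : Continuous (grad h) :=
  continuous_pi fun _ => (hh.continuous_fderiv (by simp)).clm_apply continuous_const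

lemma symplecticForm_add_left (u u' v : Phase d) :
    symplecticForm (u + u') v = symplecticForm u v + symplecticForm u' v := by
  simp only [symplecticForm, PiLp.add_apply, ← Finset.sum_add_distrib]
  exact Finset.sum_congr rfl fun i _ => by ring

lemma symplecticForm_smul_left (c : ℝ) (u v : Phase d) :
    symplecticForm (c • u) v = c * symplecticForm u v := by
  simp only [symplecticForm, PiLp.smul_apply, smul_eq_mul, Finset.mul_sum]
  exact Finset.sum_congr rfl fun i _ => by ring

lemma symplecticForm_swap (u v : Phase d) : symplecticForm u v = -symplecticForm v u := by
  simp only [symplecticForm, ← Finset.sum_neg_distrib]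
  exact Finset.sum_congr rfl fun i _ => by ring

lemma symplecticForm_add_right (u v v' : Phase d) :
    symplecticForm u (v + v') = symplecticForm u v + symplecticForm u v' := by
  rw [symplecticForm_swap, symplecticForm_add_left, symplecticForm_swap v u,
    symplecticForm_swap v' u]
  ring

lemma symplecticForm_smul_right (c : ℝ) (u v : Phase d) :
    symplecticForm u (c • v) = c * symplecticForm u v := by
  rw [symplecticForm_swap, symplecticForm_smul_left, symplecticForm_swap v u]
  ring

/-- The continuous linear functional `u ↦ symplecticForm u v`, used to differentiate the
symplectic form in its first argument. -/
def symplecticFunctional (v : Phase d) : Phase d →L[ℝ] ℝ :=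
  LinearMap.toContinuousLinearMap
    { toFun := fun u => symplecticForm u v
      map_add' := fun u u' => symplecticForm_add_left u u' v
      map_smul' := fun c u => symplecticForm_smul_left c u v }

lemma symplecticForm_single_inr (u : Phase d) (i : Fin d) :
    symplecticForm u (EuclideanSpace.single (Sum.inr i) 1) = u (Sum.inl i) := by
  simp [symplecticForm]

lemma symplecticForm_single_inl (u : Phase d) (i : Fin d) :
    symplecticForm u (EuclideanSpace.single (Sum.inl i) 1) = -u (Sum.inr i) := by
  simp [symplecticForm]

lemma symplecticForm_nondegenerate {u u' : Phase d}
    (h : ∀ v, symplecticForm u v = symplecticForm u' v) : u = u' := by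
  refine phase_ext (fun i => ?_) fun i => ?_
  · simpa [symplecticForm_single_inr] using h (EuclideanSpace.single (Sum.inr i) 1)
  · simpa [symplecticForm_single_inl] using h (EuclideanSpace.single (Sum.inl i) 1)

lemma phase_eq_sum (v : Phase d) :
    v = ∑ i, (v (Sum.inl i) • EuclideanSpace.single (Sum.inl i) (1 : ℝ) +
      v (Sum.inr i) • EuclideanSpace.single (Sum.inr i) (1 : ℝ)) := by
  refine phase_ext (fun i => ?_) fun i => ?_ <;> simp [Pi.single_apply]

lemma symplecticForm_hamVectorField (H : Phase d → ℝ) (z v : Phase d) :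
    symplecticForm (hamVectorField H z) v = fderiv ℝ H z v := by
  conv_rhs => rw [phase_eq_sum v]
  simp only [symplecticForm, hamVectorField, map_sum, map_add, map_smul, smul_eq_mul,
    Sum.elim_inl, Sum.elim_inr]
  exact Finset.sum_congr rfl fun i _ => by ring

lemma contDiff_hamVectorField {H : Phase d → ℝ} (hH : ContDiff ℝ ∞ H) :
    ContDiff ℝ ∞ (hamVectorField H) := by
  have hfderiv : ContDiff ℝ ∞ (fderiv ℝ H) := hH.fderiv_right (by simp)
  refine contDiff_euclidean.2 fun j => ?_
  rcases j with i | i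
  · exact hfderiv.clm_apply contDiff_const
  · exact (hfderiv.clm_apply contDiff_const).neg

lemma norm_hamVectorField_le (H : Phase d → ℝ) (z : Phase d) :
    ‖hamVectorField H z‖ ≤ ‖fderiv ℝ H z‖ := by
  set X := hamVectorField H z with hX
  let JX : Phase d := WithLp.toLp 2 (Sum.elim (fun i => -X (Sum.inr i)) fun i => X (Sum.inl i))
  have hnorm : ‖JX‖ ^ 2 = ‖X‖ ^ 2 := by
    rw [norm_sq_eq_sum_action, norm_sq_eq_sum_action]
    refine congrArg _ (Finset.sum_congr rfl fun i _ => ?_)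
    simp only [action, JX, Sum.elim_inl, Sum.elim_inr]
    ring
  have hform : symplecticForm X JX = ‖X‖ ^ 2 := by
    rw [norm_sq_eq_sum_action, Finset.mul_sum]
    refine Finset.sum_congr rfl fun i _ => ?_
    simp only [action, JX, Sum.elim_inl, Sum.elim_inr]
    ring
  rw [sq_eq_sq₀ (norm_nonneg _) (norm_nonneg _)] at hnorm
  rw [hX, symplecticForm_hamVectorField, ← hX] at hform
  have hle : ‖X‖ ^ 2 ≤ ‖fderiv ℝ H z‖ * ‖X‖ := by
    rw [← hform, ← hnorm]
    exact (le_abs_self _).trans ((fderiv ℝ H z).le_opNorm JX)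
  rcases (norm_nonneg X).eq_or_lt with h0 | h0
  · exact h0 ▸ norm_nonneg _
  · exact le_of_mul_le_mul_right (by rwa [← sq]) h0

lemma hamVectorField_sub {H H' : Phase d → ℝ} {z : Phase d} (h : DifferentiableAt ℝ H z)
    (h' : DifferentiableAt ℝ H' z) :
    hamVectorField H z - hamVectorField H' z = hamVectorField (fun w => H w - H' w) z := by
  have hsub : fderiv ℝ (fun w => H w - H' w) z = fderiv ℝ H z - fderiv ℝ H' z :=
    fderiv_fun_sub h h'
  refine phase_ext (fun i => ?_) fun i => ?_
  · simp [hamVectorField, hsub]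
  · simp only [hamVectorField, hsub, PiLp.sub_apply, Sum.elim_inr, sub_apply]
    ring

end PhaseSpace

section Rotations

variable {d : ℕ}

@[simp] lemma rotate_inl (θ : Fin d → ℝ) (z : Phase d) (i : Fin d) :
    rotate θ z (Sum.inl i) =
      Real.cos (θ i) * z (Sum.inl i) + Real.sin (θ i) * z (Sum.inr i) := rfl

@[simp] lemma rotate_inr (θ : Fin d → ℝ) (z : Phase d) (i : Fin d) :
    rotate θ z (Sum.inr i) =
      -Real.sin (θ i) * z (Sum.inl i) + Real.cos (θ i) * z (Sum.inr i) := rfl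

@[simp] lemma action_rotate (θ : Fin d → ℝ) (z : Phase d) : action (rotate θ z) = action z := by
  funext i
  simp only [action, rotate_inl, rotate_inr]
  have := Real.sin_sq_add_cos_sq (θ i)
  linear_combination ((z (Sum.inl i)) ^ 2 + (z (Sum.inr i)) ^ 2) / 2 * this

@[simp] lemma rotate_zero (z : Phase d) : rotate 0 z = z := by
  refine phase_ext (fun i => ?_) fun i => ?_ <;> simp

lemma rotate_rotate (θ θ' : Fin d → ℝ) (z : Phase d) :
    rotate θ (rotate θ' z) = rotate (θ + θ') z := by
  refine phase_ext (fun i => ?_) fun i => ?_ <;>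
    simp only [rotate_inl, rotate_inr, Pi.add_apply, Real.cos_add, Real.sin_add] <;> ring

lemma continuous_rotate : Continuous (fun p : (Fin d → ℝ) × Phase d => rotate p.1 p.2) := by
  unfold rotate
  refine (PiLp.continuous_toLp 2 _).comp (continuous_pi fun j => ?_)
  rcases j with i | i <;> simp only [Sum.elim_inl, Sum.elim_inr] <;> fun_prop

/-- The map `rotate θ` bundled as a continuous linear map. -/
def rotateCLM (θ : Fin d → ℝ) : Phase d →L[ℝ] Phase d :=
  LinearMap.toContinuousLinearMap
    { toFun := rotate θ
      map_add' := fun u v => by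
        refine phase_ext (fun i => ?_) fun i => ?_ <;>
          simp only [rotate_inl, rotate_inr, PiLp.add_apply] <;> ring
      map_smul' := fun c u => by
        refine phase_ext (fun i => ?_) fun i => ?_ <;>
          simp only [rotate_inl, rotate_inr, PiLp.smul_apply, smul_eq_mul, RingHom.id_apply] <;>
          ring }

@[simp] lemma rotateCLM_apply (θ : Fin d → ℝ) (z : Phase d) : rotateCLM θ z = rotate θ z := rfl

lemma symplecticForm_rotate (θ : Fin d → ℝ) (u v : Phase d) :
    symplecticForm (rotate θ u) (rotate θ v) = symplecticForm u v := by
  refine Finset.sum_congr rfl fun i _ => ?_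
  simp only [rotate_inl, rotate_inr]
  have := Real.sin_sq_add_cos_sq (θ i)
  linear_combination (u (Sum.inl i) * v (Sum.inr i) - u (Sum.inr i) * v (Sum.inl i)) * this

/-- The flow of the integrable Hamiltonian `h ∘ action`: each torus `{r = c}` is rotated with
frequency `∇h(c)`. -/
def actionFlow (h : (Fin d → ℝ) → ℝ) (t : ℝ) (z : Phase d) : Phase d :=
  rotate (t • grad h (action z)) z

@[simp] lemma action_actionFlow (h : (Fin d → ℝ) → ℝ) (t : ℝ) (z : Phase d) :
    action (actionFlow h t z) = action z := action_rotate _ _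

lemma fderiv_action_apply (z v : Phase d) :
    fderiv ℝ (fun w : Phase d => action w) z v =
      fun i => z (Sum.inl i) * v (Sum.inl i) + z (Sum.inr i) * v (Sum.inr i) := by
  let coord : Fin d ⊕ Fin d → Phase d →L[ℝ] ℝ := fun j => EuclideanSpace.proj j
  have hact : HasFDerivAt (fun w : Phase d => action w)
      (ContinuousLinearMap.pi fun i : Fin d =>
        z (Sum.inl i) • coord (Sum.inl i) + z (Sum.inr i) • coord (Sum.inr i)) z := by
    refine hasFDerivAt_pi.2 fun i => ?_
    simp only [action, div_eq_mul_inv]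
    refine ((((coord (Sum.inl i)).hasFDerivAt.pow 2).add
      ((coord (Sum.inr i)).hasFDerivAt.pow 2)).mul_const 2⁻¹).congr_fderiv ?_
    ext w
    simp [coord]
    ring
  rw [hact.fderiv]
  rfl

lemma fderiv_comp_action_apply {h : (Fin d → ℝ) → ℝ} {z : Phase d}
    (hh : DifferentiableAt ℝ h (action z)) (v : Phase d) :
    fderiv ℝ (fun w : Phase d => h (action w)) z v =
      ∑ i, (z (Sum.inl i) * v (Sum.inl i) + z (Sum.inr i) * v (Sum.inr i)) *
        grad h (action z) i := by
  have hcomp := fderiv_comp (g := h) (f := fun w : Phase d => action w) z hh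
    (contDiff_action.differentiable (by simp) z)
  rw [← fderiv_eq_sum_grad h (action z), ← fderiv_action_apply]
  exact congrArg (fun L : Phase d →L[ℝ] ℝ => L v) hcomp

lemma hamVectorField_comp_action {h : (Fin d → ℝ) → ℝ} {z : Phase d}
    (hh : DifferentiableAt ℝ h (action z)) :
    hamVectorField (fun w => h (action w)) z =
      WithLp.toLp 2 (Sum.elim (fun i => grad h (action z) i * z (Sum.inr i))
        (fun i => -(grad h (action z) i * z (Sum.inl i)))) := by
  refine phase_ext (fun i => ?_) fun i => ?_ <;>
    simp [hamVectorField, fderiv_comp_action_apply hh, mul_comm]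

lemma hasDerivAt_actionFlow {h : (Fin d → ℝ) → ℝ} (hh : Differentiable ℝ h) (z : Phase d)
    (t : ℝ) :
    HasDerivAt (fun s => actionFlow h s z)
      (hamVectorField (fun w => h (action w)) (actionFlow h t z)) t := by
  rw [hamVectorField_comp_action (hh _)]
  have hangle : ∀ i, HasDerivAt (fun s : ℝ => s * grad h (action z) i) (grad h (action z) i) t :=
    fun i => by simpa using (hasDerivAt_id t).mul_const (grad h (action z) i)
  refine hasDerivAt_phase fun j => ?_
  rcases j with i | i
  · refine (((hangle i).cos.mul_const (z (Sum.inl i))).add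
      ((hangle i).sin.mul_const (z (Sum.inr i)))).congr_deriv ?_
    simp [actionFlow]
    ring
  · refine (((hangle i).sin.neg.mul_const (z (Sum.inl i))).add
      ((hangle i).cos.mul_const (z (Sum.inr i)))).congr_deriv ?_
    simp [actionFlow]
    ring

end Rotations

section Symplectic

variable {d : ℕ}

/-- `G` is a smooth symplectic diffeomorphism of the phase space. These are the coordinate changes
that carry Hamiltonian flows to Hamiltonian flows. -/
structure IsSymplectic (G : Phase d ≃ Phase d) : Prop where
  contDiff : ContDiff ℝ ∞ G
  contDiff_symm : ContDiff ℝ ∞ G.symm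
  form : ∀ z u v, symplecticForm (fderiv ℝ G z u) (fderiv ℝ G z v) = symplecticForm u v

lemma IsSymplectic.refl : IsSymplectic (Equiv.refl (Phase d)) where
  contDiff := contDiff_id
  contDiff_symm := contDiff_id
  form z u v := by
    have : fderiv ℝ (Equiv.refl (Phase d)) z = ContinuousLinearMap.id ℝ _ := fderiv_id
    rw [this]
    rfl

lemma IsSymplectic.trans {G G' : Phase d ≃ Phase d} (hG : IsSymplectic G)
    (hG' : IsSymplectic G') : IsSymplectic (G.trans G') where
  contDiff := hG'.contDiff.comp hG.contDiff
  contDiff_symm := hG.contDiff_symm.comp hG'.contDiff_symm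
  form z u v := by
    have : fderiv ℝ (G.trans G') z = (fderiv ℝ G' (G z)).comp (fderiv ℝ G z) :=
      fderiv_comp z (hG'.contDiff.differentiable (by simp) _)
        (hG.contDiff.differentiable (by simp) _)
    rw [this]
    simp [hG'.form, hG.form]

lemma fderiv_apply_fderiv_symm {G : Phase d ≃ Phase d} (hG : ContDiff ℝ ∞ G)
    (hG' : ContDiff ℝ ∞ G.symm) (z u : Phase d) :
    fderiv ℝ G (G.symm z) (fderiv ℝ G.symm z u) = u := by
  have hcomp : fderiv ℝ (G ∘ G.symm) z = (fderiv ℝ G (G.symm z)).comp (fderiv ℝ G.symm z) :=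
    fderiv_comp z (hG.differentiable (by simp) _) (hG'.differentiable (by simp) _)
  rw [G.self_comp_symm, fderiv_id] at hcomp
  exact (congrArg (fun A : Phase d →L[ℝ] Phase d => A u) hcomp).symm

lemma IsSymplectic.symm {G : Phase d ≃ Phase d} (hG : IsSymplectic G) :
    IsSymplectic G.symm where
  contDiff := hG.contDiff_symm
  contDiff_symm := hG.contDiff
  form z u v := by
    rw [← hG.form (G.symm z), fderiv_apply_fderiv_symm hG.contDiff hG.contDiff_symm,
      fderiv_apply_fderiv_symm hG.contDiff hG.contDiff_symm]

lemma isSymplectic_symm_trans {G G' : Phase d ≃ Phase d} (hG : ContDiff ℝ ∞ G)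
    (hG_symm : ContDiff ℝ ∞ G.symm) (hG' : ContDiff ℝ ∞ G') (hG'_symm : ContDiff ℝ ∞ G'.symm)
    (hform : ∀ z u v, symplecticForm (fderiv ℝ G' z u) (fderiv ℝ G' z v) =
      symplecticForm (fderiv ℝ G z u) (fderiv ℝ G z v)) :
    IsSymplectic (G.symm.trans G') where
  contDiff := hG'.comp hG_symm
  contDiff_symm := hG.comp hG'_symm
  form z u v := by
    have hcomp : fderiv ℝ (G.symm.trans G') z =
        (fderiv ℝ G' (G.symm z)).comp (fderiv ℝ G.symm z) :=
      fderiv_comp z (hG'.differentiable (by simp) _) (hG_symm.differentiable (by simp) _)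
    simp only [hcomp, ContinuousLinearMap.comp_apply, hform,
      fderiv_apply_fderiv_symm hG hG_symm]

lemma IsSymplectic.fderiv_hamVectorField {G : Phase d ≃ Phase d} (hG : IsSymplectic G)
    {f : Phase d → ℝ} {z : Phase d} (hf : DifferentiableAt ℝ f (G z)) :
    fderiv ℝ G.symm (G z) (hamVectorField f (G z)) = hamVectorField (fun w => f (G w)) z := by
  refine symplecticForm_nondegenerate fun v => ?_
  have hchain : fderiv ℝ (fun w => f (G w)) z = (fderiv ℝ f (G z)).comp (fderiv ℝ G z) :=
    fderiv_comp z hf (hG.contDiff.differentiable (by simp) _)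
  have hv : fderiv ℝ G.symm (G z) (fderiv ℝ G z v) = v :=
    fderiv_apply_fderiv_symm hG.contDiff_symm hG.contDiff z v
  calc symplecticForm (fderiv ℝ G.symm (G z) (hamVectorField f (G z))) v
      = symplecticForm (hamVectorField f (G z)) (fderiv ℝ G z v) := by
        conv_lhs => rw [← hv]
        rw [hG.symm.form]
    _ = fderiv ℝ (fun w => f (G w)) z v := by
        rw [symplecticForm_hamVectorField, hchain]
        rfl
    _ = symplecticForm (hamVectorField (fun w => f (G w)) z) v :=
        (symplecticForm_hamVectorField _ _ _).symm

/-- The flow of the Hamiltonian `h ∘ action ∘ G`, which is integrable in the coordinates `G`. -/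
def conjFlow (h : (Fin d → ℝ) → ℝ) (G : Phase d ≃ Phase d) (t : ℝ) (z : Phase d) : Phase d :=
  G.symm (actionFlow h t (G z))

lemma conjFlow_zero (h : (Fin d → ℝ) → ℝ) (G : Phase d ≃ Phase d) (z : Phase d) :
    conjFlow h G 0 z = z := by
  simp [conjFlow, actionFlow]

lemma hasDerivAt_conjFlow {h : (Fin d → ℝ) → ℝ} (hh : Differentiable ℝ h)
    {G : Phase d ≃ Phase d} (hG : IsSymplectic G) (z : Phase d) (t : ℝ) :
    HasDerivAt (fun s => conjFlow h G s z)
      (hamVectorField (fun w => h (action (G w))) (conjFlow h G t z)) t := by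
  have hact : Differentiable ℝ fun w : Phase d => h (action w) :=
    hh.comp (contDiff_action.differentiable (by simp))
  rw [← hG.fderiv_hamVectorField (hact _), conjFlow, Equiv.apply_symm_apply]
  exact (hG.contDiff_symm.differentiable (by simp) _).hasFDerivAt.comp_hasDerivAt t
    (hasDerivAt_actionFlow hh (G z) t)

end Symplectic

section Midpoint

lemma exists_homeomorph_id_sub {E : Type*} [NormedAddCommGroup E] [NormedSpace ℝ E]
    [CompleteSpace E] {W : E → E} (hW : ContDiff ℝ ∞ W) {c : NNReal} (hc : c < 1)
    (hL : LipschitzWith c W) :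
    ∃ e : E ≃ₜ E, (∀ x, e x = x - W x) ∧ ContDiff ℝ ∞ e.symm := by
  have happrox : ApproximatesLinearOn (fun x => x - W x)
      ((ContinuousLinearEquiv.refl ℝ E : E ≃L[ℝ] E) : E →L[ℝ] E) Set.univ c := by
    intro x _ y _
    have hdist := hL.dist_le_mul y x
    rw [dist_eq_norm, dist_eq_norm, norm_sub_rev y x] at hdist
    refine le_trans (le_of_eq (congrArg norm ?_)) hdist
    simp only [ContinuousLinearEquiv.coe_refl, ContinuousLinearMap.coe_id', id_eq]
    abel
  have hc' : Subsingleton E ∨ c < ‖((ContinuousLinearEquiv.refl ℝ E).symm : E →L[ℝ] E)‖₊⁻¹ := by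
    refine (subsingleton_or_nontrivial E).imp_right fun _ : Nontrivial E => ?_
    have hnorm : ‖((ContinuousLinearEquiv.refl ℝ E).symm : E →L[ℝ] E)‖₊ = 1 :=
      NNReal.eq (by simp)
    simpa only [hnorm, inv_one] using hc
  have hlt : ∀ a, ‖fderiv ℝ W a‖ < 1 := fun a =>
    (norm_fderiv_le_of_lipschitz ℝ hL).trans_lt (by exact_mod_cast hc)
  have hderiv : ∀ a, HasFDerivAt (fun x => x - W x) (ContinuousLinearMap.id ℝ E - fderiv ℝ W a) a :=
    fun a => (hasFDerivAt_id a).sub (hW.differentiable (by simp) a).hasFDerivAt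
  exact ⟨happrox.toHomeomorph _ hc', fun x => rfl, Homeomorph.contDiff_symm _ (f₀' := fun a =>
    ContinuousLinearEquiv.unitsEquiv ℝ E (Units.oneSub (fderiv ℝ W a) (hlt a))) hderiv
    (contDiff_id.sub hW)⟩

variable {d : ℕ}

lemma symplecticForm_fderiv_hamVectorField {F : Phase d → ℝ} (hF : ContDiff ℝ ∞ F)
    (m u v : Phase d) :
    symplecticForm (fderiv ℝ (hamVectorField F) m u) v = fderiv ℝ (fderiv ℝ F) m u v := by
  have hform : HasFDerivAt (fun z => symplecticForm (hamVectorField F z) v)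
      ((symplecticFunctional v).comp (fderiv ℝ (hamVectorField F) m)) m :=
    (symplecticFunctional v).hasFDerivAt.comp m
      ((contDiff_hamVectorField hF).differentiable (by simp) m).hasFDerivAt
  have hsnd : HasFDerivAt (fun z => fderiv ℝ F z v) ((fderiv ℝ (fderiv ℝ F) m).flip v) m := by
    have hD : DifferentiableAt ℝ (fderiv ℝ F) m :=
      (hF.fderiv_right (m := ∞) (by simp)).differentiable (by simp) m
    simpa using hD.hasFDerivAt.clm_apply (hasFDerivAt_const v m)
  simp only [symplecticForm_hamVectorField] at hform
  exact congrArg (fun A : Phase d →L[ℝ] ℝ => A u) (hform.unique hsnd)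

lemma symplecticForm_fderiv_hamVectorField_add_eq_zero {F : Phase d → ℝ} (hF : ContDiff ℝ ∞ F)
    (m u v : Phase d) :
    symplecticForm (fderiv ℝ (hamVectorField F) m u) v +
      symplecticForm u (fderiv ℝ (hamVectorField F) m v) = 0 := by
  have hsymm := (hF.contDiffAt (x := m)).isSymmSndFDerivAt
    (by
      rw [minSmoothness_of_isRCLikeNormedField]
      exact WithTop.coe_le_coe.2 (le_top : (2 : ℕ∞) ≤ ⊤)) u v
  rw [symplecticForm_swap u, symplecticForm_fderiv_hamVectorField hF,
    symplecticForm_fderiv_hamVectorField hF, hsymm, add_neg_cancel]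

lemma symplecticForm_add_smul_eq_sub_smul {B : Phase d → Phase d}
    (hB : ∀ u v, symplecticForm (B u) v + symplecticForm u (B v) = 0) (τ : ℝ) (u v : Phase d) :
    symplecticForm (u + τ • B u) (v + τ • B v) = symplecticForm (u - τ • B u) (v - τ • B v) := by
  simp only [sub_eq_add_neg, ← neg_smul, symplecticForm_add_left, symplecticForm_add_right,
    symplecticForm_smul_left, symplecticForm_smul_right]
  linear_combination 2 * τ * hB u v

/-- `γ` is the implicit midpoint map with step `2 τ` of the Hamiltonian vector field of `F`, and
`m z` is the midpoint between `z` and `γ z`. It replaces the time-`2 τ` map of the flow of `F`: it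
is symplectic as well, and it exists as soon as `τ • hamVectorField F` is a contraction. -/
structure IsMidpointMap (F : Phase d → ℝ) (τ : ℝ) (γ : Phase d ≃ Phase d)
    (m : Phase d → Phase d) : Prop where
  lipschitz : LipschitzWith (1 / 2) (fun z => τ • hamVectorField F z)
  symplectic : IsSymplectic γ
  continuous_mid : Continuous m
  mid : ∀ z, m z = z + τ • hamVectorField F (m z)
  map : ∀ z, γ z = m z + τ • hamVectorField F (m z)

lemma exists_isMidpointMap {F : Phase d → ℝ} (hF : ContDiff ℝ ∞ F) {τ : ℝ}
    (hL : LipschitzWith (1 / 2) (fun z => τ • hamVectorField F z)) :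
    ∃ γ m, IsMidpointMap F τ γ m := by
  have hV := contDiff_hamVectorField hF
  have hW : ContDiff ℝ ∞ (fun z => τ • hamVectorField F z) := hV.const_smul τ
  obtain ⟨e, he, he_symm⟩ := exists_homeomorph_id_sub hW (by norm_num) hL
  obtain ⟨e', he', he'_symm⟩ := exists_homeomorph_id_sub hW.neg (by norm_num) hL.neg
  simp only [sub_neg_eq_add] at he'
  have hce : ContDiff ℝ ∞ e := by
    rw [funext he]
    exact contDiff_id.sub hW
  have hce' : ContDiff ℝ ∞ e' := by
    rw [funext he']
    exact contDiff_id.add hW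
  have hderiv : ∀ m, HasFDerivAt (fun z => τ • hamVectorField F z)
      (τ • fderiv ℝ (hamVectorField F) m) m := fun m =>
    (hV.differentiable (by simp) m).hasFDerivAt.const_smul τ
  have hde : ∀ m u, fderiv ℝ e m u = u - τ • fderiv ℝ (hamVectorField F) m u := fun m u => by
    rw [funext he]
    exact DFunLike.congr_fun ((hasFDerivAt_id m).sub (hderiv m)).fderiv u
  have hde' : ∀ m u, fderiv ℝ e' m u = u + τ • fderiv ℝ (hamVectorField F) m u := fun m u => by
    rw [funext he']
    exact DFunLike.congr_fun ((hasFDerivAt_id m).add (hderiv m)).fderiv u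
  have hsymp : IsSymplectic (e.toEquiv.symm.trans e'.toEquiv) :=
    isSymplectic_symm_trans hce he_symm hce' he'_symm fun m u v => by
      simp only [Homeomorph.coe_toEquiv, hde, hde']
      exact symplecticForm_add_smul_eq_sub_smul
        (symplecticForm_fderiv_hamVectorField_add_eq_zero hF m) τ u v
  exact ⟨_, e.symm, hL, hsymp, e.symm.continuous,
    fun z => eq_add_of_sub_eq ((he _).symm.trans (e.apply_symm_apply z)), fun z => he' _⟩

namespace IsMidpointMap

variable {F : Phase d → ℝ} {τ : ℝ} {γ : Phase d ≃ Phase d} {m : Phase d → Phase d}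

lemma eq_mid (h : IsMidpointMap F τ γ m) {z y : Phase d}
    (hy : y = z + τ • hamVectorField F y) : y = m z := by
  have hdist : dist y (m z) = dist (τ • hamVectorField F y) (τ • hamVectorField F (m z)) := by
    conv_lhs => rw [hy, h.mid z, dist_add_left]
  have hle := h.lipschitz.dist_le_mul y (m z)
  rw [← hdist] at hle
  push_cast at hle
  exact dist_le_zero.1 (by linarith)

lemma map_eq_self (h : IsMidpointMap F τ γ m) {z : Phase d}
    (hz : hamVectorField F (m z) = 0) : γ z = z := by
  have hmid := h.mid z
  have hmap := h.map z
  rw [hz, smul_zero, add_zero] at hmid hmap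
  rw [hmap, hmid]

lemma action_map (h : IsMidpointMap F τ γ m) (z : Phase d) (i : Fin d) :
    action (γ z) i = action z i + 2 * τ *
      (m z (Sum.inl i) * hamVectorField F (m z) (Sum.inl i) +
        m z (Sum.inr i) * hamVectorField F (m z) (Sum.inr i)) := by
  have hz : ∀ j, z j = m z j - τ * hamVectorField F (m z) j := fun j =>
    congrArg (fun w : Phase d => w j) (eq_sub_of_add_eq (h.mid z).symm)
  rw [h.map z]
  simp only [action, PiLp.add_apply, PiLp.smul_apply, smul_eq_mul, hz (Sum.inl i),
    hz (Sum.inr i)]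
  ring

lemma mem_of_mapsTo (h : IsMidpointMap F τ γ m) {z : Phase d} {s : Set (Phase d)}
    (hs : IsClosed s) (hz : z ∈ s) (hm : ∀ y ∈ s, z + τ • hamVectorField F y ∈ s) : m z ∈ s := by
  have hcontr : ContractingWith (1 / 2) fun y => z + τ • hamVectorField F y :=
    ⟨by norm_num, LipschitzWith.of_dist_le_mul fun x y => by
      simpa only [dist_add_left] using h.lipschitz.dist_le_mul x y⟩
  obtain ⟨y, hys, hy, -⟩ := ContractingWith.exists_fixedPoint' hs.isComplete hm
    (hcontr.restrict hm) hz (edist_ne_top _ _)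
  rw [← h.eq_mid (z := z) (y := y) hy.symm]
  exact hys

end IsMidpointMap

end Midpoint

section Cutoff

variable {d : ℕ}

lemma isCompact_preimage_action {K : Set (Fin d → ℝ)} (hK : IsCompact K) :
    IsCompact {z : Phase d | action z ∈ K} := by
  refine Metric.isCompact_of_isClosed_isBounded (hK.isClosed.preimage continuous_action) ?_
  obtain ⟨R, hR⟩ := (hK.image (f := fun r : Fin d → ℝ => 2 * ∑ i, r i)
    (by fun_prop)).isBounded.exists_norm_le
  refine (Metric.isBounded_closedBall (x := (0 : Phase d)) (r := R + 1)).subset fun z hz => ?_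
  rw [mem_closedBall_zero_iff]
  have hsq : ‖z‖ ^ 2 ≤ R := by
    rw [norm_sq_eq_sum_action]
    exact (le_abs_self _).trans (hR _ ⟨action z, hz, rfl⟩)
  nlinarith [norm_nonneg z]

lemma exists_bump {E : Type*} [NormedAddCommGroup E] [NormedSpace ℝ E] [FiniteDimensional ℝ E]
    {K O : Set E} (hK : IsCompact K) (hO : IsOpen O) (hKO : K ⊆ O) :
    ∃ f : E → ℝ, ContDiff ℝ ∞ f ∧ HasCompactSupport f ∧ tsupport f ⊆ O ∧ (∀ x, 0 ≤ f x) ∧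
      (∀ x, f x ≤ 1) ∧ ∀ x ∈ K, f x = 1 := by
  obtain ⟨δ, hδ, hsub⟩ := hK.exists_cthickening_subset_open hO hKO
  obtain ⟨f, hone, hzero, hf⟩ := exists_contMDiffMap_one_nhds_of_subset_interior
    (n := ⊤) (modelWithCornersSelf ℝ E) hK.isClosed
    (t := Metric.cthickening δ K)
    ((Metric.self_subset_thickening hδ K).trans
      (interior_maximal (Metric.thickening_subset_cthickening δ K) Metric.isOpen_thickening))
  have hsupp : tsupport f ⊆ Metric.cthickening δ K :=
    closure_minimal (fun x hx => not_imp_comm.1 (hzero x) hx) Metric.isClosed_cthickening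
  exact ⟨f, f.contMDiff.contDiff, hK.cthickening.of_isClosed_subset (isClosed_tsupport _) hsupp,
    hsupp.trans hsub, fun x => (hf x).1, fun x => (hf x).2,
    fun x hx => hone.self_of_nhdsSet x hx⟩

end Cutoff

section Monomial

variable {d : ℕ}

/-- The complex coordinate `x_i - √-1 y_i`. The sign is chosen so that `rotate θ` multiplies it by
`exp (√-1 θ_i)`. -/
def complexCoord (i : Fin d) (z : Phase d) : ℂ :=
  (z (Sum.inl i) : ℂ) - (z (Sum.inr i) : ℂ) * Complex.I

/-- The monomial in the complex coordinates and their conjugates on which `rotate θ` acts through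
the character `exp (√-1 ⟨κ, θ⟩)`: a negative exponent is a power of the conjugate coordinate. -/
def monomial (κ : Fin d → ℤ) (z : Phase d) : ℂ :=
  ∏ i, if 0 ≤ κ i then complexCoord i z ^ (κ i).natAbs
    else (starRingEnd ℂ (complexCoord i z)) ^ (κ i).natAbs

/-- The point `scaleMap z t` is `z` with each plane `(x_i, y_i)` multiplied by `t_i`. As a linear
map in `t`, its image is the space of radial directions at `z`. -/
def scaleMap (z : Phase d) : (Fin d → ℝ) →ₗ[ℝ] Phase d where
  toFun t := WithLp.toLp 2 (Sum.elim (fun i => t i * z (Sum.inl i)) (fun i => t i * z (Sum.inr i)))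
  map_add' t s := by
    refine phase_ext (fun i => ?_) fun i => ?_ <;> simp [add_mul]
  map_smul' c t := by
    refine phase_ext (fun i => ?_) fun i => ?_ <;> simp [mul_assoc]

@[simp] lemma scaleMap_inl (z : Phase d) (t : Fin d → ℝ) (i : Fin d) :
    scaleMap z t (Sum.inl i) = t i * z (Sum.inl i) := rfl

@[simp] lemma scaleMap_inr (z : Phase d) (t : Fin d → ℝ) (i : Fin d) :
    scaleMap z t (Sum.inr i) = t i * z (Sum.inr i) := rfl

lemma scaleMap_one (z : Phase d) : scaleMap z 1 = z := by
  refine phase_ext (fun i => ?_) fun i => ?_ <;> simp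

lemma scaleMap_scaleMap (z : Phase d) (t s : Fin d → ℝ) :
    scaleMap (scaleMap z t) s = scaleMap z (s * t) := by
  refine phase_ext (fun i => ?_) fun i => ?_ <;> simp [mul_assoc]

lemma action_scaleMap (z : Phase d) (t : Fin d → ℝ) (i : Fin d) :
    action (scaleMap z t) i = t i ^ 2 * action z i := by
  simp only [action, scaleMap_inl, scaleMap_inr]
  ring

lemma contDiff_complexCoord (i : Fin d) : ContDiff ℝ ∞ (complexCoord (d := d) i) := by
  have hx : ContDiff ℝ ∞ (fun z : Phase d => ((z (Sum.inl i) : ℝ) : ℂ)) :=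
    Complex.ofRealCLM.contDiff.comp (by fun_prop)
  have hy : ContDiff ℝ ∞ (fun z : Phase d => ((z (Sum.inr i) : ℝ) : ℂ)) :=
    Complex.ofRealCLM.contDiff.comp (by fun_prop)
  exact hx.sub (hy.mul contDiff_const)

lemma complexCoord_rotate (θ : Fin d → ℝ) (z : Phase d) (i : Fin d) :
    complexCoord i (rotate θ z) = Complex.exp (θ i * Complex.I) * complexCoord i z := by
  rw [Complex.exp_mul_I, ← Complex.ofReal_cos, ← Complex.ofReal_sin]
  apply Complex.ext <;> simp [complexCoord]

lemma complexCoord_scaleMap (z : Phase d) (t : Fin d → ℝ) (i : Fin d) :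
    complexCoord i (scaleMap z t) = (t i : ℂ) * complexCoord i z := by
  simp only [complexCoord, scaleMap_inl, scaleMap_inr, Complex.ofReal_mul]
  ring

lemma complexCoord_ne_zero {z : Phase d} {i : Fin d} (hz : 0 < action z i) :
    complexCoord i z ≠ 0 := by
  intro h
  have hx : z (Sum.inl i) = 0 := by simpa [complexCoord] using congrArg Complex.re h
  have hy : z (Sum.inr i) = 0 := by simpa [complexCoord] using congrArg Complex.im h
  simp [action, hx, hy] at hz

lemma contDiff_monomial (κ : Fin d → ℤ) : ContDiff ℝ ∞ (monomial κ) := by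
  refine contDiff_prod fun i _ => ?_
  split_ifs
  · exact (contDiff_complexCoord i).pow _
  · exact (Complex.conjCLE.contDiff.comp (contDiff_complexCoord i)).pow _

lemma monomial_rotate (κ : Fin d → ℤ) (θ : Fin d → ℝ) (z : Phase d) :
    monomial κ (rotate θ z) =
      Complex.exp (((∑ i, κ i * θ i : ℝ) : ℂ) * Complex.I) * monomial κ z := by
  rw [Complex.ofReal_sum, Finset.sum_mul, Complex.exp_sum, monomial, monomial,
    ← Finset.prod_mul_distrib]
  refine Finset.prod_congr rfl fun i _ => ?_
  rw [complexCoord_rotate]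
  split_ifs with hκ
  · rw [mul_pow, ← Complex.exp_nat_mul, Nat.cast_natAbs, abs_of_nonneg hκ]
    push_cast
    ring_nf
  · rw [map_mul, ← Complex.exp_conj, mul_pow, ← Complex.exp_nat_mul, Nat.cast_natAbs,
      abs_of_neg (not_le.1 hκ), map_mul, Complex.conj_I, Complex.conj_ofReal]
    push_cast
    ring_nf

lemma monomial_scaleMap (κ : Fin d → ℤ) (z : Phase d) (t : Fin d → ℝ) :
    monomial κ (scaleMap z t) = ((∏ i, t i ^ (κ i).natAbs : ℝ) : ℂ) * monomial κ z := by
  rw [monomial, monomial, Complex.ofReal_prod, ← Finset.prod_mul_distrib]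
  refine Finset.prod_congr rfl fun i _ => ?_
  rw [complexCoord_scaleMap]
  split_ifs
  · rw [mul_pow, Complex.ofReal_pow]
  · rw [map_mul, mul_pow, Complex.conj_ofReal, Complex.ofReal_pow]

lemma monomial_ne_zero (κ : Fin d → ℤ) {z : Phase d} (hz : ∀ i, 0 < action z i) :
    monomial κ z ≠ 0 := by
  refine Finset.prod_ne_zero_iff.2 fun i _ => ?_
  split_ifs
  · exact pow_ne_zero _ (complexCoord_ne_zero (hz i))
  · exact pow_ne_zero _ ((map_ne_zero _).2 (complexCoord_ne_zero (hz i)))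

end Monomial

section ResonantHam

variable {d : ℕ}

lemma hasDerivAt_rotate_single (z : Phase d) (i : Fin d) :
    HasDerivAt (fun s : ℝ => rotate (Pi.single i s) z)
      (WithLp.toLp 2
        (Sum.elim (Pi.single i (z (Sum.inr i))) (Pi.single i (-z (Sum.inl i))))) 0 := by
  have hcos := (hasDerivAt_id (0 : ℝ)).cos
  have hsin := (hasDerivAt_id (0 : ℝ)).sin
  refine hasDerivAt_phase fun j => ?_
  rcases j with j | j <;> rcases eq_or_ne j i with rfl | hj <;>
    simp only [rotate_inl, rotate_inr, Pi.single_eq_same, Sum.elim_inl, Sum.elim_inr]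
  · exact ((hcos.mul_const (z (Sum.inl j))).add (hsin.mul_const (z (Sum.inr j)))).congr_deriv
      (by simp)
  · simpa [hj] using hasDerivAt_const (0 : ℝ) (z (Sum.inl j))
  · exact ((hsin.neg.mul_const (z (Sum.inl j))).add (hcos.mul_const (z (Sum.inr j)))).congr_deriv
      (by simp)
  · simpa [hj] using hasDerivAt_const (0 : ℝ) (z (Sum.inr j))

lemma radial_hamVectorField_eq_of_hasDerivAt {F : Phase d → ℝ} {z : Phase d}
    (hF : DifferentiableAt ℝ F z) {i : Fin d} {F' : ℝ}
    (hF' : HasDerivAt (fun s : ℝ => F (rotate (Pi.single i s) z)) F' 0) :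
    z (Sum.inl i) * hamVectorField F z (Sum.inl i) +
      z (Sum.inr i) * hamVectorField F z (Sum.inr i) = -F' := by
  have hF₀ : HasFDerivAt F (fderiv ℝ F z) (rotate (Pi.single i (0 : ℝ)) z) := by
    simpa using hF.hasFDerivAt
  rw [hF'.unique (hF₀.comp_hasDerivAt 0 (hasDerivAt_rotate_single z i)),
    ← symplecticForm_hamVectorField, symplecticForm, Finset.sum_eq_single i]
  · simp only [Sum.elim_inl, Sum.elim_inr, Pi.single_eq_same]
    ring
  · intro j _ hj
    simp [hj]
  · simp

lemma angular_hamVectorField_eq_of_hasDerivAt {F : Phase d → ℝ} {z : Phase d}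
    (hF : DifferentiableAt ℝ F z) {i : Fin d} {F' : ℝ}
    (hF' : HasDerivAt (fun s : ℝ => F (scaleMap z (1 + s • Pi.single i 1))) F' 0) :
    hamVectorField F z (Sum.inl i) * z (Sum.inr i) -
      hamVectorField F z (Sum.inr i) * z (Sum.inl i) = F' := by
  have hscale : HasDerivAt (fun s : ℝ => scaleMap z (1 + s • Pi.single i 1))
      (scaleMap z (Pi.single i 1)) 0 := by
    simp only [map_add, map_smul, scaleMap_one]
    simpa using ((hasDerivAt_id (0 : ℝ)).smul_const (scaleMap z (Pi.single i 1))).const_add z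
  have hF₀ : HasFDerivAt F (fderiv ℝ F z) (scaleMap z (1 + (0 : ℝ) • Pi.single i 1)) := by
    simpa [scaleMap_one] using hF.hasFDerivAt
  rw [hF'.unique (hF₀.comp_hasDerivAt 0 hscale), ← symplecticForm_hamVectorField, symplecticForm,
    Finset.sum_eq_single i]
  · simp
  · intro j _ hj
    simp [hj]
  · simp

lemma exists_eq_scaleMap {z u : Phase d} (hz : ∀ i, 0 < action z i)
    (hu : ∀ i, u (Sum.inl i) * z (Sum.inr i) - u (Sum.inr i) * z (Sum.inl i) = 0) :
    ∃ c, u = scaleMap z c := by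
  have hne : ∀ i, 2 * action z i ≠ 0 := fun i => by simpa using (hz i).ne'
  refine ⟨fun i => (z (Sum.inl i) * u (Sum.inl i) + z (Sum.inr i) * u (Sum.inr i)) /
    (2 * action z i), phase_ext (fun i => ?_) fun i => ?_⟩
  · rw [scaleMap_inl, div_mul_eq_mul_div, eq_div_iff (hne i), action]
    linear_combination z (Sum.inr i) * hu i
  · rw [scaleMap_inr, div_mul_eq_mul_div, eq_div_iff (hne i), action]
    linear_combination -z (Sum.inl i) * hu i

/-- The Hamiltonian `f(r) · Re (monomial κ)`. On the set where the monomial is purely imaginary its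
vector field is radial and moves the actions in the direction `κ`. -/
def resonantHam (f : (Fin d → ℝ) → ℝ) (κ : Fin d → ℤ) (z : Phase d) : ℝ :=
  f (action z) * (monomial κ z).re

variable {f : (Fin d → ℝ) → ℝ} {κ : Fin d → ℤ}

lemma contDiff_resonantHam (hf : ContDiff ℝ ∞ f) : ContDiff ℝ ∞ (resonantHam f κ) :=
  (hf.comp contDiff_action).mul (Complex.reCLM.contDiff.comp (contDiff_monomial κ))

lemma hamVectorField_resonantHam_eq_zero (hf : Differentiable ℝ f) {z : Phase d}
    (hz : (monomial κ z).re = 0) (hfz : f (action z) = 0) :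
    hamVectorField (resonantHam f κ) z = 0 := by
  have hmul : HasFDerivAt (resonantHam f κ) _ z :=
    (hf.comp (contDiff_action.differentiable (by simp)) z).hasFDerivAt.mul
      ((Complex.reCLM.contDiff.comp (contDiff_monomial κ)).differentiable (by simp) z).hasFDerivAt
  have hzero : fderiv ℝ (resonantHam f κ) z = 0 := by
    rw [hmul.fderiv]
    simp [hz, hfz]
  refine phase_ext (fun i => ?_) fun i => ?_ <;> simp [hamVectorField, hzero]

lemma resonantHam_rotate_single (f : (Fin d → ℝ) → ℝ) (κ : Fin d → ℤ) (z : Phase d) (i : Fin d)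
    (s : ℝ) :
    resonantHam f κ (rotate (Pi.single i s) z) = f (action z) *
      (Real.cos (κ i * s) * (monomial κ z).re - Real.sin (κ i * s) * (monomial κ z).im) := by
  have hsum : ∑ j, (κ j : ℝ) * (Pi.single i s : Fin d → ℝ) j = κ i * s := by
    simp [Pi.single_apply]
  rw [resonantHam, action_rotate, monomial_rotate, hsum, Complex.mul_re,
    Complex.exp_ofReal_mul_I_re, Complex.exp_ofReal_mul_I_im]

lemma radial_hamVectorField_resonantHam (hf : ContDiff ℝ ∞ f) (z : Phase d) (i : Fin d) :
    z (Sum.inl i) * hamVectorField (resonantHam f κ) z (Sum.inl i) +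
      z (Sum.inr i) * hamVectorField (resonantHam f κ) z (Sum.inr i) =
    κ i * (f (action z) * (monomial κ z).im) := by
  have hangle : HasDerivAt (fun s : ℝ => (κ i : ℝ) * s) (κ i) 0 := by
    simpa using (hasDerivAt_id (0 : ℝ)).const_mul (κ i : ℝ)
  have hrot : HasDerivAt (fun s : ℝ => resonantHam f κ (rotate (Pi.single i s) z))
      (-(κ i * (f (action z) * (monomial κ z).im))) 0 := by
    simp only [resonantHam_rotate_single]
    refine (((hangle.cos.mul_const (monomial κ z).re).sub
      (hangle.sin.mul_const (monomial κ z).im)).const_mul (f (action z))).congr_deriv ?_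
    simp only [mul_zero, Real.sin_zero, Real.cos_zero]
    ring
  rw [radial_hamVectorField_eq_of_hasDerivAt
    ((contDiff_resonantHam hf).differentiable (by simp) z) hrot, neg_neg]

lemma exists_hamVectorField_resonantHam_eq_scaleMap (hf : ContDiff ℝ ∞ f)
    (hpos : ∀ r, f r ≠ 0 → ∀ i, 0 < r i) {z : Phase d} (hz : (monomial κ z).re = 0) :
    ∃ c, hamVectorField (resonantHam f κ) z = scaleMap z c := by
  by_cases hfz : f (action z) = 0
  · exact ⟨0, by rw [hamVectorField_resonantHam_eq_zero (hf.differentiable (by simp)) hz hfz,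
      map_zero]⟩
  have hscale : ∀ t, resonantHam f κ (scaleMap z t) = 0 := fun t => by
    rw [resonantHam, monomial_scaleMap, Complex.re_ofReal_mul, hz, mul_zero, mul_zero]
  refine exists_eq_scaleMap (hpos _ hfz) fun i => angular_hamVectorField_eq_of_hasDerivAt
    ((contDiff_resonantHam hf).differentiable (by simp) z) ?_
  simpa only [hscale] using hasDerivAt_const (0 : ℝ) (0 : ℝ)

end ResonantHam

section RotationInvariance

variable {d : ℕ} {F : Phase d → ℝ} {θ : Fin d → ℝ}

lemma hamVectorField_rotate (hF : Differentiable ℝ F) (h : ∀ z, F (rotate θ z) = F z)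
    (z : Phase d) : hamVectorField F (rotate θ z) = rotate θ (hamVectorField F z) := by
  refine symplecticForm_nondegenerate fun v => ?_
  have hcomp : HasFDerivAt (fun w => F (rotate θ w))
      ((fderiv ℝ F (rotate θ z)).comp (rotateCLM θ)) z :=
    (hF (rotate θ z)).hasFDerivAt.comp z (rotateCLM θ).hasFDerivAt
  rw [funext h] at hcomp
  have hv : v = rotate θ (rotate (-θ) v) := by rw [rotate_rotate, add_neg_cancel, rotate_zero]
  rw [hv, symplecticForm_rotate, symplecticForm_hamVectorField, symplecticForm_hamVectorField,
    hcomp.fderiv]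
  rfl

lemma IsMidpointMap.map_rotate (hF : Differentiable ℝ F) (h : ∀ z, F (rotate θ z) = F z) {τ : ℝ}
    {γ : Phase d ≃ Phase d} {m : Phase d → Phase d} (hγ : IsMidpointMap F τ γ m) (z : Phase d) :
    γ (rotate θ z) = rotate θ (γ z) := by
  have hm : rotate θ (m z) = m (rotate θ z) := by
    refine hγ.eq_mid ?_
    conv_lhs => rw [hγ.mid z]
    rw [hamVectorField_rotate hF h]
    simp only [← rotateCLM_apply, map_add, map_smul]
  rw [hγ.map, hγ.map, ← hm, hamVectorField_rotate hF h]
  simp only [← rotateCLM_apply, map_add, map_smul]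

end RotationInvariance

section Lines

variable {d : ℕ}

/-- The segment from `ρ` to `ρ + t κ` is contained in `S`. The resonant maps move actions along
such segments. -/
def LineIn (S : Set (Fin d → ℝ)) (κ : Fin d → ℤ) (ρ : Fin d → ℝ) (t : ℝ) : Prop :=
  ∀ s ∈ Set.uIcc 0 t, ρ + s • (fun i => (κ i : ℝ)) ∈ S

/-- `C` is invariant under the translations along `κ` inside `D`. -/
def LineInvariant (D : Set (Fin d → ℝ)) (κ : Fin d → ℤ) (C : Set (Fin d → ℝ)) : Prop :=
  ∀ ρ ∈ C, ∀ t, LineIn D κ ρ t → ρ + t • (fun i => (κ i : ℝ)) ∈ C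

variable {S S' : Set (Fin d → ℝ)} {κ : Fin d → ℤ} {ρ : Fin d → ℝ} {t t' : ℝ}

lemma lineIn_zero : LineIn S κ ρ 0 ↔ ρ ∈ S := by
  simp [LineIn]

lemma lineIn_of_convex (hS : Convex ℝ S) (hρ : ρ ∈ S) (ht : ρ + t • (fun i => (κ i : ℝ)) ∈ S) :
    LineIn S κ ρ t := by
  intro s hs
  rw [← segment_eq_uIcc] at hs
  obtain ⟨a, b, ha, hb, hab, rfl⟩ := hs
  refine hS.segment_subset hρ ht ⟨a, b, ha, hb, hab, ?_⟩
  rw [smul_add, ← add_assoc, ← add_smul, hab, one_smul, smul_zero, zero_add, smul_smul,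
    smul_eq_mul]

lemma LineIn.left_mem (h : LineIn S κ ρ t) : ρ ∈ S := by
  simpa using h 0 Set.left_mem_uIcc

lemma LineIn.right_mem (h : LineIn S κ ρ t) : ρ + t • (fun i => (κ i : ℝ)) ∈ S :=
  h t Set.right_mem_uIcc

lemma LineIn.mono (h : LineIn S κ ρ t) (ht : t' ∈ Set.uIcc 0 t) : LineIn S κ ρ t' := fun s hs =>
  h s (Set.uIcc_subset_uIcc Set.left_mem_uIcc ht hs)

lemma LineIn.mono_set (h : LineIn S κ ρ t) (hS : S ⊆ S') : LineIn S' κ ρ t := fun s hs =>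
  hS (h s hs)

lemma LineIn.add (h : LineIn S κ ρ t) (h' : LineIn S κ (ρ + t • (fun i => (κ i : ℝ))) t') :
    LineIn S κ ρ (t + t') := by
  intro s hs
  rcases Set.uIcc_subset_uIcc_union_uIcc (b := t) hs with hst | hst
  · exact h s hst
  · have hmem : s - t ∈ Set.uIcc 0 t' := by
      rw [Set.mem_uIcc] at hst ⊢
      exact hst.imp (fun hst => ⟨by linarith, by linarith⟩) fun hst => ⟨by linarith, by linarith⟩
    have := h' _ hmem
    rwa [add_assoc, ← add_smul, add_sub_cancel] at this

lemma LineIn.neg (h : LineIn S κ ρ t) : LineIn S κ (ρ + t • (fun i => (κ i : ℝ))) (-t) := by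
  intro s hs
  have hmem : t + s ∈ Set.uIcc 0 t := by
    rw [Set.mem_uIcc] at hs ⊢
    exact hs.symm.imp (fun hs => ⟨by linarith, by linarith⟩) fun hs => ⟨by linarith, by linarith⟩
  have := h _ hmem
  rwa [add_smul, ← add_assoc] at this

lemma LineIn.abs_le (hκ : κ ≠ 0) {R : ℝ} (hR : ∀ r ∈ S, ‖r‖ ≤ R) (h : LineIn S κ ρ t) :
    |t| ≤ 2 * R := by
  obtain ⟨i, hi⟩ := Function.ne_iff.1 hκ
  have hκi : (1 : ℝ) ≤ |(κ i : ℝ)| := by exact_mod_cast Int.one_le_abs hi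
  have hshift : ‖t • (fun i => (κ i : ℝ))‖ ≤ 2 * R := by
    calc ‖t • (fun i => (κ i : ℝ))‖ = ‖(ρ + t • (fun i => (κ i : ℝ))) - ρ‖ := by
          rw [add_sub_cancel_left]
      _ ≤ ‖ρ + t • (fun i => (κ i : ℝ))‖ + ‖ρ‖ := norm_sub_le _ _
      _ ≤ 2 * R := by linarith [hR _ h.left_mem, hR _ h.right_mem]
  have hcoord := (norm_le_pi_norm (t • (fun i => (κ i : ℝ))) i).trans hshift
  simp only [Pi.smul_apply, smul_eq_mul, norm_mul, Real.norm_eq_abs] at hcoord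
  nlinarith [abs_nonneg t]

end Lines

section ResonantMaps

variable {d : ℕ}

/-- `γ` is a symplectic map supported in `{r ∈ K}` that commutes with the rotations orthogonal to
`κ` and translates the actions in `O` along `κ`. Such a map commutes with the flow of an
integrable Hamiltonian that is resonant with `κ` on `O`. -/
structure IsResonantMap (κ : Fin d → ℤ) (O K : Set (Fin d → ℝ)) (γ : Phase d ≃ Phase d) :
    Prop where
  symplectic : IsSymplectic γ
  eq_self : ∀ z, action z ∉ K → γ z = z
  map_rotate : ∀ θ : Fin d → ℝ, ∑ i, κ i * θ i = 0 → ∀ z, γ (rotate θ z) = rotate θ (γ z)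
  exists_action_eq : ∀ z, action z ∈ O →
    ∃ t, action (γ z) = action z + t • (fun i => (κ i : ℝ)) ∧ LineIn O κ (action z) t

/-- `w` is obtained from `z` by a translation of the actions by `t κ` inside `O`, preserving the
argument of the monomial of exponent `κ`. For purely imaginary monomials the sign of `t` is the
sign of the imaginary part, so that successive shifts of the same point do not cancel. -/
structure IsRadialShift (κ : Fin d → ℤ) (O : Set (Fin d → ℝ)) (z w : Phase d) (t : ℝ) :
    Prop where
  action_eq : action w = action z + t • (fun i => (κ i : ℝ))
  lineIn : LineIn O κ (action z) t
  exists_monomial_eq : ∃ s : ℝ, 0 < s ∧ monomial κ w = s * monomial κ z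
  sign : 0 ≤ t * (monomial κ z).im

variable {κ : Fin d → ℤ} {O K : Set (Fin d → ℝ)}

lemma IsResonantMap.refl : IsResonantMap κ O K (Equiv.refl (Phase d)) where
  symplectic := IsSymplectic.refl
  eq_self _ _ := rfl
  map_rotate _ _ _ := rfl
  exists_action_eq z hz := ⟨0, by simp, lineIn_zero.2 hz⟩

lemma IsResonantMap.trans {γ γ' : Phase d ≃ Phase d} (h : IsResonantMap κ O K γ)
    (h' : IsResonantMap κ O K γ') : IsResonantMap κ O K (γ.trans γ') where
  symplectic := h.symplectic.trans h'.symplectic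
  eq_self z hz := by rw [Equiv.trans_apply, h.eq_self z hz, h'.eq_self z hz]
  map_rotate θ hθ z := by simp only [Equiv.trans_apply, h.map_rotate θ hθ, h'.map_rotate θ hθ]
  exists_action_eq z hz := by
    obtain ⟨t, ht, hl⟩ := h.exists_action_eq z hz
    obtain ⟨t', ht', hl'⟩ := h'.exists_action_eq (γ z) (ht ▸ hl.right_mem)
    exact ⟨t + t', by rw [Equiv.trans_apply, ht', ht, add_smul, add_assoc], hl.add (ht ▸ hl')⟩

namespace IsRadialShift

variable {z w v : Phase d} {t t' : ℝ}

lemma refl (hz : action z ∈ O) : IsRadialShift κ O z z 0 where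
  action_eq := by simp
  lineIn := lineIn_zero.2 hz
  exists_monomial_eq := ⟨1, one_pos, by simp⟩
  sign := by simp

lemma re_eq_zero (h : IsRadialShift κ O z w t) (hz : (monomial κ z).re = 0) :
    (monomial κ w).re = 0 := by
  obtain ⟨s, -, hs⟩ := h.exists_monomial_eq
  rw [hs, Complex.re_ofReal_mul, hz, mul_zero]

lemma sign_of_trans (h : IsRadialShift κ O z w t) (h' : IsRadialShift κ O w v t') :
    0 ≤ t' * (monomial κ z).im := by
  obtain ⟨s, hs, hws⟩ := h.exists_monomial_eq
  have hsign := h'.sign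
  rw [hws, Complex.im_ofReal_mul, mul_left_comm] at hsign
  exact nonneg_of_mul_nonneg_right hsign hs

lemma trans (h : IsRadialShift κ O z w t) (h' : IsRadialShift κ O w v t') :
    IsRadialShift κ O z v (t + t') where
  action_eq := by rw [h'.action_eq, h.action_eq, add_smul, add_assoc]
  lineIn := h.lineIn.add (h.action_eq ▸ h'.lineIn)
  exists_monomial_eq := by
    obtain ⟨s, hs, hws⟩ := h.exists_monomial_eq
    obtain ⟨s', hs', hvs⟩ := h'.exists_monomial_eq
    exact ⟨s' * s, by positivity, by rw [hvs, hws, Complex.ofReal_mul, mul_assoc]⟩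
  sign := by
    rw [add_mul]
    exact add_nonneg h.sign (h.sign_of_trans h')

lemma same_sign (h : IsRadialShift κ O z w t) (h' : IsRadialShift κ O w v t')
    (hz : (monomial κ z).im ≠ 0) : (0 ≤ t ∧ 0 ≤ t') ∨ (t ≤ 0 ∧ t' ≤ 0) := by
  have ht := h.sign
  have ht' := h.sign_of_trans h'
  rcases hz.lt_or_gt with him | him
  · exact Or.inr ⟨by nlinarith, by nlinarith⟩
  · exact Or.inl ⟨nonneg_of_mul_nonneg_left ht him, nonneg_of_mul_nonneg_left ht' him⟩

end IsRadialShift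

end ResonantMaps

section ResonantStep

variable {d : ℕ}

lemma hamVectorField_resonantHam_eq_zero_of_notMem_tsupport {f : (Fin d → ℝ) → ℝ}
    (κ : Fin d → ℤ) {z : Phase d} (hz : action z ∉ tsupport f) :
    hamVectorField (resonantHam f κ) z = 0 := by
  have hzero : resonantHam f κ =ᶠ[𝓝 z] fun _ => 0 := by
    filter_upwards [(continuous_action.tendsto z).eventually
      ((isClosed_tsupport f).isOpen_compl.mem_nhds hz)] with w hw
    rw [resonantHam, image_eq_zero_of_notMem_tsupport hw, zero_mul]
  have hfderiv : fderiv ℝ (resonantHam f κ) z = 0 := by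
    rw [hzero.fderiv_eq, fderiv_fun_const, Pi.zero_apply]
  refine phase_ext (fun i => ?_) fun i => ?_ <;> simp [hamVectorField, hfderiv]

lemma exists_pos_smul_lipschitzWith_and_norm_lt {X E : Type*} [PseudoMetricSpace X]
    [NormedAddCommGroup E] [NormedSpace ℝ E] {V : X → E} {L : NNReal} (hL : LipschitzWith L V)
    {B : ℝ} (hB : ∀ x, ‖V x‖ ≤ B) {δ : ℝ} (hδ : 0 < δ) :
    ∃ τ > (0 : ℝ), LipschitzWith (1 / 2) (fun x => τ • V x) ∧ ∀ x, ‖τ • V x‖ < δ := by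
  set τ : ℝ := min (1 / (2 * (L + 1))) (δ / (2 * (|B| + 1)))
  have hτ : 0 < τ := lt_min (by positivity) (by positivity)
  have hτL : τ * (2 * (L + 1)) ≤ 1 := (le_div_iff₀ (by positivity)).1 (min_le_left _ _)
  have hτB : τ * (2 * (|B| + 1)) ≤ δ := (le_div_iff₀ (by positivity)).1 (min_le_right _ _)
  refine ⟨τ, hτ, LipschitzWith.of_dist_le_mul fun x y => ?_, fun x => ?_⟩
  · rw [dist_smul₀, Real.norm_eq_abs, abs_of_pos hτ]
    have hdist := mul_le_mul_of_nonneg_left (hL.dist_le_mul x y) hτ.le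
    push_cast
    nlinarith [dist_nonneg (x := x) (y := y)]
  · rw [norm_smul, Real.norm_eq_abs, abs_of_pos hτ]
    have hnorm := mul_le_mul_of_nonneg_left ((hB x).trans (le_abs_self B)) hτ.le
    nlinarith [abs_nonneg B]

/-- An implicit midpoint map of `resonantHam f κ` whose step is so short that the actions move by
less than `η` between the midpoint and the two endpoints. -/
structure IsResonantStep (f : (Fin d → ℝ) → ℝ) (κ : Fin d → ℤ) (τ η : ℝ) (γ : Phase d ≃ Phase d)
    (m : Phase d → Phase d) : Prop extends IsMidpointMap (resonantHam f κ) τ γ m where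
  contDiff : ContDiff ℝ ∞ f
  pos : 0 < τ
  action_mem_ball : ∀ y, action y ∈ tsupport f → ∀ s ∈ Set.Icc (-1 : ℝ) 1,
    action (y + s • τ • hamVectorField (resonantHam f κ) y) ∈ Metric.ball (action y) η

lemma exists_isResonantStep {f : (Fin d → ℝ) → ℝ} (hf : ContDiff ℝ ∞ f)
    (hfc : HasCompactSupport f) (κ : Fin d → ℤ) {η : ℝ} (hη : 0 < η) :
    ∃ τ γ m, IsResonantStep f κ τ η γ m := by
  have hV := contDiff_hamVectorField (contDiff_resonantHam (κ := κ) hf)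
  have hcompact : IsCompact {z : Phase d | action z ∈ tsupport f} := isCompact_preimage_action hfc
  have hVc : HasCompactSupport (hamVectorField (resonantHam f κ)) :=
    HasCompactSupport.intro hcompact fun z hz =>
      hamVectorField_resonantHam_eq_zero_of_notMem_tsupport κ hz
  obtain ⟨L, hL⟩ := ContDiff.lipschitzWith_of_hasCompactSupport hVc hV (by simp)
  obtain ⟨B, hB⟩ := hVc.exists_bound_of_continuous hV.continuous
  obtain ⟨δ, hδ, hδη⟩ := Metric.mem_uniformity_dist.1
    (hcompact.uniformContinuousAt_of_continuousAt (fun z : Phase d => action z)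
      (fun a _ => continuous_action.continuousAt) (Metric.dist_mem_uniformity hη))
  obtain ⟨τ, hτ, hLip, hlt⟩ := exists_pos_smul_lipschitzWith_and_norm_lt hL hB hδ
  obtain ⟨γ, m, hγ⟩ := exists_isMidpointMap (contDiff_resonantHam hf) hLip
  refine ⟨τ, γ, m, hγ, hf, hτ, fun y hy s hs => ?_⟩
  rw [Metric.mem_ball, dist_comm]
  refine hδη (b := y + s • τ • hamVectorField (resonantHam f κ) y) ?_ hy
  rw [dist_self_add_right, norm_smul, Real.norm_eq_abs]
  exact (mul_le_of_le_one_left (norm_nonneg _) (abs_le.2 hs)).trans_lt (hlt y)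

lemma two_mul_sub_one_pos {a : ℝ} (ha : ∀ s ∈ Set.Icc (-1 : ℝ) 1, a + s * (a - 1) ≠ 0) :
    0 < 2 * a - 1 := by
  by_contra hneg
  have hpos : 0 < 1 - a := by linarith
  refine ha (a / (1 - a)) ⟨?_, ?_⟩ ?_
  · rw [le_div_iff₀ hpos]
    linarith
  · rw [div_le_iff₀ hpos]
    linarith
  · field_simp
    ring

namespace IsResonantStep

variable {f : (Fin d → ℝ) → ℝ} {κ : Fin d → ℤ} {τ η : ℝ} {γ : Phase d ≃ Phase d}
  {m : Phase d → Phase d} {O C : Set (Fin d → ℝ)} {z : Phase d}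

lemma action_mem_ball_mid (h : IsResonantStep f κ τ η γ m) (hm : action (m z) ∈ tsupport f) :
    action z ∈ Metric.ball (action (m z)) η := by
  have hz : z = m z + (-1 : ℝ) • τ • hamVectorField (resonantHam f κ) (m z) := by
    rw [neg_one_smul, ← sub_eq_add_neg]
    exact eq_sub_of_add_eq (h.mid z).symm
  have hball := h.action_mem_ball (m z) hm (-1) (by simp)
  rwa [← hz] at hball

lemma action_map_mem_ball_mid (h : IsResonantStep f κ τ η γ m)
    (hm : action (m z) ∈ tsupport f) : action (γ z) ∈ Metric.ball (action (m z)) η := by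
  have hball := h.action_mem_ball (m z) hm 1 (by simp)
  rwa [one_smul, ← h.map] at hball

lemma action_map_eq_add (h : IsResonantStep f κ τ η γ m) (z : Phase d) :
    action (γ z) = action z +
      (2 * τ * (f (action (m z)) * (monomial κ (m z)).im)) • (fun i => (κ i : ℝ)) := by
  funext i
  rw [h.action_map, radial_hamVectorField_resonantHam h.contDiff, Pi.add_apply, Pi.smul_apply,
    smul_eq_mul]
  ring

lemma lineIn (h : IsResonantStep f κ τ η γ m) (hO : Metric.cthickening η (tsupport f) ⊆ O)
    (hz : action z ∈ O) :
    LineIn O κ (action z) (2 * τ * (f (action (m z)) * (monomial κ (m z)).im)) := by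
  by_cases hm : action (m z) ∈ tsupport f
  · refine LineIn.mono_set (lineIn_of_convex (convex_ball _ _) (h.action_mem_ball_mid hm) ?_)
      (((Metric.ball_subset_thickening hm η).trans
        (Metric.thickening_subset_cthickening _ _)).trans hO)
    rw [← h.action_map_eq_add]
    exact h.action_map_mem_ball_mid hm
  · simpa [image_eq_zero_of_notMem_tsupport hm, lineIn_zero] using hz

lemma isResonantMap (h : IsResonantStep f κ τ η γ m)
    (hO : Metric.cthickening η (tsupport f) ⊆ O) :
    IsResonantMap κ O (Metric.cthickening η (tsupport f)) γ where
  symplectic := h.symplectic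
  eq_self z hz := h.map_eq_self <|
    hamVectorField_resonantHam_eq_zero_of_notMem_tsupport κ fun hm => hz <|
      Metric.thickening_subset_cthickening _ _ <|
        Metric.ball_subset_thickening hm η (h.action_mem_ball_mid hm)
  map_rotate θ hθ z := h.toIsMidpointMap.map_rotate
    ((contDiff_resonantHam h.contDiff).differentiable (by simp))
    (fun w => by simp [resonantHam, monomial_rotate, hθ]) z
  exists_action_eq z hz := ⟨_, h.action_map_eq_add z, h.lineIn hO hz⟩

-- The radial directions at `z` form a linear space preserved by the fixed point iteration of `m`.
lemma exists_mid_eq_scaleMap (h : IsResonantStep f κ τ η γ m)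
    (hf : ∀ r, f r ≠ 0 → ∀ i, 0 < r i) (hz : (monomial κ z).re = 0) :
    ∃ a, m z = scaleMap z a := by
  obtain ⟨a, ha⟩ := h.mem_of_mapsTo (z := z) (s := LinearMap.range (scaleMap z))
    (Submodule.closed_of_finiteDimensional _) ⟨1, scaleMap_one z⟩ (by
      rintro y ⟨a, rfl⟩
      obtain ⟨b, hb⟩ := exists_hamVectorField_resonantHam_eq_scaleMap (κ := κ) h.contDiff hf
        (z := scaleMap z a) (by rw [monomial_scaleMap, Complex.re_ofReal_mul, hz, mul_zero])
      rw [hb, scaleMap_scaleMap]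
      exact ⟨1 + τ • (b * a), by rw [map_add, map_smul, scaleMap_one]⟩)
  exact ⟨a, ha.symm⟩

-- The scaling factors are `1` at `z`, and on the segment from `z` through `m z` to `γ z` they
-- cannot vanish, since the actions stay in `O`; so they stay positive.
lemma exists_pos_eq_scaleMap (h : IsResonantStep f κ τ η γ m)
    (hO : Metric.cthickening η (tsupport f) ⊆ O) (hpos : ∀ r ∈ O, ∀ i, 0 < r i)
    (hz : (monomial κ z).re = 0) :
    ∃ a : Fin d → ℝ, (∀ i, 0 < a i) ∧ (∀ i, 0 < 2 * a i - 1) ∧ m z = scaleMap z a ∧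
      γ z = scaleMap z (2 • a - 1) := by
  have hthick : ∀ r ∈ tsupport f, Metric.ball r η ⊆ O := fun r hr =>
    ((Metric.ball_subset_thickening hr η).trans (Metric.thickening_subset_cthickening _ _)).trans hO
  by_cases hm : action (m z) ∈ tsupport f
  · obtain ⟨a, ha⟩ := h.exists_mid_eq_scaleMap (fun r hr => hpos r <|
      hO (Metric.self_subset_cthickening _ (subset_tsupport _ hr))) hz
    have hstep : τ • hamVectorField (resonantHam f κ) (m z) = scaleMap z (a - 1) := by
      rw [map_sub, ← ha, scaleMap_one]
      exact (sub_eq_of_eq_add' (h.mid z)).symm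
    have hne : ∀ i, ∀ s ∈ Set.Icc (-1 : ℝ) 1, a i + s * (a i - 1) ≠ 0 := by
      intro i s hs h0
      have haction := hpos _ (hthick _ hm (h.action_mem_ball (m z) hm s hs)) i
      rw [hstep, ha, ← map_smul, ← map_add, action_scaleMap] at haction
      simp [h0] at haction
    have ha2 : ∀ i, 0 < 2 * a i - 1 := fun i => two_mul_sub_one_pos (hne i)
    refine ⟨a, fun i => by linarith [ha2 i], ha2, ha, ?_⟩
    rw [h.map, hstep, ha, ← map_add, two_smul, add_sub_assoc]
  · have hzero := hamVectorField_resonantHam_eq_zero_of_notMem_tsupport κ hm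
    have hmid := h.mid z
    rw [hzero, smul_zero, add_zero] at hmid
    have htwo : (2 • (1 : Fin d → ℝ) - 1) = 1 := by rw [two_smul, add_sub_cancel_right]
    exact ⟨1, by simp, by norm_num, by rw [hmid, scaleMap_one],
      by rw [h.map_eq_self hzero, htwo, scaleMap_one]⟩

lemma isRadialShift (h : IsResonantStep f κ τ η γ m)
    (hO : Metric.cthickening η (tsupport f) ⊆ O) (hpos : ∀ r ∈ O, ∀ i, 0 < r i)
    (hf : ∀ r, 0 ≤ f r) (hzO : action z ∈ O) (hz : (monomial κ z).re = 0) :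
    IsRadialShift κ O z (γ z) (2 * τ * (f (action (m z)) * (monomial κ (m z)).im)) := by
  obtain ⟨a, ha, ha2, hma, hγa⟩ := h.exists_pos_eq_scaleMap hO hpos hz
  refine ⟨h.action_map_eq_add z, h.lineIn hO hzO,
    ⟨∏ i, (2 • a - 1 : Fin d → ℝ) i ^ (κ i).natAbs, ?_, by rw [hγa, monomial_scaleMap]⟩, ?_⟩
  · exact Finset.prod_pos fun i _ => pow_pos (by simpa using ha2 i) _
  · have hprod : 0 ≤ ∏ i, a i ^ (κ i).natAbs := Finset.prod_nonneg fun i _ => pow_nonneg (ha i).le _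
    have hτ := h.pos.le
    rw [hma, monomial_scaleMap, Complex.im_ofReal_mul]
    calc 0 ≤ 2 * τ * f (action (scaleMap z a)) * (∏ i, a i ^ (κ i).natAbs) *
          ((monomial κ z).im * (monomial κ z).im) :=
        mul_nonneg (mul_nonneg (mul_nonneg (by linarith) (hf _)) hprod) (mul_self_nonneg _)
      _ = _ := by ring

lemma shift_ne_zero (h : IsResonantStep f κ τ η γ m)
    (hO : Metric.cthickening η (tsupport f) ⊆ O) (hpos : ∀ r ∈ O, ∀ i, 0 < r i)
    (hf : f (action z) ≠ 0) (hz : (monomial κ z).re = 0) :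
    2 * τ * (f (action (m z)) * (monomial κ (m z)).im) ≠ 0 := by
  have hzO : action z ∈ O := hO (Metric.self_subset_cthickening _ (subset_tsupport _ hf))
  obtain ⟨a, ha, -, hma, -⟩ := h.exists_pos_eq_scaleMap hO hpos hz
  have him : (monomial κ z).im ≠ 0 := fun h0 =>
    monomial_ne_zero κ (hpos _ hzO) (Complex.ext hz h0)
  have hmre : (monomial κ (m z)).re = 0 := by
    rw [hma, monomial_scaleMap, Complex.re_ofReal_mul, hz, mul_zero]
  have hmim : (monomial κ (m z)).im ≠ 0 := by
    rw [hma, monomial_scaleMap, Complex.im_ofReal_mul]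
    exact mul_ne_zero (Finset.prod_ne_zero_iff.2 fun i _ => pow_ne_zero _ (ha i).ne') him
  have hfm : f (action (m z)) ≠ 0 := by
    intro h0
    have hmid := h.mid z
    rw [hamVectorField_resonantHam_eq_zero (h.contDiff.differentiable (by simp)) hmre h0,
      smul_zero, add_zero] at hmid
    exact hf (hmid ▸ h0)
  exact mul_ne_zero (mul_ne_zero two_ne_zero h.pos.ne') (mul_ne_zero hfm hmim)

lemma exists_pos_le_abs_shift (h : IsResonantStep f κ τ η γ m)
    (hO : Metric.cthickening η (tsupport f) ⊆ O) (hpos : ∀ r ∈ O, ∀ i, 0 < r i)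
    (hC : IsCompact C) (hf : ∀ r ∈ C, f r ≠ 0) :
    ∃ c > 0, ∀ z, action z ∈ C → (monomial κ z).re = 0 →
      c ≤ |2 * τ * (f (action (m z)) * (monomial κ (m z)).im)| := by
  have hmon := (contDiff_monomial κ).continuous
  have hcompact : IsCompact {z : Phase d | action z ∈ C ∧ (monomial κ z).re = 0} :=
    (isCompact_preimage_action hC).inter_right
      (isClosed_eq (Complex.continuous_re.comp hmon) continuous_const)
  have hcont : Continuous fun z => |2 * τ * (f (action (m z)) * (monomial κ (m z)).im)| :=
    (continuous_const.mul
      ((h.contDiff.continuous.comp (continuous_action.comp h.continuous_mid)).mul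
        ((Complex.continuous_im.comp hmon).comp h.continuous_mid))).abs
  obtain ⟨c, hc, hle⟩ := hcompact.exists_forall_le' hcont.continuousOn (a := 0)
    fun z hz => abs_pos.2 (h.shift_ne_zero hO hpos (hf _ hz.1) hz.2)
  exact ⟨c, hc, fun z hzC hz => hle z ⟨hzC, hz⟩⟩

end IsResonantStep

lemma exists_isResonantMap_shift_ge {κ : Fin d → ℤ} {O C : Set (Fin d → ℝ)} (hO : IsOpen O)
    (hpos : ∀ r ∈ O, ∀ i, 0 < r i) (hCO : C ⊆ O) (hC : IsCompact C) :
    ∃ γ K, ∃ c > 0, IsCompact K ∧ K ⊆ O ∧ IsResonantMap κ O K γ ∧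
      ∀ z, action z ∈ O → (monomial κ z).re = 0 →
        ∃ t, IsRadialShift κ O z (γ z) t ∧ (action z ∈ C → c ≤ |t|) := by
  obtain ⟨f, hf, hfc, hfO, hf0, -, hf1⟩ := exists_bump hC hO hCO
  obtain ⟨η, hη, hηO⟩ := hfc.exists_cthickening_subset_open hO hfO
  obtain ⟨τ, γ, m, hγ⟩ := exists_isResonantStep hf hfc κ hη
  obtain ⟨c, hc, hle⟩ := hγ.exists_pos_le_abs_shift hηO hpos hC fun r hr => by simp [hf1 r hr]
  exact ⟨γ, _, c, hc, hfc.cthickening, hηO, hγ.isResonantMap hηO, fun z hzO hz =>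
    ⟨_, hγ.isRadialShift hηO hpos hf0 hzO hz, fun hzC => hle z hzC hz⟩⟩

end ResonantStep

section Escape

variable {d : ℕ} {κ : Fin d → ℤ} {O C Q K : Set (Fin d → ℝ)} {g : Phase d ≃ Phase d} {c : ℝ}

lemma exists_iterate_isRadialShift (hpos : ∀ r ∈ O, ∀ i, 0 < r i) (hCO : C ⊆ O)
    (hC : LineInvariant O κ C) (hg : IsResonantMap κ O K g)
    (hshift : ∀ z, action z ∈ O → (monomial κ z).re = 0 →
      ∃ t, IsRadialShift κ O z (g z) t ∧ (action z ∈ C ∩ Q → c ≤ |t|)) (N : ℕ) :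
    ∃ γ, IsResonantMap κ O K γ ∧ ∀ z, action z ∈ C → (monomial κ z).re = 0 →
      ∃ t, IsRadialShift κ O z (γ z) t ∧ (LineIn Q κ (action z) t → N * c ≤ |t|) := by
  induction N with
  | zero => exact ⟨Equiv.refl _, IsResonantMap.refl, fun z hz _ =>
      ⟨0, IsRadialShift.refl (hCO hz), by simp⟩⟩
  | succ N ih =>
    obtain ⟨γ, hγ, hγshift⟩ := ih
    refine ⟨γ.trans g, hγ.trans hg, fun z hz hre => ?_⟩
    obtain ⟨t, ht, hN⟩ := hγshift z hz hre
    have hzC : action (γ z) ∈ C := ht.action_eq ▸ hC _ hz _ ht.lineIn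
    obtain ⟨t', ht', hc⟩ := hshift _ (hCO hzC) (ht.re_eq_zero hre)
    have hsign := ht.same_sign ht' fun h0 =>
      monomial_ne_zero κ (hpos _ (hCO hz)) (Complex.ext hre h0)
    have hmem : t ∈ Set.uIcc 0 (t + t') := Set.mem_uIcc.2 <|
      hsign.imp (fun h => ⟨h.1, by linarith⟩) fun h => ⟨by linarith, h.1⟩
    refine ⟨t + t', ht.trans ht', fun hQ => ?_⟩
    have hle := hN (hQ.mono hmem)
    have hle' := hc ⟨hzC, by rw [ht.action_eq]; exact hQ t hmem⟩
    rw [(abs_add_eq_add_abs_iff t t').2 hsign]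
    push_cast
    linarith

theorem exists_isResonantMap_not_lineIn (hκ : κ ≠ 0) (hO : IsOpen O)
    (hpos : ∀ r ∈ O, ∀ i, 0 < r i) (hCO : C ⊆ O) (hQ : Bornology.IsBounded Q)
    (hCQ : IsCompact (C ∩ Q)) (hC : LineInvariant O κ C) :
    ∃ γ K, IsCompact K ∧ K ⊆ O ∧ IsResonantMap κ O K γ ∧
      ∀ z, action z ∈ C → (monomial κ z).re = 0 →
        ∃ t, IsRadialShift κ O z (γ z) t ∧ ¬ LineIn Q κ (action z) t := by
  obtain ⟨g, K, c, hc, hK, hKO, hg, hshift⟩ :=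
    exists_isResonantMap_shift_ge (κ := κ) hO hpos (Set.inter_subset_left.trans hCO) hCQ
  obtain ⟨R, hR⟩ := hQ.exists_norm_le
  obtain ⟨N, hN⟩ := exists_nat_gt (2 * R / c)
  obtain ⟨γ, hγ, hγshift⟩ := exists_iterate_isRadialShift hpos hCO hC hg hshift N
  refine ⟨γ, K, hK, hKO, hγ, fun z hz hre => ?_⟩
  obtain ⟨t, ht, hNt⟩ := hγshift z hz hre
  refine ⟨t, ht, fun hQt => ?_⟩
  rw [div_lt_iff₀ hc] at hN
  linarith [hNt hQt, hQt.abs_le hκ hR]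

end Escape

section Perturbation

variable {d : ℕ}

lemma exists_cutoff (d l : ℕ) : ∃ f : Phase d → ℝ, ContDiff ℝ ∞ f ∧ HasCompactSupport f ∧
    ∀ x ∈ Metric.closedBall (0 : Phase d) l, f x = 1 := by
  obtain ⟨f, hsmooth, hcompact, -, -, -, hone⟩ := exists_bump
    (isCompact_closedBall (0 : Phase d) (l : ℝ)) isOpen_univ (Set.subset_univ _)
  exact ⟨f, hsmooth, hcompact, hone⟩

/-- A smooth compactly supported function equal to `1` on the ball of radius `l`. It turns bounds
on derivatives over that ball into bounds over the whole space, so that locally uniform `C^∞`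
convergence can be expressed by global estimates. -/
def cutoff (d l : ℕ) : Phase d → ℝ := (exists_cutoff d l).choose

lemma contDiff_cutoff (d l : ℕ) : ContDiff ℝ ∞ (cutoff d l) := (exists_cutoff d l).choose_spec.1

lemma hasCompactSupport_cutoff (d l : ℕ) : HasCompactSupport (cutoff d l) :=
  (exists_cutoff d l).choose_spec.2.1

lemma cutoff_eq_one {l : ℕ} {x : Phase d} (hx : ‖x‖ ≤ l) : cutoff d l x = 1 :=
  (exists_cutoff d l).choose_spec.2.2 x (by simpa using hx)

lemma contDiff_comp_action {h : (Fin d → ℝ) → ℝ} (hh : ContDiff ℝ ∞ h) {G : Phase d ≃ Phase d}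
    (hG : IsSymplectic G) : ContDiff ℝ ∞ (fun z => h (action (G z))) :=
  hh.comp (contDiff_action.comp hG.contDiff)

/-- Quantitative closeness of the integrable systems `h ∘ action ∘ G` and `h' ∘ action ∘ G'`: of
their flows for times and points up to `R`, of their Hamiltonians in `C^j` on balls of radius up to
`j`, of their `2`-jets at the origin, and of their frequency maps. -/
structure FlowClose (j : ℕ) (R ε : ℝ) (h : (Fin d → ℝ) → ℝ) (G : Phase d ≃ Phase d)
    (h' : (Fin d → ℝ) → ℝ) (G' : Phase d ≃ Phase d) : Prop where
  flow : ∀ t z, |t| ≤ R → ‖z‖ ≤ R → dist (conjFlow h G t z) (conjFlow h' G' t z) ≤ ε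
  deriv : ∀ l ≤ j, ∀ n ≤ j, ∀ z, ‖iteratedFDeriv ℝ n
    (fun w => cutoff d l w * (h' (action (G' w)) - h (action (G w)))) z‖ ≤ ε
  ham : ∀ z, ‖z‖ ≤ 1 → |h' (action (G' z)) - h (action (G z))| ≤ ε * ‖z‖ ^ 3
  freq : ∀ r, ‖r‖ ≤ j → ‖grad h' r - grad h r‖ ≤ ε

lemma FlowClose.trans {j : ℕ} {R ε ε' : ℝ} {h₁ h₂ h₃ : (Fin d → ℝ) → ℝ}
    {G₁ G₂ G₃ : Phase d ≃ Phase d} (hh₁ : ContDiff ℝ ∞ h₁) (hh₂ : ContDiff ℝ ∞ h₂)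
    (hh₃ : ContDiff ℝ ∞ h₃) (hG₁ : IsSymplectic G₁) (hG₂ : IsSymplectic G₂)
    (hG₃ : IsSymplectic G₃) (h : FlowClose j R ε h₁ G₁ h₂ G₂)
    (h' : FlowClose j R ε' h₂ G₂ h₃ G₃) : FlowClose j R (ε + ε') h₁ G₁ h₃ G₃ where
  flow t z ht hz := (dist_triangle _ _ _).trans (add_le_add (h.flow t z ht hz) (h'.flow t z ht hz))
  deriv l hl n hn z := by
    have contDiff_cutoff_mul_sub {f f' : Phase d → ℝ} (hf : ContDiff ℝ ∞ f)
        (hf' : ContDiff ℝ ∞ f') : ContDiff ℝ n (fun w => cutoff d l w * (f' w - f w)) :=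
      ((contDiff_cutoff d l).mul (hf'.sub hf)).of_le (WithTop.coe_le_coe.2 le_top)
    have hH₁ := contDiff_comp_action hh₁ hG₁
    have hH₂ := contDiff_comp_action hh₂ hG₂
    have hH₃ := contDiff_comp_action hh₃ hG₃
    have hsplit : (fun w => cutoff d l w * (h₃ (action (G₃ w)) - h₁ (action (G₁ w)))) =
        (fun w => cutoff d l w * (h₂ (action (G₂ w)) - h₁ (action (G₁ w)))) +
        (fun w => cutoff d l w * (h₃ (action (G₃ w)) - h₂ (action (G₂ w)))) := by
      funext w
      simp only [Pi.add_apply]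
      ring
    rw [hsplit, iteratedFDeriv_add_apply (contDiff_cutoff_mul_sub hH₁ hH₂).contDiffAt
      (contDiff_cutoff_mul_sub hH₂ hH₃).contDiffAt]
    exact (norm_add_le _ _).trans (add_le_add (h.deriv l hl n hn z) (h'.deriv l hl n hn z))
  ham z hz := by
    rw [add_mul, ← sub_add_sub_cancel' (h₂ (action (G₂ z)))]
    exact (abs_add_le _ _).trans (add_le_add (h.ham z hz) (h'.ham z hz))
  freq r hr := by
    rw [← sub_add_sub_cancel' (grad h₂ r)]
    exact (norm_add_le _ _).trans (add_le_add (h.freq r hr) (h'.freq r hr))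

lemma norm_action_le (z : Phase d) : ‖action z‖ ≤ ‖z‖ ^ 2 := by
  refine (pi_norm_le_iff_of_nonneg (by positivity)).2 fun i => ?_
  have hsingle := Finset.single_le_sum (fun i (_ : i ∈ Finset.univ) => action_nonneg z i)
    (Finset.mem_univ i)
  rw [norm_sq_eq_sum_action, Real.norm_eq_abs, abs_of_nonneg (action_nonneg z i)]
  linarith [action_nonneg z i]

lemma isBigO_comp_action {u : (Fin d → ℝ) → ℝ} (hu : u =O[𝓝 0] fun r => ‖r‖ ^ 2) :
    (fun z : Phase d => u (action z)) =O[𝓝 0] fun z => ‖z‖ ^ 3 := by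
  have htendsto : Tendsto (fun z : Phase d => action z) (𝓝 0) (𝓝 0) := by
    have hzero : action (0 : Phase d) = 0 := by
      funext i
      simp [action]
    simpa only [hzero] using (continuous_action (d := d)).tendsto 0
  refine (hu.comp_tendsto htendsto).trans (Asymptotics.IsBigO.of_bound 1 ?_)
  filter_upwards [Metric.closedBall_mem_nhds (0 : Phase d) one_pos] with z hz
  rw [mem_closedBall_zero_iff] at hz
  rw [one_mul, Real.norm_of_nonneg (by simp), Real.norm_of_nonneg (by positivity)]
  calc ‖action z‖ ^ 2 ≤ (‖z‖ ^ 2) ^ 2 := pow_le_pow_left₀ (norm_nonneg _) (norm_action_le z) 2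
    _ = ‖z‖ ^ 3 * ‖z‖ := by ring
    _ ≤ ‖z‖ ^ 3 := mul_le_of_le_one_right (by positivity) hz

lemma exists_forall_abs_le_mul_norm_pow {E : Type*} [NormedAddCommGroup E] [ProperSpace E]
    {g : E → ℝ} (hg : Continuous g) {n : ℕ} (hO : g =O[𝓝 0] fun z => ‖z‖ ^ n) (R : ℝ) :
    ∃ B, ∀ z, ‖z‖ ≤ R → |g z| ≤ B * ‖z‖ ^ n := by
  obtain ⟨B, hB⟩ := hO.bound
  obtain ⟨s, hs, hsB⟩ := Metric.eventually_nhds_iff.1 hB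
  obtain ⟨A, hA⟩ := (isCompact_closedBall (0 : E) R).exists_bound_of_continuousOn hg.continuousOn
  refine ⟨max B (A / s ^ n), fun z hz => ?_⟩
  rcases lt_or_ge ‖z‖ s with hlt | hge
  · have hnear := hsB (y := z) (by simpa using hlt)
    simp only [Real.norm_eq_abs, abs_pow, abs_norm] at hnear
    exact hnear.trans (mul_le_mul_of_nonneg_right (le_max_left _ _) (by positivity))
  · have hfar : |g z| ≤ A := hA z (by simpa using hz)
    calc |g z| ≤ A := hfar
      _ = A / s ^ n * s ^ n := (div_mul_cancel₀ A (pow_pos hs n).ne').symm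
      _ ≤ A / s ^ n * ‖z‖ ^ n :=
        mul_le_mul_of_nonneg_left (pow_le_pow_left₀ hs.le hge n)
          (div_nonneg ((abs_nonneg _).trans hfar) (by positivity))
      _ ≤ max B (A / s ^ n) * ‖z‖ ^ n :=
        mul_le_mul_of_nonneg_right (le_max_right _ _) (by positivity)

variable {ι : Type*} [Fintype ι] {h : (Fin d → ℝ) → ℝ} {u : ι → (Fin d → ℝ) → ℝ}
  {G : Phase d ≃ Phase d} {ε : ℝ}

/-- The function `h + ∑ i, c i • u i` of the actions, a finite-dimensional family of perturbations
of `h` in the directions `u i`. -/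
def perturbed (h : (Fin d → ℝ) → ℝ) (u : ι → (Fin d → ℝ) → ℝ) (c : ι → ℝ) (r : Fin d → ℝ) : ℝ :=
  h r + ∑ i, c i * u i r

lemma perturbed_zero (h : (Fin d → ℝ) → ℝ) (u : ι → (Fin d → ℝ) → ℝ) : perturbed h u 0 = h := by
  funext r
  simp [perturbed]

lemma contDiff_perturbed (hh : ContDiff ℝ ∞ h) (hu : ∀ i, ContDiff ℝ ∞ (u i)) (c : ι → ℝ) :
    ContDiff ℝ ∞ (perturbed h u c) :=
  hh.add (ContDiff.sum fun i _ => contDiff_const.mul (hu i))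

lemma grad_perturbed (hh : Differentiable ℝ h) (hu : ∀ i, Differentiable ℝ (u i)) (c : ι → ℝ)
    (r : Fin d → ℝ) : grad (perturbed h u c) r = grad h r + ∑ i, c i • grad (u i) r := by
  have hfderiv : HasFDerivAt (perturbed h u c)
      (fderiv ℝ h r + ∑ i, c i • fderiv ℝ (u i) r) r :=
    (hh r).hasFDerivAt.add (HasFDerivAt.fun_sum fun i _ => (hu i r).hasFDerivAt.const_mul (c i))
  funext j
  simp [grad, hfderiv.fderiv]

lemma continuous_conjFlow_perturbed (hh : ContDiff ℝ ∞ h) (hG : IsSymplectic G)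
    (hu : ∀ i, ContDiff ℝ ∞ (u i)) :
    Continuous fun q : (ι → ℝ) × (ℝ × Phase d) =>
      conjFlow (perturbed h u q.1) G q.2.1 q.2.2 := by
  have hGq : Continuous fun q : (ι → ℝ) × (ℝ × Phase d) => G q.2.2 :=
    hG.contDiff.continuous.comp (by fun_prop)
  have hact : Continuous fun q : (ι → ℝ) × (ℝ × Phase d) => action (G q.2.2) :=
    continuous_action.comp hGq
  have hfreq : Continuous fun q : (ι → ℝ) × (ℝ × Phase d) =>
      grad (perturbed h u q.1) (action (G q.2.2)) := by
    simp only [grad_perturbed (hh.differentiable (by simp))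
      fun i => (hu i).differentiable (by simp)]
    exact ((continuous_grad hh).comp hact).add (continuous_finsetSum _ fun i _ =>
      ((continuous_apply i).comp continuous_fst).smul ((continuous_grad (hu i)).comp hact))
  have hrotate : Continuous fun q : (ι → ℝ) × (ℝ × Phase d) =>
      rotate (q.2.1 • grad (perturbed h u q.1) (action (G q.2.2))) (G q.2.2) := by
    simpa only [Function.comp_def, Pi.smul_apply'] using continuous_rotate.comp
      (((continuous_fst.comp continuous_snd).smul hfreq).prodMk hGq)
  exact hG.contDiff_symm.continuous.comp hrotate

lemma eventually_sum_abs_mul_le (hε : 0 < ε) (B : ι → ℝ) :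
    ∀ᶠ c : ι → ℝ in 𝓝 0, ∑ i, |c i| * B i ≤ ε := by
  have hcont : Continuous fun c : ι → ℝ => ∑ i, |c i| * B i := by fun_prop
  have htendsto : Tendsto (fun c : ι → ℝ => ∑ i, |c i| * B i) (𝓝 0) (𝓝 0) := by
    simpa using hcont.tendsto 0
  exact (htendsto.eventually (gt_mem_nhds hε)).mono fun c hc => hc.le

lemma eventually_dist_conjFlow_perturbed_le (hh : ContDiff ℝ ∞ h) (hG : IsSymplectic G)
    (hu : ∀ i, ContDiff ℝ ∞ (u i)) (R : ℝ) (hε : 0 < ε) :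
    ∀ᶠ c : ι → ℝ in 𝓝 0, ∀ t z, |t| ≤ R → ‖z‖ ≤ R →
      dist (conjFlow h G t z) (conjFlow (perturbed h u c) G t z) ≤ ε := by
  have hflow := continuous_conjFlow_perturbed hh hG hu
  have hunperturbed : Continuous fun q : (ι → ℝ) × (ℝ × Phase d) => conjFlow h G q.2.1 q.2.2 := by
    simpa only [Function.comp_def, perturbed_zero] using hflow.comp
      ((continuous_const (y := (0 : ι → ℝ))).prodMk continuous_snd)
  have hball : ∀ᶠ c : ι → ℝ in 𝓝 0, ∀ p ∈ Metric.closedBall (0 : ℝ) R ×ˢ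
      Metric.closedBall (0 : Phase d) R,
      dist (conjFlow h G p.1 p.2) (conjFlow (perturbed h u c) G p.1 p.2) ≤ ε := by
    refine ((isCompact_closedBall _ _).prod
      (isCompact_closedBall _ _)).eventually_forall_of_forall_eventually fun p _ => ?_
    have htendsto := (hunperturbed.dist hflow).tendsto (0, p)
    simp only [perturbed_zero, dist_self] at htendsto
    exact (htendsto.eventually (gt_mem_nhds hε)).mono fun q hq => hq.le
  filter_upwards [hball] with c hc t z ht hz
  exact hc (t, z) ⟨by simpa using ht, by simpa using hz⟩

lemma eventually_norm_iteratedFDeriv_sum_le {E : Type*} [NormedAddCommGroup E]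
    [NormedSpace ℝ E] {g : ι → E → ℝ} (hg : ∀ i, ContDiff ℝ ∞ (g i))
    (hgc : ∀ i, HasCompactSupport (g i)) (n : ℕ) (hε : 0 < ε) :
    ∀ᶠ c : ι → ℝ in 𝓝 0, ∀ z, ‖iteratedFDeriv ℝ n (fun w => ∑ i, c i • g i w) z‖ ≤ ε := by
  have hgn : ∀ i, ContDiff ℝ n (g i) := fun i => (hg i).of_le (WithTop.coe_le_coe.2 le_top)
  have hbound : ∀ i, ∃ B, ∀ z, ‖iteratedFDeriv ℝ n (g i) z‖ ≤ B := fun i =>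
    ((hgc i).iteratedFDeriv (𝕜 := ℝ) n).exists_bound_of_continuous
      ((hgn i).continuous_iteratedFDeriv le_rfl)
  choose B hB using hbound
  filter_upwards [eventually_sum_abs_mul_le hε B] with c hc z
  rw [iteratedFDeriv_fun_sum_apply fun i _ => ((hgn i).const_smul (c i)).contDiffAt]
  refine (norm_sum_le _ _).trans (le_trans (Finset.sum_le_sum fun i _ => ?_) hc)
  rw [iteratedFDeriv_const_smul_apply' (hgn i).contDiffAt, norm_smul, Real.norm_eq_abs]
  exact mul_le_mul_of_nonneg_left (hB i z) (abs_nonneg _)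

lemma eventually_norm_sum_smul_le {X E : Type*} [SeminormedAddCommGroup E] [NormedSpace ℝ E]
    {g : ι → X → E} {w : X → ℝ} {s : Set X} (hw : ∀ x, 0 ≤ w x)
    (hg : ∀ i, ∃ B, ∀ x ∈ s, ‖g i x‖ ≤ B * w x) (hε : 0 < ε) :
    ∀ᶠ c : ι → ℝ in 𝓝 0, ∀ x ∈ s, ‖∑ i, c i • g i x‖ ≤ ε * w x := by
  choose B hB using hg
  filter_upwards [eventually_sum_abs_mul_le hε B] with c hc x hx
  calc ‖∑ i, c i • g i x‖ ≤ ∑ i, |c i| * B i * w x := by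
        refine (norm_sum_le _ _).trans (Finset.sum_le_sum fun i _ => ?_)
        rw [norm_smul, Real.norm_eq_abs, mul_assoc]
        exact mul_le_mul_of_nonneg_left (hB i x hx) (abs_nonneg _)
    _ ≤ ε * w x := by
        rw [← Finset.sum_mul]
        exact mul_le_mul_of_nonneg_right hc (hw x)

lemma eventually_abs_sum_comp_action_le (hG : IsSymplectic G) (hG0 : ∀ᶠ z in 𝓝 0, G z = z)
    (hu : ∀ i, ContDiff ℝ ∞ (u i)) (hu0 : ∀ i, u i =O[𝓝 0] fun r => ‖r‖ ^ 2) (hε : 0 < ε) :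
    ∀ᶠ c : ι → ℝ in 𝓝 0, ∀ z : Phase d, ‖z‖ ≤ 1 →
      |∑ i, c i * u i (action (G z))| ≤ ε * ‖z‖ ^ 3 := by
  refine eventually_norm_sum_smul_le (s := {z : Phase d | ‖z‖ ≤ 1})
    (g := fun i z => u i (action (G z))) (fun z => by positivity) (fun i => ?_) hε
  refine exists_forall_abs_le_mul_norm_pow (contDiff_comp_action (hu i) hG).continuous ?_ 1
  refine (isBigO_comp_action (hu0 i)).congr' ?_ EventuallyEq.rfl
  filter_upwards [hG0] with z hz
  rw [hz]

lemma eventually_norm_sum_smul_grad_le (hu : ∀ i, ContDiff ℝ ∞ (u i)) (R : ℝ) (hε : 0 < ε) :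
    ∀ᶠ c : ι → ℝ in 𝓝 0, ∀ r : Fin d → ℝ, ‖r‖ ≤ R → ‖∑ i, c i • grad (u i) r‖ ≤ ε := by
  have hbound : ∀ i, ∃ B, ∀ r ∈ {r : Fin d → ℝ | ‖r‖ ≤ R}, ‖grad (u i) r‖ ≤ B * 1 := fun i => by
    obtain ⟨B, hB⟩ := (isCompact_closedBall (0 : Fin d → ℝ) R).exists_bound_of_continuousOn
      (continuous_grad (hu i)).continuousOn
    exact ⟨B, fun r hr => by simpa using hB r (by simpa using hr)⟩
  filter_upwards [eventually_norm_sum_smul_le (fun _ => zero_le_one) hbound hε] with c hc r hr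
  simpa using hc r hr

lemma exists_flowClose_perturbed (hh : ContDiff ℝ ∞ h) (hG : IsSymplectic G)
    (hG0 : ∀ᶠ z in 𝓝 0, G z = z) (hu : ∀ i, ContDiff ℝ ∞ (u i))
    (hu0 : ∀ i, u i =O[𝓝 0] fun r => ‖r‖ ^ 2) (j : ℕ) (R : ℝ) (hε : 0 < ε) :
    ∃ η > 0, ∀ c : ι → ℝ, ‖c‖ < η → FlowClose j R ε h G (perturbed h u c) G := by
  suffices hev : ∀ᶠ c : ι → ℝ in 𝓝 0, FlowClose j R ε h G (perturbed h u c) G by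
    obtain ⟨η, hη, hclose⟩ := Metric.eventually_nhds_iff.1 hev
    exact ⟨η, hη, fun c hc => hclose (by simpa using hc)⟩
  have hderiv : ∀ᶠ c : ι → ℝ in 𝓝 0, ∀ l ∈ Finset.range (j + 1), ∀ n ∈ Finset.range (j + 1),
      ∀ z, ‖iteratedFDeriv ℝ n
        (fun w => ∑ i, c i • (cutoff d l w * u i (action (G w)))) z‖ ≤ ε := by
    simp only [Filter.eventually_all_finset]
    exact fun l _ n _ => eventually_norm_iteratedFDeriv_sum_le
      (fun i => (contDiff_cutoff d l).mul (contDiff_comp_action (hu i) hG))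
      (fun i => (hasCompactSupport_cutoff d l).mul_right) n hε
  filter_upwards [eventually_dist_conjFlow_perturbed_le hh hG hu R hε, hderiv,
    eventually_abs_sum_comp_action_le hG hG0 hu hu0 hε,
    eventually_norm_sum_smul_grad_le hu j hε] with c hflow hderiv hham hfreq
  refine ⟨hflow, fun l hl n hn z => ?_, fun z hz => ?_, fun r hr => ?_⟩
  · convert hderiv l (by simp; omega) n (by simp; omega) z using 4 with w
    simp only [perturbed, add_sub_cancel_left, Finset.mul_sum, smul_eq_mul, mul_left_comm]
  · simpa only [perturbed, add_sub_cancel_left] using hham z hz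
  · rw [grad_perturbed (hh.differentiable (by simp)) fun i => (hu i).differentiable (by simp),
      add_sub_cancel_left]
    exact hfreq r hr

end Perturbation

section Gluing

variable {d : ℕ} {O : Set (Fin d → ℝ)}

lemma action_apply_mem_iff {γ : Phase d ≃ Phase d} (hγ : ∀ z, action z ∉ O → γ z = z)
    (z : Phase d) : action (γ z) ∈ O ↔ action z ∈ O := by
  constructor
  · intro hmem
    by_contra hz
    exact hz (hγ z hz ▸ hmem)
  · intro hmem
    by_contra hz
    exact hz ((γ.injective (hγ (γ z) hz)).symm ▸ hmem)

lemma exists_isSymplectic_glue {ι : Type*} (S : Finset ι) (O : ι → Set (Fin d → ℝ))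
    (γ : ι → Phase d ≃ Phase d) (hO : (S : Set ι).PairwiseDisjoint O)
    (hγ : ∀ m ∈ S, IsSymplectic (γ m)) (hid : ∀ m ∈ S, ∀ z, action z ∉ O m → γ m z = z) :
    ∃ Γ : Phase d ≃ Phase d, IsSymplectic Γ ∧ (∀ m ∈ S, ∀ z, action z ∈ O m → Γ z = γ m z) ∧
      ∀ z, (∀ m ∈ S, action z ∉ O m) → Γ z = z := by
  classical
  induction S using Finset.induction_on with
  | empty => exact ⟨Equiv.refl _, IsSymplectic.refl, by simp, fun _ _ => rfl⟩
  | insert a S ha ih =>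
    simp only [Finset.forall_mem_insert] at hγ hid
    rw [Finset.coe_insert, Set.pairwiseDisjoint_insert_of_notMem (by simpa using ha)] at hO
    obtain ⟨Γ, hΓ, hΓO, hΓid⟩ := ih hO.1 hγ.2 hid.2
    refine ⟨Γ.trans (γ a), hΓ.trans hγ.1, Finset.forall_mem_insert _ _ _ |>.2 ⟨?_, ?_⟩, ?_⟩
    · intro z hz
      rw [Equiv.trans_apply, hΓid z fun m hm => Set.disjoint_left.1 (hO.2 m hm) hz]
    · intro m hm z hz
      rw [Equiv.trans_apply, hΓO m hm z hz]
      refine hid.1 _ (Set.disjoint_right.1 (hO.2 m hm) ?_)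
      exact (action_apply_mem_iff (hid.2 m hm) z).2 hz
    · intro z hz
      rw [Finset.forall_mem_insert] at hz
      rw [Equiv.trans_apply, hΓid z hz.2, hid.1 z hz.1]

end Gluing

section Resonance

variable {d : ℕ} {O : Set (Fin d → ℝ)} {κ : Fin d → ℤ} {h : (Fin d → ℝ) → ℝ} {ρ : Fin d → ℝ}
  {t : ℝ}

/-- The frequencies of the integrable Hamiltonian `h` are orthogonal to the integer vector `κ` at
all actions in `O`. -/
def IsResonantOn (κ : Fin d → ℤ) (h : (Fin d → ℝ) → ℝ) (O : Set (Fin d → ℝ)) : Prop :=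
  ∀ r ∈ O, ∑ i, κ i * grad h r i = 0

lemma IsResonantOn.apply_eq_of_lineIn (hh : Differentiable ℝ h) (hres : IsResonantOn κ h O)
    (hl : LineIn O κ ρ t) : h (ρ + t • (fun i => (κ i : ℝ))) = h ρ := by
  have hderiv : ∀ s ∈ Set.uIcc 0 t, HasDerivWithinAt (fun s => h (ρ + s • (fun i => (κ i : ℝ)))) 0
      (Set.uIcc 0 t) s := by
    intro s hs
    have hline : HasDerivAt (fun s : ℝ => ρ + s • (fun i => (κ i : ℝ))) (fun i => (κ i : ℝ)) s := by
      simpa using ((hasDerivAt_id s).smul_const (fun i => (κ i : ℝ))).const_add ρ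
    have hcomp := (hh _).hasFDerivAt.comp_hasDerivAt s hline
    rw [fderiv_eq_sum_grad, hres _ (hl s hs)] at hcomp
    exact hcomp.hasDerivWithinAt
  have hbound := (convex_uIcc (0 : ℝ) t).norm_image_sub_le_of_norm_hasDerivWithin_le (C := 0)
    hderiv (by simp) Set.left_mem_uIcc Set.right_mem_uIcc
  simpa [sub_eq_zero] using hbound

lemma eventually_lineIn (hO : IsOpen O) (hl : LineIn O κ ρ t) : ∀ᶠ r in 𝓝 ρ, LineIn O κ r t := by
  refine isCompact_uIcc.eventually_forall_of_forall_eventually fun s hs => ?_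
  have hcont : Continuous fun q : (Fin d → ℝ) × ℝ => q.1 + q.2 • (fun i => (κ i : ℝ)) := by fun_prop
  exact (hcont.tendsto (ρ, s)).eventually (hO.mem_nhds (hl s hs))

lemma IsResonantOn.grad_eq_of_lineIn (hh : Differentiable ℝ h) (hO : IsOpen O)
    (hres : IsResonantOn κ h O) (hl : LineIn O κ ρ t) :
    grad h (ρ + t • (fun i => (κ i : ℝ))) = grad h ρ := by
  have htranslate : (fun r => h (r + t • (fun i => (κ i : ℝ)))) =ᶠ[𝓝 ρ] h :=
    (eventually_lineIn hO hl).mono fun r hr => hres.apply_eq_of_lineIn hh hr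
  have hfderiv := htranslate.fderiv_eq (𝕜 := ℝ)
  rw [fderiv_comp_add_right (𝕜 := ℝ) (f := h)] at hfderiv
  funext i
  simp only [grad, hfderiv]

lemma IsResonantOn.sum_mul_smul_grad_eq_zero (hres : IsResonantOn κ h O) (hρ : ρ ∈ O) (t : ℝ) :
    ∑ i, κ i * (t • grad h ρ) i = 0 := by
  simp only [Pi.smul_apply, smul_eq_mul, mul_left_comm _ t, ← Finset.mul_sum, hres ρ hρ, mul_zero]

/-- Some member of the class `Adm` with the property `P` is obtained from `h` by adding an
arbitrarily small linear combination of finitely many fixed functions of second order at `0`. -/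
def HasSmallPerturbation (Adm P : ((Fin d → ℝ) → ℝ) → Prop) (h : (Fin d → ℝ) → ℝ) : Prop :=
  ∃ (N : ℕ) (u : Fin N → (Fin d → ℝ) → ℝ), (∀ i, ContDiff ℝ ∞ (u i)) ∧
    (∀ i, u i =O[𝓝 0] fun r => ‖r‖ ^ 2) ∧
    ∀ η > 0, ∃ c : Fin N → ℝ, ‖c‖ < η ∧ Adm (perturbed h u c) ∧ P (perturbed h u c)

end Resonance

/-- The combinatorics of actions and resonances behind the construction. The domain `D` in the
space of actions is exhausted by the compact sets `Q j` and covered by the sets `C m`. Arbitrarily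
small perturbations of the Hamiltonians of the class `Adm` are resonant on the zones `O m ⊇ C m`
with directions in `dir m`, along which `C m` is invariant, or have these resonances broken. Zones
with indices of the same parity are disjoint, so that they can be treated simultaneously. -/
structure ZoneSystem (d : ℕ) where
  D : Set (Fin d → ℝ)
  pos : ∀ r ∈ D, ∀ i, 0 < r i
  zero_notMem : (0 : Fin d → ℝ) ∉ D
  Q : ℕ → Set (Fin d → ℝ)
  isCompact_Q : ∀ j, IsCompact (Q j)
  Q_subset : ∀ j, Q j ⊆ D
  monotone_Q : Monotone Q
  exists_subset_Q : ∀ K, IsCompact K → K ⊆ D → ∃ j, K ⊆ Q j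
  lineIn_Q : ∀ j κ ρ t, ρ ∈ Q j → ρ + t • (fun i => ((κ : Fin d → ℤ) i : ℝ)) ∈ Q j →
    LineIn D κ ρ t → LineIn (Q j) κ ρ t
  O : ℕ → Set (Fin d → ℝ)
  C : ℕ → Set (Fin d → ℝ)
  isOpen_O : ∀ m, IsOpen (O m)
  O_subset : ∀ m, O m ⊆ D
  C_subset : ∀ m, C m ⊆ O m
  isCompact_C_inter : ∀ m K, IsCompact K → K ⊆ D → IsCompact (C m ∩ K)
  cover : ∀ r ∈ D, ∃ m, r ∈ C m
  disjoint_O : ∀ m m', m ≠ m' → m % 2 = m' % 2 → Disjoint (O m) (O m')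
  finite_C : ∀ K, IsCompact K → K ⊆ D → ∃ M, ∀ m, (C m ∩ K).Nonempty → m < M
  dir : ℕ → Set (Fin d → ℤ)
  dir_ne : ∀ m, ∀ κ ∈ dir m, κ ≠ 0
  inv_C : ∀ m, ∀ κ ∈ dir m, LineInvariant D κ (C m)
  Adm : ((Fin d → ℝ) → ℝ) → Prop
  contDiff_of_adm : ∀ h, Adm h → ContDiff ℝ ∞ h
  resonate : ∀ h, Adm h → ∀ M : ℕ, HasSmallPerturbation Adm
    (fun h' => ∃ κ : ℕ → Fin d → ℤ, ∀ m < M, κ m ∈ dir m ∧ IsResonantOn (κ m) h' (O m)) h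
  detune : ∀ h, Adm h → ∀ (M : ℕ) (κ : ℕ → Fin d → ℤ),
    (∀ m < M, κ m ∈ dir m ∧ IsResonantOn (κ m) h (O m)) → HasSmallPerturbation Adm
      (fun h' => ∀ m < M, ∀ r ∈ C m, ∑ i, κ m i * grad h' r i ≠ 0) h

namespace ZoneSystem

variable {d : ℕ} (Z : ZoneSystem d)

/-- The integrable Hamiltonian `h` and the change of coordinates `G` define one of the
approximations `h ∘ action ∘ G`. -/
structure IsState (h : (Fin d → ℝ) → ℝ) (G : Phase d ≃ Phase d) : Prop where
  adm : Z.Adm h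
  symplectic : IsSymplectic G
  support : ∃ K, IsCompact K ∧ K ⊆ Z.D ∧ ∀ z, action z ∉ K → G z = z

/-- The lines through `ρ` in the directions of the zone `m` avoid `K`, and, followed in the positive
sense, they stay in `L` until they are far from the origin. From a small such `ρ` an orbit can thus
be driven from the ball of radius `A⁻¹` out of the ball of radius `A`. -/
structure IsDriftPoint (A : ℝ) (K L : Set (Fin d → ℝ)) (m : ℕ) (ρ : Fin d → ℝ) : Prop where
  mem : ρ ∈ Z.C m
  sum_lt : 2 * ∑ i, ρ i < A⁻¹ ^ 2
  dir_nonneg : ∀ κ ∈ Z.dir m, ∀ i, 0 ≤ κ i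
  notMem : ∀ κ ∈ Z.dir m, ∀ t, LineIn Z.D κ ρ t → ρ + t • (fun i => (κ i : ℝ)) ∉ K
  mem_of_sum_lt : ∀ κ ∈ Z.dir m, ∀ t, 0 ≤ t → LineIn Z.D κ ρ t →
    ∑ i, (ρ + t • (fun i => (κ i : ℝ))) i < A ^ 2 → ρ + t • (fun i => (κ i : ℝ)) ∈ L

/-- There are drift points in zones of both parities, away from any given compact set. -/
def Drift : Prop :=
  ∀ A > 0, ∀ K, IsCompact K → K ⊆ Z.D → ∀ m₀ : ℕ, ∃ m, m % 2 = m₀ % 2 ∧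
    ∃ ρ L, IsCompact L ∧ L ⊆ Z.D ∧ Z.IsDriftPoint A K L m ρ

variable {Z} {h : (Fin d → ℝ) → ℝ} {G : Phase d ≃ Phase d}

lemma IsState.eventually_eq (hs : Z.IsState h G) : ∀ᶠ z in 𝓝 0, G z = z := by
  obtain ⟨K, hK, hKD, hid⟩ := hs.support
  have hzero : action (0 : Phase d) = 0 := by
    funext i
    simp [action]
  have hnotMem : action (0 : Phase d) ∈ Kᶜ := hzero ▸ fun hmem => Z.zero_notMem (hKD hmem)
  exact ((continuous_action.tendsto 0).eventually
    (hK.isClosed.isOpen_compl.mem_nhds hnotMem)).mono hid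

lemma IsState.action_mem (hs : Z.IsState h G) (z : Phase d) :
    action (G z) ∈ Z.D ↔ action z ∈ Z.D := by
  obtain ⟨K, -, hKD, hid⟩ := hs.support
  exact action_apply_mem_iff (fun z hz => hid z fun hmem => hz (hKD hmem)) z

lemma IsState.exists_flowClose (hs : Z.IsState h G) {P : ((Fin d → ℝ) → ℝ) → Prop}
    (hP : HasSmallPerturbation Z.Adm P h) (j : ℕ) (R : ℝ) {ε : ℝ} (hε : 0 < ε) :
    ∃ h', Z.Adm h' ∧ P h' ∧ FlowClose j R ε h G h' G := by
  obtain ⟨N, u, hu, hu0, hpert⟩ := hP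
  obtain ⟨η, hη, hclose⟩ := exists_flowClose_perturbed (Z.contDiff_of_adm h hs.adm) hs.symplectic
    hs.eventually_eq hu hu0 j R hε
  obtain ⟨c, hc, hadm, hPc⟩ := hpert η hη
  exact ⟨_, hadm, hPc, hclose c hc⟩

variable (Z) in
/-- `Γ` moves the points of the zones `O m`, `m ∈ S`, along the directions `κ m`, and nothing else;
those points of `C m` whose monomial is imaginary are moved so far that they leave `Q j`. -/
structure IsZoneMap (κ : ℕ → Fin d → ℤ) (S : Finset ℕ) (j : ℕ) (Γ : Phase d ≃ Phase d) :
    Prop where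
  dir_mem : ∀ m ∈ S, κ m ∈ Z.dir m
  symplectic : IsSymplectic Γ
  support : ∃ K, IsCompact K ∧ K ⊆ Z.D ∧ ∀ z, action z ∉ K → Γ z = z
  eq_self : ∀ z, (∀ m ∈ S, action z ∉ Z.O m) → Γ z = z
  map_rotate : ∀ m ∈ S, ∀ θ : Fin d → ℝ, ∑ i, κ m i * θ i = 0 → ∀ z, action z ∈ Z.O m →
    Γ (rotate θ z) = rotate θ (Γ z)
  exists_action_eq : ∀ m ∈ S, ∀ z, action z ∈ Z.O m →
    ∃ t, action (Γ z) = action z + t • (fun i => (κ m i : ℝ)) ∧ LineIn (Z.O m) (κ m) (action z) t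
  exists_isRadialShift : ∀ m ∈ S, ∀ z, action z ∈ Z.C m → (monomial (κ m) z).re = 0 →
    ∃ t, IsRadialShift (κ m) (Z.O m) z (Γ z) t ∧ ¬ LineIn (Z.Q j) (κ m) (action z) t

variable {κ : ℕ → Fin d → ℤ} {S : Finset ℕ} {j : ℕ} {Γ : Phase d ≃ Phase d}

lemma exists_isZoneMap (hκ : ∀ m ∈ S, κ m ∈ Z.dir m) (hS : (S : Set ℕ).PairwiseDisjoint Z.O)
    (j : ℕ) : ∃ Γ, Z.IsZoneMap κ S j Γ := by
  have hzone : ∀ m ∈ S, ∃ γ K, IsCompact K ∧ K ⊆ Z.O m ∧ IsResonantMap (κ m) (Z.O m) K γ ∧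
      ∀ z, action z ∈ Z.C m → (monomial (κ m) z).re = 0 →
        ∃ t, IsRadialShift (κ m) (Z.O m) z (γ z) t ∧ ¬ LineIn (Z.Q j) (κ m) (action z) t :=
    fun m hm => exists_isResonantMap_not_lineIn (Z.dir_ne m _ (hκ m hm)) (Z.isOpen_O m)
      (fun r hr => Z.pos r (Z.O_subset m hr)) (Z.C_subset m) (Z.isCompact_Q j).isBounded
      (Z.isCompact_C_inter m _ (Z.isCompact_Q j) (Z.Q_subset j))
      fun ρ hρ t hl => Z.inv_C m _ (hκ m hm) ρ hρ t (hl.mono_set (Z.O_subset m))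
  choose! γ K hK hKO hγ hshift using hzone
  have hid : ∀ m ∈ S, ∀ z, action z ∉ Z.O m → γ m z = z := fun m hm z hz =>
    (hγ m hm).eq_self z fun hmem => hz (hKO m hm hmem)
  obtain ⟨Γ, hΓ, hΓO, hΓid⟩ := exists_isSymplectic_glue S Z.O γ hS
    (fun m hm => (hγ m hm).symplectic) hid
  refine ⟨Γ, hκ, hΓ, ⟨⋃ m ∈ S, K m, S.isCompact_biUnion hK,
    Set.iUnion₂_subset fun m hm => (hKO m hm).trans (Z.O_subset m), fun z hz => ?_⟩, hΓid, ?_, ?_,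
    ?_⟩
  · by_cases hzone : ∃ m ∈ S, action z ∈ Z.O m
    · obtain ⟨m, hm, hzO⟩ := hzone
      rw [hΓO m hm z hzO]
      exact (hγ m hm).eq_self z fun hmem => hz (Set.mem_biUnion hm hmem)
    · exact hΓid z fun m hm hzO => hzone ⟨m, hm, hzO⟩
  · intro m hm θ hθ z hz
    rw [hΓO m hm z hz, hΓO m hm _ (by rwa [action_rotate]), (hγ m hm).map_rotate θ hθ]
  · intro m hm z hz
    rw [hΓO m hm z hz]
    exact (hγ m hm).exists_action_eq z hz
  · intro m hm z hz
    rw [hΓO m hm z (Z.C_subset m hz)]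
    exact hshift m hm z hz

namespace IsZoneMap

lemma apply_action_eq (hΓ : Z.IsZoneMap κ S j Γ) (hh : Z.Adm h)
    (hres : ∀ m ∈ S, IsResonantOn (κ m) h (Z.O m)) (z : Phase d) :
    h (action (Γ z)) = h (action z) := by
  by_cases hz : ∃ m ∈ S, action z ∈ Z.O m
  · obtain ⟨m, hm, hzO⟩ := hz
    obtain ⟨t, ht, hl⟩ := hΓ.exists_action_eq m hm z hzO
    rw [ht]
    exact (hres m hm).apply_eq_of_lineIn ((Z.contDiff_of_adm h hh).differentiable (by simp)) hl
  · rw [hΓ.eq_self z fun m hm hzO => hz ⟨m, hm, hzO⟩]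

lemma map_actionFlow (hΓ : Z.IsZoneMap κ S j Γ) (hh : Z.Adm h)
    (hres : ∀ m ∈ S, IsResonantOn (κ m) h (Z.O m)) (t : ℝ) (z : Phase d) :
    Γ (actionFlow h t z) = actionFlow h t (Γ z) := by
  by_cases hz : ∃ m ∈ S, action z ∈ Z.O m
  · obtain ⟨m, hm, hzO⟩ := hz
    obtain ⟨s, hs, hl⟩ := hΓ.exists_action_eq m hm z hzO
    have hgrad : grad h (action (Γ z)) = grad h (action z) := by
      rw [hs]
      exact (hres m hm).grad_eq_of_lineIn ((Z.contDiff_of_adm h hh).differentiable (by simp))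
        (Z.isOpen_O m) hl
    rw [actionFlow, actionFlow, hgrad]
    exact hΓ.map_rotate m hm _ ((hres m hm).sum_mul_smul_grad_eq_zero hzO t) z hzO
  · push Not at hz
    rw [hΓ.eq_self z hz, hΓ.eq_self _ (by simpa using hz)]

lemma action_mem_C_iff (hΓ : Z.IsZoneMap κ S j Γ) {m : ℕ} (hm : ∀ m' ∈ S, m' % 2 = m % 2)
    (z : Phase d) : action (Γ z) ∈ Z.C m ↔ action z ∈ Z.C m := by
  by_cases hz : ∃ m' ∈ S, action z ∈ Z.O m'
  · obtain ⟨m', hm', hzO⟩ := hz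
    obtain ⟨t, ht, hl⟩ := hΓ.exists_action_eq m' hm' z hzO
    rcases eq_or_ne m' m with rfl | hne
    · have hC := Z.inv_C m' _ (hΓ.dir_mem m' hm')
      have hlD := hl.mono_set (Z.O_subset m')
      rw [ht]
      refine ⟨fun hmem => ?_, fun hmem => hC _ hmem _ hlD⟩
      simpa [add_assoc, ← add_smul] using hC _ hmem _ hlD.neg
    · have hdisj := Z.disjoint_O m' m hne (hm m' hm')
      have hΓzO : action (Γ z) ∈ Z.O m' := ht ▸ hl.right_mem
      exact iff_of_false (fun hmem => Set.disjoint_left.1 hdisj hΓzO (Z.C_subset m hmem))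
        fun hmem => Set.disjoint_left.1 hdisj hzO (Z.C_subset m hmem)
  · rw [hΓ.eq_self z fun m' hm' hzO => hz ⟨m', hm', hzO⟩]

end IsZoneMap

end ZoneSystem

section Stability

variable {d : ℕ} {Φ Ψ : ℝ → Phase d → Phase d} {P P' : (ℝ → Phase d → Phase d) → Prop}

/-- The two motions are `ε`-close on the ball of radius `R` up to the time `R`. -/
def MotionClose (ε R : ℝ) (Φ Ψ : ℝ → Phase d → Phase d) : Prop :=
  ∀ t z, |t| ≤ R → ‖z‖ ≤ R → dist (Φ t z) (Ψ t z) ≤ ε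

/-- The property `P` holds for all motions that are close to `Φ` on some bounded set. Such
properties survive the passage to the limit of the successive approximations. -/
def HoldsNear (Φ : ℝ → Phase d → Phase d) (P : (ℝ → Phase d → Phase d) → Prop) : Prop :=
  ∃ ε > 0, ∃ R, ∀ Ψ, MotionClose ε R Φ Ψ → P Ψ

lemma MotionClose.mono {ε ε' R R' : ℝ} (h : MotionClose ε R Φ Ψ) (hε : ε ≤ ε') (hR : R' ≤ R) :
    MotionClose ε' R' Φ Ψ := fun t z ht hz =>
  (h t z (ht.trans hR) (hz.trans hR)).trans hε

lemma HoldsNear.mono (h : HoldsNear Φ P) (hP : ∀ Ψ, P Ψ → P' Ψ) : HoldsNear Φ P' := by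
  obtain ⟨ε, hε, R, hR⟩ := h
  exact ⟨ε, hε, R, fun Ψ hΨ => hP Ψ (hR Ψ hΨ)⟩

lemma HoldsNear.and (h : HoldsNear Φ P) (h' : HoldsNear Φ P') :
    HoldsNear Φ fun Ψ => P Ψ ∧ P' Ψ := by
  obtain ⟨ε, hε, R, hR⟩ := h
  obtain ⟨ε', hε', R', hR'⟩ := h'
  exact ⟨min ε ε', lt_min hε hε', max R R', fun Ψ hΨ =>
    ⟨hR Ψ (hΨ.mono (min_le_left _ _) (le_max_left _ _)),
      hR' Ψ (hΨ.mono (min_le_right _ _) (le_max_right _ _))⟩⟩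

lemma holdsNear_visit {t : ℝ} (hΦ : Continuous (Φ t)) {U : Set (Phase d)} (hU : IsOpen U)
    {z : Phase d} (hz : Φ t z ∈ U) :
    ∃ V ∈ 𝓝 z, HoldsNear Φ fun Ψ => ∀ w ∈ V, Ψ t w ∈ U := by
  obtain ⟨ε, hε, hball⟩ := Metric.isOpen_iff.1 hU _ hz
  have hV : ∀ᶠ w in 𝓝 z, dist (Φ t w) (Φ t z) < ε / 2 ∧ ‖w‖ < ‖z‖ + 1 :=
    ((hΦ.tendsto z).eventually (Metric.ball_mem_nhds _ (half_pos hε))).and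
      ((continuous_norm.tendsto z).eventually (gt_mem_nhds (lt_add_one _)))
  refine ⟨_, hV, ε / 2, half_pos hε, max |t| (‖z‖ + 1), fun Ψ hΨ w hw => hball ?_⟩
  have hclose := hΨ t w (le_max_left _ _) (hw.2.le.trans (le_max_right _ _))
  rw [dist_comm] at hclose
  calc dist (Ψ t w) (Φ t z) ≤ dist (Ψ t w) (Φ t w) + dist (Φ t w) (Φ t z) := dist_triangle _ _ _
    _ < ε / 2 + ε / 2 := add_lt_add_of_le_of_lt hclose hw.1
    _ = ε := add_halves ε

lemma holdsNear_exists_visit_of_isCompact {A U : Set (Phase d)} (hA : IsCompact A)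
    (hΦ : ∀ t, Continuous (Φ t)) (hU : IsOpen U) (hAU : ∀ z ∈ A, ∃ t, Φ t z ∈ U) :
    HoldsNear Φ fun Ψ => ∀ z ∈ A, ∃ t, Ψ t z ∈ U := by
  refine hA.induction_on ⟨1, one_pos, 0, by simp⟩
    (fun s s' hss' hs' => hs'.mono fun Ψ hΨ z hz => hΨ z (hss' hz))
    (fun s s' hs hs' => (hs.and hs').mono fun Ψ hΨ z hz => hz.elim (hΨ.1 z) (hΨ.2 z))
    fun z hz => ?_
  obtain ⟨t, ht⟩ := hAU z hz
  obtain ⟨V, hV, hVU⟩ := holdsNear_visit (hΦ t) hU ht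
  exact ⟨V, mem_nhdsWithin_of_mem_nhds hV, hVU.mono fun Ψ hΨ w hw => ⟨t, hΨ w hw⟩⟩

end Stability

section Step

variable {d : ℕ}

lemma exists_monomial_rotate_eq {κ : Fin d → ℤ} {v : Fin d → ℝ} (hv : ∑ i, κ i * v i ≠ 0)
    (w : Phase d) {σ : ℝ} (hσ : σ = 1 ∨ σ = -1) :
    ∃ t : ℝ, (monomial κ (rotate (t • v) w)).re = 0 ∧
      (monomial κ (rotate (t • v) w)).im = σ * ‖monomial κ w‖ := by
  set p := monomial κ w with hp
  refine ⟨(σ * (Real.pi / 2) - p.arg) / ∑ i, κ i * v i, ?_⟩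
  set t := (σ * (Real.pi / 2) - p.arg) / ∑ i, κ i * v i with ht
  have hangle : ∑ i, (κ i : ℝ) * (t • v) i = σ * (Real.pi / 2) - p.arg := by
    simp only [Pi.smul_apply, smul_eq_mul, mul_left_comm _ t, ← Finset.mul_sum]
    exact div_mul_cancel₀ _ hv
  have hpolar : monomial κ (rotate (t • v) w) =
      (‖p‖ : ℂ) * Complex.exp (((σ * (Real.pi / 2) : ℝ) : ℂ) * Complex.I) := by
    rw [monomial_rotate, hangle, ← hp]
    conv_lhs => rw [← Complex.norm_mul_exp_arg_mul_I p]
    rw [mul_left_comm, ← Complex.exp_add, ← add_mul, ← Complex.ofReal_add,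
      Complex.norm_mul_exp_arg_mul_I, sub_add_cancel]
  rw [hpolar, Complex.exp_mul_I, ← Complex.ofReal_cos, ← Complex.ofReal_sin]
  rcases hσ with rfl | rfl
  · simp
  · simp [neg_mul]

lemma exists_action_eq {ρ : Fin d → ℝ} (hρ : ∀ i, 0 ≤ ρ i) : ∃ w : Phase d, action w = ρ := by
  refine ⟨WithLp.toLp 2 (Sum.elim (fun i => Real.sqrt (2 * ρ i)) (fun _ => 0)), funext fun i => ?_⟩
  have hsq := Real.sq_sqrt (show 0 ≤ 2 * ρ i by linarith [hρ i])
  simp only [action, Sum.elim_inl, Sum.elim_inr, hsq]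
  ring

lemma continuous_conjFlow {h : (Fin d → ℝ) → ℝ} (hh : ContDiff ℝ ∞ h) {G : Phase d ≃ Phase d}
    (hG : IsSymplectic G) (t : ℝ) : Continuous (conjFlow h G t) := by
  have hcont := (continuous_conjFlow_perturbed (ι := Empty) (u := fun _ _ => 0) hh hG
    fun _ => contDiff_const).comp
    ((continuous_const (y := (0 : Empty → ℝ))).prodMk
      ((continuous_const (y := t)).prodMk (continuous_id (X := Phase d))))
  simpa only [Function.comp_def, perturbed_zero, id] using hcont

lemma LineIn.of_zero_mem_uIcc {S : Set (Fin d → ℝ)} {κ : Fin d → ℤ} {ρ : Fin d → ℝ} {s t : ℝ}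
    (h : LineIn S κ (ρ + s • (fun i => (κ i : ℝ))) (-s + t)) (hzero : 0 ∈ Set.uIcc s t) :
    LineIn S κ ρ t := by
  intro x hx
  have hmem : x - s ∈ Set.uIcc 0 (-s + t) := by
    have hxst : x ∈ Set.uIcc s t := Set.uIcc_subset_uIcc hzero Set.right_mem_uIcc hx
    rw [Set.mem_uIcc] at hxst ⊢
    exact hxst.imp (fun hxst => ⟨by linarith, by linarith⟩)
      fun hxst => ⟨by linarith, by linarith⟩
  simpa [add_assoc, ← add_smul] using h _ hmem

namespace ZoneSystem

variable {Z : ZoneSystem d} {h : (Fin d → ℝ) → ℝ} {G Γ : Phase d ≃ Phase d}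
  {κ : ℕ → Fin d → ℤ} {S : Finset ℕ} {j j' m : ℕ}

lemma IsZoneMap.exists_action_actionFlow_eq (hΓ : Z.IsZoneMap κ S j Γ) (hm : m ∈ S) {w : Phase d}
    (hw : action w ∈ Z.C m) (hne : ∑ i, κ m i * grad h (action w) i ≠ 0) {σ : ℝ}
    (hσ : σ = 1 ∨ σ = -1) :
    ∃ t τ, 0 ≤ σ * τ ∧ action (Γ (actionFlow h t w)) = action w + τ • (fun i => (κ m i : ℝ)) ∧
      LineIn (Z.O m) (κ m) (action w) τ ∧ ¬ LineIn (Z.Q j) (κ m) (action w) τ := by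
  obtain ⟨t, hre, him⟩ := exists_monomial_rotate_eq hne w hσ
  obtain ⟨τ, hshift, hQ⟩ := hΓ.exists_isRadialShift m hm (actionFlow h t w)
    (by rwa [action_actionFlow]) hre
  have hsign := hshift.sign
  have haction := hshift.action_eq
  have hline := hshift.lineIn
  rw [action_actionFlow] at haction hline hQ
  refine ⟨t, τ, ?_, haction, hline, hQ⟩
  have hmono : 0 < ‖monomial (κ m) w‖ := norm_pos_iff.2
    (monomial_ne_zero _ (Z.pos _ (Z.O_subset m (Z.C_subset m hw))))
  rw [actionFlow, him, ← mul_assoc, mul_comm τ] at hsign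
  exact nonneg_of_mul_nonneg_left hsign hmono

-- Following the line in the sense that leads from `w` away from `Γ w`, the orbit crosses the whole
-- segment from `Γ w`, and `Q j` contains with two points of a line the segment between them.
lemma IsZoneMap.exists_action_notMem (hΓ : Z.IsZoneMap κ S j Γ) (hm : m ∈ S)
    (hS : ∀ m' ∈ S, m' % 2 = m % 2) (hne : ∀ r ∈ Z.C m, ∑ i, κ m i * grad h r i ≠ 0)
    {w : Phase d} (hwC : action (Γ w) ∈ Z.C m) (hwQ : action (Γ w) ∈ Z.Q j) :
    ∃ t, action (Γ (actionFlow h t w)) ∉ Z.Q j := by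
  have hw := (hΓ.action_mem_C_iff hS w).1 hwC
  obtain ⟨s, hs, hsl⟩ := hΓ.exists_action_eq m hm w (Z.C_subset m hw)
  obtain ⟨σ, hσ, hσs⟩ : ∃ σ : ℝ, (σ = 1 ∨ σ = -1) ∧ σ * s ≤ 0 := by
    rcases le_total s 0 with hs0 | hs0
    · exact ⟨1, Or.inl rfl, by linarith⟩
    · exact ⟨-1, Or.inr rfl, by linarith⟩
  obtain ⟨t, τ, hστ, hact, hτl, hτQ⟩ := hΓ.exists_action_actionFlow_eq hm hw (hne _ hw) hσ
  refine ⟨t, fun hQ => hτQ (LineIn.of_zero_mem_uIcc (s := s) ?_ ?_)⟩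
  · have hτ : action (Γ w) + (-s + τ) • (fun i => (κ m i : ℝ)) =
        action w + τ • (fun i => (κ m i : ℝ)) := by
      rw [hs, add_assoc, ← add_smul, add_neg_cancel_left]
    rw [← hs]
    refine Z.lineIn_Q j _ _ _ hwQ (by rwa [hτ, ← hact]) ?_
    refine (hs ▸ hsl.neg.add ?_ : LineIn (Z.O m) _ _ _).mono_set (Z.O_subset m)
    simpa [add_assoc, ← add_smul] using hτl
  · rw [Set.mem_uIcc]
    rcases hσ with rfl | rfl
    · exact Or.inl ⟨by linarith, by linarith⟩
    · exact Or.inr ⟨by linarith, by linarith⟩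

lemma sum_add_smul (ρ v : Fin d → ℝ) (t : ℝ) :
    ∑ i, (ρ + t • v) i = ∑ i, ρ i + t * ∑ i, v i := by
  simp [Finset.sum_add_distrib, Finset.mul_sum]

lemma IsDriftPoint.sq_le_sum {A t : ℝ} {K L : Set (Fin d → ℝ)} {ρ : Fin d → ℝ} {κ : Fin d → ℤ}
    (hρ : Z.IsDriftPoint A K L m ρ) (hκ : κ ∈ Z.dir m) (hLQ : L ⊆ Z.Q j) (ht : 0 ≤ t)
    (hl : LineIn Z.D κ ρ t) (hQ : ¬ LineIn (Z.Q j) κ ρ t) :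
    A ^ 2 ≤ ∑ i, (ρ + t • (fun i => (κ i : ℝ))) i := by
  obtain ⟨x, hx, hxQ⟩ : ∃ x ∈ Set.uIcc 0 t, ρ + x • (fun i => (κ i : ℝ)) ∉ Z.Q j := by
    simpa only [LineIn, not_forall, exists_prop] using hQ
  have hlx := hl.mono hx
  rw [Set.uIcc_of_le ht] at hx
  have hsum : (0 : ℝ) ≤ ∑ i, (κ i : ℝ) :=
    Finset.sum_nonneg fun i _ => by exact_mod_cast hρ.dir_nonneg κ hκ i
  calc A ^ 2 ≤ ∑ i, (ρ + x • (fun i => (κ i : ℝ))) i :=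
        not_lt.1 fun hlt => hxQ (hLQ (hρ.mem_of_sum_lt κ hκ x hx.1 hlx hlt))
    _ ≤ ∑ i, (ρ + t • (fun i => (κ i : ℝ))) i := by
        rw [sum_add_smul, sum_add_smul]
        gcongr
        exact hx.2

lemma IsZoneMap.exists_norm_lt_and_lt_norm (hΓ : Z.IsZoneMap κ S j Γ) (hm : m ∈ S)
    (hne : ∀ r ∈ Z.C m, ∑ i, κ m i * grad h r i ≠ 0) {A : ℝ} (hA : 0 < A)
    {K L : Set (Fin d → ℝ)} {ρ : Fin d → ℝ} (hρ : Z.IsDriftPoint A K L m ρ) (hLQ : L ⊆ Z.Q j) :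
    ∃ w t₁ t₂, (action (Γ (actionFlow h t₁ w)) ∉ K ∧ ‖Γ (actionFlow h t₁ w)‖ < A⁻¹) ∧
      action (Γ (actionFlow h t₂ w)) ∉ K ∧ A < ‖Γ (actionFlow h t₂ w)‖ := by
  have hκ := hΓ.dir_mem m hm
  obtain ⟨w, rfl⟩ := _root_.exists_action_eq fun i =>
    (Z.pos ρ (Z.O_subset _ (Z.C_subset _ hρ.mem)) i).le
  have hsum : (0 : ℝ) ≤ ∑ i, (κ m i : ℝ) :=
    Finset.sum_nonneg fun i _ => by exact_mod_cast hρ.dir_nonneg _ hκ i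
  obtain ⟨t₁, τ₁, hτ₁, hact₁, hl₁, -⟩ :=
    hΓ.exists_action_actionFlow_eq hm hρ.mem (hne _ hρ.mem) (Or.inr rfl)
  obtain ⟨t₂, τ₂, hτ₂, hact₂, hl₂, hQ₂⟩ :=
    hΓ.exists_action_actionFlow_eq hm hρ.mem (hne _ hρ.mem) (Or.inl rfl)
  replace hl₁ := hl₁.mono_set (Z.O_subset m)
  replace hl₂ := hl₂.mono_set (Z.O_subset m)
  refine ⟨w, t₁, t₂, ⟨by rw [hact₁]; exact hρ.notMem _ hκ _ hl₁, ?_⟩,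
    by rw [hact₂]; exact hρ.notMem _ hκ _ hl₂, ?_⟩
  · refine lt_of_pow_lt_pow_left₀ 2 (by positivity) ?_
    rw [norm_sq_eq_sum_action, hact₁, sum_add_smul]
    nlinarith [hρ.sum_lt]
  · refine lt_of_pow_lt_pow_left₀ 2 (norm_nonneg _) ?_
    have hfar := hρ.sq_le_sum hκ hLQ (by linarith) hl₂ hQ₂
    rw [norm_sq_eq_sum_action, hact₂]
    linarith [pow_pos hA 2]

lemma IsState.trans_symm (hs : Z.IsState h G) {h' : (Fin d → ℝ) → ℝ} (hh' : Z.Adm h')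
    (hΓ : Z.IsZoneMap κ S j Γ) : Z.IsState h' (G.trans Γ.symm) := by
  obtain ⟨K, hK, hKD, hKid⟩ := hs.support
  obtain ⟨L, hL, hLD, hLid⟩ := hΓ.support
  refine ⟨hh', hs.symplectic.trans hΓ.symplectic.symm, K ∪ L, hK.union hL,
    Set.union_subset hKD hLD, fun z hz => ?_⟩
  rw [Set.mem_union, not_or] at hz
  rw [Equiv.trans_apply, hKid z hz.1, Equiv.symm_apply_eq, hLid z hz.2]

-- A zone map preserves a resonant Hamiltonian and its flow, so that the approximation is the same
-- in the old and in the new coordinates.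
lemma IsZoneMap.flowClose_trans_symm {h' : (Fin d → ℝ) → ℝ} {n : ℕ} {R ε : ℝ}
    (hΓ : Z.IsZoneMap κ S j Γ) (hh' : Z.Adm h') (hres : ∀ m ∈ S, IsResonantOn (κ m) h' (Z.O m))
    (hclose : FlowClose n R ε h G h' G) : FlowClose n R ε h G h' (G.trans Γ.symm) := by
  have hham : ∀ z, h' (action (G.trans Γ.symm z)) = h' (action (G z)) := fun z => by
    rw [← hΓ.apply_action_eq hh' hres, Equiv.trans_apply, Equiv.apply_symm_apply]
  have hflow : ∀ t z, conjFlow h' (G.trans Γ.symm) t z = conjFlow h' G t z := fun t z => by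
    change G.symm (Γ (actionFlow h' t (Γ.symm (G z)))) = G.symm (actionFlow h' t (G z))
    rw [hΓ.map_actionFlow hh' hres, Equiv.apply_symm_apply]
  refine ⟨fun t z ht hz => ?_, fun l hl n hn z => ?_, fun z hz => ?_, hclose.freq⟩
  · rw [hflow]
    exact hclose.flow t z ht hz
  · simp only [hham]
    exact hclose.deriv l hl n hn z
  · rw [hham]
    exact hclose.ham z hz

/-- The indices below `M` with the parity of `j`: the zones treated in the step `j`. -/
def treatedZones (M j : ℕ) : Finset ℕ := (Finset.range M).filter fun m => m % 2 = j % 2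

lemma mem_treatedZones {M : ℕ} : m ∈ treatedZones M j ↔ m < M ∧ m % 2 = j % 2 := by
  simp [treatedZones]

lemma pairwiseDisjoint_treatedZones (M j : ℕ) :
    (treatedZones M j : Set ℕ).PairwiseDisjoint Z.O := fun m hm m' hm' hne =>
  Z.disjoint_O m m' hne ((mem_treatedZones.1 hm).2.trans (mem_treatedZones.1 hm').2.symm)

-- First a perturbation makes the zones resonant and the change of coordinates is composed with a
-- zone map, which has no effect yet; then a second perturbation breaks the resonances.
lemma IsState.exists_isZoneMap (hs : Z.IsState h G) (M j j' : ℕ) (R : ℝ) {ε : ℝ} (hε : 0 < ε) :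
    ∃ h' κ Γ, Z.IsZoneMap κ (treatedZones M j) j' Γ ∧ Z.IsState h' (G.trans Γ.symm) ∧
      FlowClose j R ε h G h' (G.trans Γ.symm) ∧
      ∀ m ∈ treatedZones M j, ∀ r ∈ Z.C m, ∑ i, κ m i * grad h' r i ≠ 0 := by
  obtain ⟨h₁, hadm₁, ⟨κ, hκ⟩, hclose₁⟩ :=
    hs.exists_flowClose (Z.resonate h hs.adm M) j R (half_pos hε)
  have hlt : ∀ m ∈ treatedZones M j, m < M := fun m hm => (mem_treatedZones.1 hm).1
  obtain ⟨Γ, hΓ⟩ := ZoneSystem.exists_isZoneMap (fun m hm => (hκ m (hlt m hm)).1)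
    (pairwiseDisjoint_treatedZones M j) j'
  have hs₁ := hs.trans_symm hadm₁ hΓ
  obtain ⟨h', hadm', hne, hclose'⟩ :=
    hs₁.exists_flowClose (Z.detune h₁ hadm₁ M κ hκ) j R (half_pos hε)
  have hclose := (hΓ.flowClose_trans_symm hadm₁ (fun m hm => (hκ m (hlt m hm)).2) hclose₁).trans
    (Z.contDiff_of_adm h hs.adm) (Z.contDiff_of_adm h₁ hadm₁) (Z.contDiff_of_adm h' hadm')
    hs.symplectic hs₁.symplectic hs₁.symplectic hclose'
  rw [add_halves] at hclose
  exact ⟨h', κ, Γ, hΓ, hs.trans_symm hadm' hΓ, hclose, fun m hm => hne m (hlt m hm)⟩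

lemma isCompact_setOf_action_mem (hG : Continuous G)
    (hGQ : ∀ z, action z ∈ Z.Q j → action (G z) ∈ Z.Q j') (m : ℕ) :
    IsCompact {z | action z ∈ Z.Q j ∧ action (G z) ∈ Z.C m} := by
  have hinter : {z | action z ∈ Z.Q j ∧ action (G z) ∈ Z.C m} =
      {z | action z ∈ Z.Q j} ∩ (fun z => action (G z)) ⁻¹' (Z.C m ∩ Z.Q j') := by
    ext z
    exact ⟨fun hz => ⟨hz.1, hz.2, hGQ z hz.1⟩, fun hz => ⟨hz.1, hz.2.1⟩⟩
  rw [hinter]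
  exact (isCompact_preimage_action (Z.isCompact_Q j)).inter_right
    ((Z.isCompact_C_inter m _ (Z.isCompact_Q j') (Z.Q_subset j')).isClosed.preimage
      (continuous_action.comp hG))

lemma IsState.holdsNear_exists_notMem (hs : Z.IsState h (G.trans Γ.symm)) {M : ℕ}
    (hΓ : Z.IsZoneMap κ (treatedZones M j) j' Γ)
    (hne : ∀ m ∈ treatedZones M j, ∀ r ∈ Z.C m, ∑ i, κ m i * grad h r i ≠ 0) (hG : Continuous G)
    (hGQ : ∀ z, action z ∈ Z.Q j → action (G z) ∈ Z.Q j')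
    (hM : ∀ m, (Z.C m ∩ Z.Q j').Nonempty → m < M) :
    HoldsNear (conjFlow h (G.trans Γ.symm)) fun Ψ => ∀ m, m % 2 = j % 2 → ∀ z,
      action z ∈ Z.Q j → action (G z) ∈ Z.C m → ∃ t, action (Ψ t z) ∉ Z.Q j := by
  have hcompact := (treatedZones M j).isCompact_biUnion
    fun m _ => Z.isCompact_setOf_action_mem hG hGQ m
  have hopen : IsOpen {w : Phase d | action w ∉ Z.Q j} :=
    (Z.isCompact_Q j).isClosed.isOpen_compl.preimage continuous_action
  refine (holdsNear_exists_visit_of_isCompact hcompact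
    (continuous_conjFlow (Z.contDiff_of_adm h hs.adm) hs.symplectic) hopen ?_).mono ?_
  · intro z hz
    obtain ⟨m, hm, hzQ, hzC⟩ := Set.mem_iUnion₂.1 hz
    have hparity : ∀ m' ∈ treatedZones M j, m' % 2 = m % 2 := fun m' hm' =>
      (mem_treatedZones.1 hm').2.trans (mem_treatedZones.1 hm).2.symm
    obtain ⟨t, ht⟩ := hΓ.exists_action_notMem (w := Γ.symm (G z)) hm hparity (hne m hm)
      (by rwa [Equiv.apply_symm_apply]) (by rw [Equiv.apply_symm_apply]; exact hGQ z hzQ)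
    refine ⟨t, fun hQ => ht ?_⟩
    simpa [conjFlow] using hGQ _ hQ
  · intro Ψ hΨ m hm z hzQ hzC
    exact hΨ z (Set.mem_biUnion (mem_treatedZones.2 ⟨hM m ⟨_, hzC, hGQ z hzQ⟩, hm⟩) ⟨hzQ, hzC⟩)

lemma IsState.holdsNear_exists_drift (hs : Z.IsState h (G.trans Γ.symm))
    (hΓ : Z.IsZoneMap κ S j Γ) (hm : m ∈ S)
    (hne : ∀ r ∈ Z.C m, ∑ i, κ m i * grad h r i ≠ 0) {A : ℝ} (hA : 0 < A)
    {K L : Set (Fin d → ℝ)} {ρ : Fin d → ℝ} (hρ : Z.IsDriftPoint A K L m ρ) (hLQ : L ⊆ Z.Q j)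
    (hG : ∀ z, action z ∉ K → G z = z) :
    HoldsNear (conjFlow h (G.trans Γ.symm)) fun Ψ =>
      ∃ p t₁ t₂, ‖Ψ t₁ p‖ < A⁻¹ ∧ A < ‖Ψ t₂ p‖ := by
  obtain ⟨w, t₁, t₂, ⟨hK₁, hnear⟩, hK₂, hfar⟩ := hΓ.exists_norm_lt_and_lt_norm hm hne hA hρ hLQ
  have hflow : ∀ t, action (Γ (actionFlow h t w)) ∉ K →
      conjFlow h (G.trans Γ.symm) t ((G.trans Γ.symm).symm w) = Γ (actionFlow h t w) := by
    intro t ht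
    rw [conjFlow, Equiv.apply_symm_apply]
    exact (Equiv.symm_apply_eq G).2 (hG _ ht).symm
  have hcont := continuous_conjFlow (Z.contDiff_of_adm h hs.adm) hs.symplectic
  obtain ⟨V₁, hV₁, hvisit₁⟩ := holdsNear_visit (hcont t₁)
    (isOpen_lt continuous_norm continuous_const) (by rw [hflow t₁ hK₁]; exact hnear)
  obtain ⟨V₂, hV₂, hvisit₂⟩ := holdsNear_visit (hcont t₂)
    (isOpen_lt continuous_const continuous_norm) (by rw [hflow t₂ hK₂]; exact hfar)
  exact (hvisit₁.and hvisit₂).mono fun Ψ hΨ =>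
    ⟨_, t₁, t₂, hΨ.1 _ (mem_of_mem_nhds hV₁), hΨ.2 _ (mem_of_mem_nhds hV₂)⟩

variable (Z) in
/-- What the step `j` of the construction achieves for a motion `Ψ`: the points of `Q j` that the
coordinates `G` put into a set `C m` with `m` of the parity of `j` leave `Q j`, and, if the zones
allow it, some orbit drifts between the scales `(j + 1)⁻¹` and `j + 1`. -/
structure IsStirred (j : ℕ) (G : Phase d ≃ Phase d) (Ψ : ℝ → Phase d → Phase d) : Prop where
  exists_notMem : ∀ m, m % 2 = j % 2 → ∀ z, action z ∈ Z.Q j → action (G z) ∈ Z.C m →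
    ∃ t, action (Ψ t z) ∉ Z.Q j
  exists_drift : Z.Drift → ∃ p t₁ t₂, ‖Ψ t₁ p‖ < ((j : ℝ) + 1)⁻¹ ∧ (j : ℝ) + 1 < ‖Ψ t₂ p‖

lemma exists_isDriftPoint_of_drift {K : Set (Fin d → ℝ)} (hK : IsCompact K) (hKD : K ⊆ Z.D)
    (j : ℕ) : ∃ L m, IsCompact L ∧ L ⊆ Z.D ∧
      (Z.Drift → m % 2 = j % 2 ∧ ∃ ρ, Z.IsDriftPoint (j + 1) K L m ρ) := by
  by_cases hdrift : Z.Drift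
  · obtain ⟨m, hm, ρ, L, hL, hLD, hρ⟩ := hdrift (j + 1) (by positivity) K hK hKD j
    exact ⟨L, m, hL, hLD, fun _ => ⟨hm, ρ, hρ⟩⟩
  · exact ⟨∅, 0, isCompact_empty, Set.empty_subset _, fun hD => absurd hD hdrift⟩

lemma IsState.exists_forall_mem_Q (hs : Z.IsState h G) (j : ℕ) {L : Set (Fin d → ℝ)}
    (hL : IsCompact L) (hLD : L ⊆ Z.D) :
    ∃ j', L ⊆ Z.Q j' ∧ ∀ z, action z ∈ Z.Q j → action (G z) ∈ Z.Q j' := by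
  have himage : IsCompact ((fun z => action (G z)) '' {z : Phase d | action z ∈ Z.Q j}) :=
    (isCompact_preimage_action (Z.isCompact_Q j)).image
      (continuous_action.comp hs.symplectic.contDiff.continuous)
  obtain ⟨j', hj'⟩ := Z.exists_subset_Q _ (hL.union himage) (Set.union_subset hLD
    (Set.image_subset_iff.2 fun z hz => (hs.action_mem z).2 (Z.Q_subset j hz)))
  exact ⟨j', Set.subset_union_left.trans hj', fun z hz => hj' (Or.inr ⟨z, hz, rfl⟩)⟩

theorem IsState.exists_step (hs : Z.IsState h G) (j : ℕ) (R : ℝ) {ε : ℝ} (hε : 0 < ε) :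
    ∃ h' G', Z.IsState h' G' ∧ FlowClose j R ε h G h' G' ∧
      (∀ m, m % 2 = j % 2 → ∀ z, action (G' z) ∈ Z.C m → action (G z) ∈ Z.C m) ∧
      HoldsNear (conjFlow h' G') (Z.IsStirred j G) := by
  obtain ⟨K, hK, hKD, hid⟩ := hs.support
  obtain ⟨L, m₁, hL, hLD, hdrift⟩ := exists_isDriftPoint_of_drift hK hKD j
  obtain ⟨j', hLQ, hGQ⟩ := hs.exists_forall_mem_Q j hL hLD
  obtain ⟨M, hM⟩ := Z.finite_C (Z.Q j') (Z.isCompact_Q j') (Z.Q_subset j')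
  obtain ⟨h', κ, Γ, hΓ, hs', hclose, hne⟩ :=
    hs.exists_isZoneMap (max M (m₁ + 1)) j j' R hε
  refine ⟨h', G.trans Γ.symm, hs', hclose, fun m hm z hz => ?_, ?_⟩
  · have hparity : ∀ m' ∈ treatedZones (max M (m₁ + 1)) j, m' % 2 = m % 2 := fun m' hm' =>
      (mem_treatedZones.1 hm').2.trans hm.symm
    rw [← Γ.apply_symm_apply (G z)]
    exact (hΓ.action_mem_C_iff hparity _).2 hz
  have hexit := hs'.holdsNear_exists_notMem hΓ hne hs.symplectic.contDiff.continuous hGQ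
    fun m hm => lt_max_of_lt_left (hM m hm)
  by_cases hD : Z.Drift
  · obtain ⟨hm₁, ρ, hρ⟩ := hdrift hD
    have hm₁mem : m₁ ∈ treatedZones (max M (m₁ + 1)) j :=
      mem_treatedZones.2 ⟨lt_max_of_lt_right (Nat.lt_succ_self m₁), hm₁⟩
    exact (hexit.and (hs'.holdsNear_exists_drift hΓ hm₁mem (hne m₁ hm₁mem) (by positivity) hρ hLQ
      hid)).mono fun Ψ hΨ => ⟨hΨ.1, fun _ => hΨ.2⟩
  · exact hexit.mono fun Ψ hΨ => ⟨hΨ, fun hD' => absurd hD' hD⟩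

end ZoneSystem

end Step

section UniformLimits

lemma exists_tendsto_of_dist_le_geometric_two {α : Type*} [PseudoMetricSpace α] [CompleteSpace α]
    {f : ℕ → α} {n : ℕ} {C : ℝ}
    (hf : ∀ k, dist (f (n + k)) (f (n + (k + 1))) ≤ C / 2 / 2 ^ k) :
    ∃ a, Tendsto f atTop (𝓝 a) := by
  obtain ⟨a, ha⟩ := cauchySeq_tendsto_of_complete
    (cauchySeq_of_le_geometric_two (f := fun k => f (n + k)) hf)
  refine ⟨a, (tendsto_add_atTop_iff_nat n).1 ?_⟩
  simpa only [add_comm] using ha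

variable {ι E : Type*} [NormedAddCommGroup E] {l : Filter ι}

lemma tendstoUniformlyOn_comp_of_bounded [ProperSpace E] {X : ι → E → E} {Y : E → E}
    (hY : Continuous Y) (hX : ∀ B, TendstoUniformlyOn X Y l (Metric.closedBall 0 B))
    {c : ι → ℝ → E} {c' : ℝ → E} {s : Set ℝ} (hc : TendstoUniformlyOn c c' l s) {B : ℝ}
    (hB : ∀ u ∈ s, ‖c' u‖ ≤ B) :
    TendstoUniformlyOn (fun n u => X n (c n u)) (fun u => Y (c' u)) l s := by
  have hbounded : ∀ᶠ n in l, ∀ u ∈ s, c n u ∈ Metric.closedBall 0 (B + 1) := by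
    filter_upwards [Metric.tendstoUniformlyOn_iff.1 hc 1 one_pos] with n hn u hu
    rw [mem_closedBall_zero_iff]
    have hclose := hn u hu
    rw [dist_eq_norm, norm_sub_rev] at hclose
    linarith [norm_le_norm_add_norm_sub' (c n u) (c' u), hB u hu]
  have hYc : TendstoUniformlyOn (fun n u => Y (c n u)) (fun u => Y (c' u)) l s :=
    ((isCompact_closedBall (0 : E) (B + 1)).uniformContinuousOn_of_continuous
      hY.continuousOn).comp_tendstoUniformlyOn_eventually hbounded
      (fun u hu => mem_closedBall_zero_iff.2 ((hB u hu).trans (by linarith))) hc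
  rw [Metric.tendstoUniformlyOn_iff] at hYc ⊢
  intro η hη
  filter_upwards [hbounded, hYc (η / 2) (half_pos hη),
    Metric.tendstoUniformlyOn_iff.1 (hX (B + 1)) (η / 2) (half_pos hη)] with n hn hYn hXn u hu
  calc dist (Y (c' u)) (X n (c n u))
      ≤ dist (Y (c' u)) (Y (c n u)) + dist (Y (c n u)) (X n (c n u)) := dist_triangle _ _ _
    _ < η / 2 + η / 2 := add_lt_add (hYn u hu) (hXn _ (hn u hu))
    _ = η := add_halves η

end UniformLimits

section Limit

variable {d : ℕ}

/-- The successive approximations `h n ∘ action ∘ G n` of the Hamiltonian under construction. Every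
motion `2 ε (n + 1)`-close to the flow of the `(n + 1)`-st one has the properties obtained in the
step `n`; the limit flow will be one of them. -/
structure ApproxSeq (Z : ZoneSystem d) (h₀ : (Fin d → ℝ) → ℝ) where
  h : ℕ → (Fin d → ℝ) → ℝ
  G : ℕ → Phase d ≃ Phase d
  ε : ℕ → ℝ
  R : ℕ → ℝ
  h_zero : h 0 = h₀
  G_zero : G 0 = Equiv.refl _
  isState : ∀ n, Z.IsState (h n) (G n)
  ε_pos : ∀ n, 0 < ε n
  ε_succ : ∀ n, ε (n + 1) ≤ ε n / 2
  R_zero : R 0 = 0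
  R_succ : ∀ n, R n + 1 ≤ R (n + 1)
  close : ∀ n, FlowClose n (R n) (ε n) (h n) (G n) (h (n + 1)) (G (n + 1))
  preserve : ∀ n m, m % 2 = n % 2 → ∀ z, action (G (n + 1) z) ∈ Z.C m → action (G n z) ∈ Z.C m
  isStirred : ∀ n Ψ, MotionClose (2 * ε (n + 1)) (R (n + 1)) (conjFlow (h (n + 1)) (G (n + 1))) Ψ →
    Z.IsStirred n (G n) Ψ

lemma exists_approxSeq (Z : ZoneSystem d) {h₀ : (Fin d → ℝ) → ℝ} (hadm : Z.Adm h₀) :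
    Nonempty (ApproxSeq Z h₀) := by
  let State := {x : ((Fin d → ℝ) → ℝ) × (Phase d ≃ Phase d) × ℝ × ℝ //
    Z.IsState x.1 x.2.1 ∧ 0 < x.2.2.1}
  have step : ∀ (n : ℕ) (x : State), ∃ y : State,
      FlowClose n x.1.2.2.2 x.1.2.2.1 x.1.1 x.1.2.1 y.1.1 y.1.2.1 ∧
      (∀ m, m % 2 = n % 2 → ∀ z, action (y.1.2.1 z) ∈ Z.C m → action (x.1.2.1 z) ∈ Z.C m) ∧
      y.1.2.2.1 ≤ x.1.2.2.1 / 2 ∧ x.1.2.2.2 + 1 ≤ y.1.2.2.2 ∧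
      ∀ Ψ, MotionClose (2 * y.1.2.2.1) y.1.2.2.2 (conjFlow y.1.1 y.1.2.1) Ψ →
        Z.IsStirred n x.1.2.1 Ψ := by
    rintro n ⟨⟨h, G, ε, R⟩, hs, hε⟩
    obtain ⟨h', G', hs', hclose, hpreserve, ε', hε', R', hstir⟩ := hs.exists_step n R hε
    have hε'_le : 2 * min (ε / 2) (ε' / 2) ≤ ε' := by linarith [min_le_right (ε / 2) (ε' / 2)]
    exact ⟨⟨⟨h', G', min (ε / 2) (ε' / 2), max (R + 1) R'⟩, hs',
      lt_min (half_pos hε) (half_pos hε')⟩, hclose, hpreserve, min_le_left _ _, le_max_left _ _,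
      fun Ψ hΨ => hstir Ψ (hΨ.mono hε'_le (le_max_right _ _))⟩
  choose next hnext using step
  let x₀ : State := ⟨⟨h₀, Equiv.refl _, 1, 0⟩, ⟨hadm, IsSymplectic.refl, ∅, isCompact_empty,
    Set.empty_subset _, fun _ _ => rfl⟩, one_pos⟩
  let x : ℕ → State := fun n => Nat.rec x₀ next n
  exact ⟨{
    h := fun n => (x n).1.1
    G := fun n => (x n).1.2.1
    ε := fun n => (x n).1.2.2.1
    R := fun n => (x n).1.2.2.2
    h_zero := rfl
    G_zero := rfl
    isState := fun n => (x n).2.1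
    ε_pos := fun n => (x n).2.2
    ε_succ := fun n => (hnext n (x n)).2.2.1
    R_zero := rfl
    R_succ := fun n => (hnext n (x n)).2.2.2.1
    close := fun n => (hnext n (x n)).1
    preserve := fun n => (hnext n (x n)).2.1
    isStirred := fun n => (hnext n (x n)).2.2.2.2 }⟩

namespace ApproxSeq

variable {Z : ZoneSystem d} {h₀ : (Fin d → ℝ) → ℝ} (S : ApproxSeq Z h₀)

-- The right-hand side has the shape of Mathlib's lemmas on geometric series of ratio `1 / 2`.
lemma ε_add_le (n k : ℕ) : S.ε (n + k) ≤ 2 * S.ε n / 2 / 2 ^ k := by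
  induction k with
  | zero => simp
  | succ k ih =>
    calc S.ε (n + k + 1) ≤ S.ε (n + k) / 2 := S.ε_succ (n + k)
      _ ≤ (2 * S.ε n / 2 / 2 ^ k) / 2 := by linarith
      _ = 2 * S.ε n / 2 / 2 ^ (k + 1) := by rw [pow_succ, div_div _ ((2 : ℝ) ^ k)]

lemma tendsto_two_mul_ε : Tendsto (fun n => 2 * S.ε n) atTop (𝓝 0) := by
  have htendsto : Tendsto S.ε atTop (𝓝 0) :=
    squeeze_zero (fun n => (S.ε_pos n).le) (fun n => by simpa using S.ε_add_le 0 n)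
      (summable_geometric_two' (2 * S.ε 0)).tendsto_atTop_zero
  simpa using htendsto.const_mul 2

lemma monotone_R : Monotone S.R := monotone_nat_of_le_succ fun n => by linarith [S.R_succ n]

lemma natCast_le_R (n : ℕ) : (n : ℝ) ≤ S.R n := by
  induction n with
  | zero => simp [S.R_zero]
  | succ n ih =>
    push_cast
    linarith [S.R_succ n]

lemma contDiff_h (n : ℕ) : ContDiff ℝ ∞ (S.h n) := Z.contDiff_of_adm _ (S.isState n).adm

/-- The `n`-th approximating Hamiltonian. -/
def ham (n : ℕ) (z : Phase d) : ℝ := S.h n (action (S.G n z))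

lemma contDiff_ham (n : ℕ) : ContDiff ℝ ∞ (S.ham n) :=
  contDiff_comp_action (S.contDiff_h n) (S.isState n).symplectic

/-- The flow of the `n`-th approximating Hamiltonian. -/
def flow (n : ℕ) : ℝ → Phase d → Phase d := conjFlow (S.h n) (S.G n)

lemma hasDerivAt_flow (n : ℕ) (z : Phase d) (t : ℝ) :
    HasDerivAt (fun s => S.flow n s z) (hamVectorField (S.ham n) (S.flow n t z)) t :=
  hasDerivAt_conjFlow ((S.contDiff_h n).differentiable (by simp)) (S.isState n).symplectic z t

lemma dist_flow_le {n : ℕ} {t : ℝ} {z : Phase d} (ht : |t| ≤ S.R n) (hz : ‖z‖ ≤ S.R n) (k : ℕ) :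
    dist (S.flow (n + k) t z) (S.flow (n + (k + 1)) t z) ≤ 2 * S.ε n / 2 / 2 ^ k := by
  have hR : S.R n ≤ S.R (n + k) := S.monotone_R (Nat.le_add_right n k)
  exact ((S.close (n + k)).flow t z (ht.trans hR) (hz.trans hR)).trans (S.ε_add_le n k)

lemma exists_tendsto_flow (t : ℝ) (z : Phase d) :
    ∃ w, Tendsto (fun n => S.flow n t z) atTop (𝓝 w) := by
  obtain ⟨n, hn⟩ := exists_nat_ge (max |t| ‖z‖)
  have hR := hn.trans (S.natCast_le_R n)
  exact exists_tendsto_of_dist_le_geometric_two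
    (S.dist_flow_le ((le_max_left _ _).trans hR) ((le_max_right _ _).trans hR))

/-- The pointwise limit of the approximating flows. -/
def limitFlow (t : ℝ) (z : Phase d) : Phase d := (S.exists_tendsto_flow t z).choose

lemma tendsto_flow (t : ℝ) (z : Phase d) :
    Tendsto (fun n => S.flow n t z) atTop (𝓝 (S.limitFlow t z)) :=
  (S.exists_tendsto_flow t z).choose_spec

lemma limitFlow_zero (z : Phase d) : S.limitFlow 0 z = z := by
  refine tendsto_nhds_unique (S.tendsto_flow 0 z) ?_
  simp only [flow, conjFlow_zero]
  exact tendsto_const_nhds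

lemma motionClose_limitFlow (n : ℕ) :
    MotionClose (2 * S.ε n) (S.R n) (S.flow n) S.limitFlow := by
  intro t z ht hz
  have hlim : Tendsto (fun k => S.flow (n + k) t z) atTop (𝓝 (S.limitFlow t z)) := by
    simpa only [add_comm] using (tendsto_add_atTop_iff_nat n).2 (S.tendsto_flow t z)
  exact dist_le_of_le_geometric_two_of_tendsto₀ (S.dist_flow_le ht hz) hlim

lemma isStirred_limitFlow (n : ℕ) : Z.IsStirred n (S.G n) S.limitFlow :=
  S.isStirred n _ (S.motionClose_limitFlow (n + 1))

lemma tendstoUniformlyOn_flow (z : Phase d) (T : ℝ) :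
    TendstoUniformlyOn (fun n s => S.flow n s z) (fun s => S.limitFlow s z) atTop
      (Metric.closedBall 0 T) := by
  obtain ⟨n₀, hn₀⟩ := exists_nat_ge (max T ‖z‖)
  rw [Metric.tendstoUniformlyOn_iff]
  intro η hη
  filter_upwards [S.tendsto_two_mul_ε.eventually (gt_mem_nhds hη), eventually_ge_atTop n₀]
    with n hε hn s hs
  have hR := (hn₀.trans (S.natCast_le_R n₀)).trans (S.monotone_R hn)
  rw [mem_closedBall_zero_iff, Real.norm_eq_abs] at hs
  rw [dist_comm]
  exact (S.motionClose_limitFlow n s z (hs.trans ((le_max_left _ _).trans hR))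
    ((le_max_right _ _).trans hR)).trans_lt hε

lemma exists_norm_limitFlow_le (z : Phase d) (T : ℝ) :
    ∃ B, ∀ s ∈ Metric.closedBall 0 T, ‖S.limitFlow s z‖ ≤ B := by
  have hcont : ContinuousOn (fun s => S.limitFlow s z) (Metric.closedBall 0 T) :=
    (S.tendstoUniformlyOn_flow z T).continuousOn <| Frequently.of_forall fun n =>
      (continuous_iff_continuousAt.2 fun s => (S.hasDerivAt_flow n z s).continuousAt).continuousOn
  exact (isCompact_closedBall 0 T).exists_bound_of_continuousOn hcont

/-- The sum of the telescoping series of the approximating Hamiltonians. -/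
def limitHam (z : Phase d) : ℝ := S.ham 0 z + ∑' n, (S.ham (n + 1) z - S.ham n z)

lemma abs_cutoff_mul_le {l n : ℕ} (hl : l ≤ n) (z : Phase d) :
    |cutoff d l z * (S.ham (n + 1) z - S.ham n z)| ≤ S.ε n := by
  have hderiv := (S.close n).deriv l hl 0 (Nat.zero_le _) z
  rwa [norm_iteratedFDeriv_zero, Real.norm_eq_abs] at hderiv

lemma summable_ham_succ_sub (z : Phase d) : Summable fun n => S.ham (n + 1) z - S.ham n z := by
  obtain ⟨l, hl⟩ := exists_nat_ge ‖z‖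
  rw [← summable_nat_add_iff l]
  refine Summable.of_norm_bounded (summable_geometric_two' (2 * S.ε l)) fun k => ?_
  have hle := S.abs_cutoff_mul_le (Nat.le_add_right l k) z
  rw [cutoff_eq_one hl, one_mul, ← Real.norm_eq_abs] at hle
  rw [add_comm k l]
  exact hle.trans (S.ε_add_le l k)

/-- The difference between the limit Hamiltonian and the `n`-th one, cut off outside the ball of
radius `l` so that the series converges in `C^∞` globally. -/
def tail (l n : ℕ) (z : Phase d) : ℝ :=
  ∑' k, cutoff d l z * (S.ham (n + k + 1) z - S.ham (n + k) z)

lemma limitHam_eq {l : ℕ} {z : Phase d} (hz : ‖z‖ ≤ l) (n : ℕ) :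
    S.limitHam z = S.ham n z + S.tail l n z := by
  have htail : S.tail l n z = ∑' k, (S.ham (k + n + 1) z - S.ham (k + n) z) :=
    tsum_congr fun k => by rw [cutoff_eq_one hz, one_mul, add_comm n k]
  rw [limitHam, ← (S.summable_ham_succ_sub z).sum_add_tsum_nat_add n,
    Finset.sum_range_sub (fun n => S.ham n z), htail]
  ring

lemma contDiff_cutoff_mul_ham_sub (l n : ℕ) :
    ContDiff ℝ ∞ fun z => cutoff d l z * (S.ham (n + 1) z - S.ham n z) :=
  (contDiff_cutoff d l).mul ((S.contDiff_ham _).sub (S.contDiff_ham _))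

lemma contDiff_tail (l n : ℕ) : ContDiff ℝ ∞ (S.tail l n) := by
  refine contDiff_tsum_of_eventually (v := fun _ k => 2 * S.ε n / 2 / 2 ^ k)
    (fun k => S.contDiff_cutoff_mul_ham_sub l (n + k)) (fun _ _ => summable_geometric_two' _)
    fun m _ => ?_
  rw [Nat.cofinite_eq_atTop]
  filter_upwards [eventually_ge_atTop (max l m)] with k hk z
  have hk' : max l m ≤ n + k := hk.trans (Nat.le_add_left _ _)
  exact ((S.close (n + k)).deriv l ((le_max_left _ _).trans hk') m ((le_max_right _ _).trans hk')
    z).trans (S.ε_add_le n k)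

lemma norm_fderiv_tail_le {l n : ℕ} (hl : l ≤ n) (hn : 1 ≤ n) (z : Phase d) :
    ‖fderiv ℝ (S.tail l n) z‖ ≤ 2 * S.ε n := by
  set term : ℕ → Phase d → ℝ := fun k z =>
    cutoff d l z * (S.ham (n + k + 1) z - S.ham (n + k) z)
  have hbound : ∀ k z, ‖fderiv ℝ (term k) z‖ ≤ 2 * S.ε n / 2 / 2 ^ k := fun k z => by
    rw [← norm_iteratedFDeriv_one]
    exact ((S.close (n + k)).deriv l (by omega) 1 (by omega) z).trans (S.ε_add_le n k)
  have hsum : Summable fun k => term k 0 :=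
    Summable.of_norm_bounded (summable_geometric_two' (2 * S.ε n)) fun k =>
      (S.abs_cutoff_mul_le (by omega) 0).trans (S.ε_add_le n k)
  have hfderiv : fderiv ℝ (S.tail l n) z = ∑' k, fderiv ℝ (term k) z :=
    fderiv_tsum_apply (summable_geometric_two' (2 * S.ε n))
      (fun k => (S.contDiff_cutoff_mul_ham_sub l (n + k)).differentiable (by simp)) hbound hsum z
  rw [hfderiv]
  exact tsum_of_norm_bounded (hasSum_geometric_two' (2 * S.ε n)) fun k => hbound k z

lemma eventuallyEq_limitHam {l : ℕ} {z : Phase d} (hz : ‖z‖ < l) (n : ℕ) :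
    S.limitHam =ᶠ[𝓝 z] fun w => S.ham n w + S.tail l n w := by
  filter_upwards [(continuous_norm.tendsto z).eventually (gt_mem_nhds hz)] with w hw
  exact S.limitHam_eq (le_of_lt hw) n

lemma contDiff_limitHam : ContDiff ℝ ∞ S.limitHam := by
  refine contDiff_iff_contDiffAt.2 fun z => ?_
  obtain ⟨l, hl⟩ := exists_nat_gt ‖z‖
  exact ((S.contDiff_ham 0).add (S.contDiff_tail l 0)).contDiffAt.congr_of_eventuallyEq
    (S.eventuallyEq_limitHam hl 0)

lemma norm_hamVectorField_sub_le {l n : ℕ} (hl : l ≤ n) (hn : 1 ≤ n) {z : Phase d} (hz : ‖z‖ < l) :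
    ‖hamVectorField S.limitHam z - hamVectorField (S.ham n) z‖ ≤ 2 * S.ε n := by
  have htail : (fun w => S.limitHam w - S.ham n w) =ᶠ[𝓝 z] S.tail l n := by
    filter_upwards [S.eventuallyEq_limitHam hz n] with w hw
    rw [hw, add_sub_cancel_left]
  calc ‖hamVectorField S.limitHam z - hamVectorField (S.ham n) z‖
      = ‖hamVectorField (fun w => S.limitHam w - S.ham n w) z‖ := by
        rw [hamVectorField_sub (S.contDiff_limitHam.differentiable (by simp) z)
          ((S.contDiff_ham n).differentiable (by simp) z)]
    _ ≤ ‖fderiv ℝ (fun w => S.limitHam w - S.ham n w) z‖ := norm_hamVectorField_le _ z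
    _ = ‖fderiv ℝ (S.tail l n) z‖ := by rw [htail.fderiv_eq]
    _ ≤ 2 * S.ε n := S.norm_fderiv_tail_le hl hn z

lemma tendstoUniformlyOn_hamVectorField (B : ℝ) :
    TendstoUniformlyOn (fun n => hamVectorField (S.ham n)) (hamVectorField S.limitHam) atTop
      (Metric.closedBall 0 B) := by
  obtain ⟨l, hl⟩ := exists_nat_gt B
  rw [Metric.tendstoUniformlyOn_iff]
  intro η hη
  filter_upwards [S.tendsto_two_mul_ε.eventually (gt_mem_nhds hη), eventually_ge_atTop l,
    eventually_ge_atTop 1] with n hε hln hn z hz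
  rw [dist_eq_norm]
  exact (S.norm_hamVectorField_sub_le hln hn
    ((mem_closedBall_zero_iff.1 hz).trans_lt hl)).trans_lt hε

lemma isHamiltonianFlow_limitFlow : IsHamiltonianFlow S.limitHam S.limitFlow := by
  refine ⟨S.limitFlow_zero, fun z t => ?_⟩
  have hball : Metric.ball (0 : ℝ) (|t| + 1) ⊆ Metric.closedBall 0 (|t| + 1) :=
    Metric.ball_subset_closedBall
  obtain ⟨B, hB⟩ := S.exists_norm_limitFlow_le z (|t| + 1)
  refine hasDerivAt_of_tendstoUniformlyOn Metric.isOpen_ball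
    (tendstoUniformlyOn_comp_of_bounded (contDiff_hamVectorField S.contDiff_limitHam).continuous
      S.tendstoUniformlyOn_hamVectorField ((S.tendstoUniformlyOn_flow z (|t| + 1)).mono hball)
      fun s hs => hB s (hball hs))
    (Eventually.of_forall fun n s _ => S.hasDerivAt_flow n z s) (fun s _ => S.tendsto_flow s z) ?_
  rw [mem_ball_zero_iff, Real.norm_eq_abs]
  exact lt_add_one _

lemma isBigO_limitHam_sub_ham_zero :
    (fun z : Phase d => S.limitHam z - S.ham 0 z) =O[𝓝 0] fun z => ‖z‖ ^ 3 := by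
  refine Asymptotics.IsBigO.of_bound (2 * S.ε 0) ?_
  filter_upwards [Metric.closedBall_mem_nhds (0 : Phase d) one_pos] with z hz
  rw [limitHam, add_sub_cancel_left, norm_pow, norm_norm]
  refine tsum_of_norm_bounded ((hasSum_geometric_two' (2 * S.ε 0)).mul_right (‖z‖ ^ 3)) fun n => ?_
  refine ((S.close n).ham z (mem_closedBall_zero_iff.1 hz)).trans
    (mul_le_mul_of_nonneg_right ?_ (by positivity))
  simpa using S.ε_add_le 0 n

lemma isElliptic_limitHam {ω₀ : Fin d → ℝ}
    (hh₀ : (fun r => h₀ r - ∑ i, ω₀ i * r i) =O[𝓝 0] fun r => ‖r‖ ^ 2) :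
    IsEllipticWithFrequency ω₀ S.limitHam := by
  have hham : ∀ z, S.ham 0 z = h₀ (action z) := fun z => by simp [ham, S.h_zero, S.G_zero]
  refine (S.isBigO_limitHam_sub_ham_zero.add (isBigO_comp_action hh₀)).congr_left fun z => ?_
  rw [hham]
  ring

lemma flow_eq_rotate (n : ℕ) {z : Phase d} (hz : action z ∉ Z.D) (t : ℝ) :
    S.flow n t z = rotate (t • grad (S.h n) (action z)) z := by
  obtain ⟨K, -, hKD, hid⟩ := (S.isState n).support
  have hzK : action z ∉ K := fun h => hz (hKD h)
  rw [flow, conjFlow, hid z hzK, Equiv.symm_apply_eq, hid _ (by simpa [actionFlow] using hzK),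
    actionFlow]

lemma exists_tendsto_grad (r : Fin d → ℝ) :
    ∃ v, Tendsto (fun n => grad (S.h n) r) atTop (𝓝 v) := by
  obtain ⟨n, hn⟩ := exists_nat_ge ‖r‖
  refine exists_tendsto_of_dist_le_geometric_two (n := n) (C := 2 * S.ε n) fun k => ?_
  rw [dist_comm, dist_eq_norm]
  refine ((S.close (n + k)).freq r (hn.trans ?_)).trans (S.ε_add_le n k)
  exact_mod_cast Nat.le_add_right n k

lemma exists_limitFlow_eq_rotate : ∃ Ω : (Fin d → ℝ) → Fin d → ℝ, ∀ z, action z ∉ Z.D → ∀ t,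
    S.limitFlow t z = rotate (t • Ω (action z)) z := by
  choose Ω hΩ using S.exists_tendsto_grad
  refine ⟨Ω, fun z hz t => tendsto_nhds_unique (S.tendsto_flow t z) ?_⟩
  have hcont : Continuous fun v : Fin d → ℝ => rotate (t • v) z :=
    continuous_rotate.comp (f := fun v => (t • v, z)) (by fun_prop)
  simp only [S.flow_eq_rotate _ hz]
  exact (hcont.tendsto _).comp (hΩ _)

-- If the coordinates `G j` put `z` into no zone of the parity of `j`, then neither do the
-- coordinates `G (j + 1)`, because step `j` preserves these zones; so `z` lies in a zone of the
-- parity of `j + 1`, which step `j + 1` makes it leave.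
lemma exists_action_limitFlow_notMem {z : Phase d} (hz : action z ∈ Z.D) {K : Set (Fin d → ℝ)}
    (hK : IsCompact K) (hKD : K ⊆ Z.D) : ∃ t, action (S.limitFlow t z) ∉ K := by
  obtain ⟨j, hj⟩ := Z.exists_subset_Q K hK hKD
  by_cases hzj : action z ∈ Z.Q j
  swap
  · exact ⟨0, by rw [S.limitFlow_zero]; exact fun h => hzj (hj h)⟩
  by_cases hzone : ∃ m, m % 2 = j % 2 ∧ action (S.G j z) ∈ Z.C m
  · obtain ⟨m, hm, hmC⟩ := hzone
    obtain ⟨t, ht⟩ := (S.isStirred_limitFlow j).exists_notMem m hm z hzj hmC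
    exact ⟨t, fun h => ht (hj h)⟩
  · push Not at hzone
    obtain ⟨m, hm⟩ := Z.cover _ (((S.isState (j + 1)).action_mem z).2 hz)
    have hparity : m % 2 = (j + 1) % 2 := by
      by_contra hne
      exact hzone m (by omega) (S.preserve j m (by omega) z hm)
    have hmono := Z.monotone_Q (Nat.le_succ j)
    obtain ⟨t, ht⟩ := (S.isStirred_limitFlow (j + 1)).exists_notMem m hparity z (hmono hzj) hm
    exact ⟨t, fun h => ht (hmono (hj h))⟩

lemma isDiffusive_limitFlow (hdrift : Z.Drift) : IsDiffusive S.limitFlow := by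
  intro A hA
  obtain ⟨n, hn⟩ := exists_nat_ge A
  obtain ⟨p, t₁, t₂, hnear, hfar⟩ := (S.isStirred_limitFlow n).exists_drift hdrift
  exact ⟨p, t₁, t₂, hnear.le.trans (inv_anti₀ hA (by linarith)), by linarith⟩

end ApproxSeq

theorem ZoneSystem.exists_hamiltonian (Z : ZoneSystem d) {h₀ : (Fin d → ℝ) → ℝ} (hadm : Z.Adm h₀)
    {ω₀ : Fin d → ℝ} (hh₀ : (fun r => h₀ r - ∑ i, ω₀ i * r i) =O[𝓝 0] fun r => ‖r‖ ^ 2) :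
    ∃ (H : Phase d → ℝ) (Φ : ℝ → Phase d → Phase d), ContDiff ℝ ∞ H ∧
      IsEllipticWithFrequency ω₀ H ∧ IsHamiltonianFlow H Φ ∧
      (∃ Ω : (Fin d → ℝ) → Fin d → ℝ, ∀ z, action z ∉ Z.D → ∀ t,
        Φ t z = rotate (t • Ω (action z)) z) ∧
      (∀ z, action z ∈ Z.D → ∀ K, IsCompact K → K ⊆ Z.D → ∃ t, action (Φ t z) ∉ K) ∧
      (Z.Drift → IsDiffusive Φ) := by
  obtain ⟨S⟩ := exists_approxSeq Z hadm
  exact ⟨S.limitHam, S.limitFlow, S.contDiff_limitHam, S.isElliptic_limitHam hh₀,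
    S.isHamiltonianFlow_limitFlow, S.exists_limitFlow_eq_rotate,
    fun z hz K hK hKD => S.exists_action_limitFlow_notMem hz hK hKD, S.isDiffusive_limitFlow⟩

end Limit

section NullSets

variable {d : ℕ}

lemma notMem_exceptionalSet_iff {k : Fin d} {a : ℤ → ℝ} {z : Phase d} :
    z ∉ exceptionalSet k a ↔ (∀ i, 0 < action z i) ∧ ∀ n, action z k ≠ a n := by
  simp only [exceptionalSet, Set.mem_ofPred_eq, not_or, not_exists]
  refine and_congr_left fun _ => forall_congr' fun i => ?_
  exact ⟨fun h => lt_of_le_of_ne (action_nonneg z i) (Ne.symm h), fun h => h.ne'⟩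

lemma convex_setOf_action_le (i : Fin d) (a : ℝ) : Convex ℝ {z : Phase d | action z i ≤ a} := by
  have hsq (j : Fin d ⊕ Fin d) : ConvexOn ℝ Set.univ fun z : Phase d => z j ^ 2 :=
    (even_two.convexOn_pow (𝕜 := ℝ)).comp_linearMap (EuclideanSpace.projₗ j)
  simpa [action, div_eq_inv_mul] using
    (((hsq (Sum.inl i)).add (hsq (Sum.inr i))).smul (inv_nonneg.2 zero_le_two)).convex_le a

lemma setOf_action_eq_subset_frontier (i : Fin d) (a : ℝ) :
    {z : Phase d | action z i = a} ⊆ frontier {z : Phase d | action z i ≤ a} := by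
  intro z hz
  refine ⟨subset_closure (le_of_eq hz), fun hinterior => ?_⟩
  let v : Phase d := EuclideanSpace.single (Sum.inl i) 1
  have hexpand (s : ℝ) : action (z + s • v) i = a + (s * z (Sum.inl i) + s ^ 2 / 2) := by
    rw [← hz]
    simp [action, v]
    ring
  have hnear {f : ℝ → ℝ} (hf : Continuous f) (hf0 : f 0 = 0) :
      ∀ᶠ s in 𝓝 (0 : ℝ), action (z + f s • v) i ≤ a := by
    have hcont : Continuous fun s => z + f s • v := by fun_prop
    exact (hcont.tendsto' 0 z (by simp [hf0])).eventually (mem_interior_iff_mem_nhds.1 hinterior)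
  obtain ⟨s, ⟨hs, hs'⟩, hpos⟩ := (((hnear continuous_id rfl).and
    (hnear continuous_neg neg_zero)).filter_mono nhdsWithin_le_nhds |>.and
      (self_mem_nhdsWithin (s := Set.Ioi (0 : ℝ)))).exists
  rw [hexpand] at hs hs'
  have hsq : 0 < s ^ 2 := pow_pos hpos 2
  simp only [id] at hs
  nlinarith

lemma volume_setOf_action_eq (i : Fin d) (a : ℝ) : volume {z : Phase d | action z i = a} = 0 :=
  measure_mono_null (setOf_action_eq_subset_frontier i a)
    ((convex_setOf_action_le i a).addHaar_frontier volume)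

lemma volume_exceptionalSet (k : Fin d) (a : ℤ → ℝ) : volume (exceptionalSet k a) = 0 := by
  have hunion : exceptionalSet k a = (⋃ i, {z : Phase d | action z i = 0}) ∪
      ⋃ n, {z : Phase d | action z k = a n} := by
    ext z
    simp [exceptionalSet]
  rw [hunion]
  exact measure_union_null (measure_iUnion_null fun i => volume_setOf_action_eq i 0)
    (measure_iUnion_null fun n => volume_setOf_action_eq k (a n))

end NullSets

section Consequences

lemma notMem_of_tendsto_of_forall_notMem {X : Type*} [TopologicalSpace X] [LocallyCompactSpace X]
    {D : Set X} {Q : ℕ → Set X} (hD : IsOpen D) (hQ : Monotone Q)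
    (hex : ∀ K, IsCompact K → K ⊆ D → ∃ j, K ⊆ Q j) {x : ℕ → X} {φ : ℕ → ℕ}
    (hφ : StrictMono φ) (hx : ∀ n, x n ∉ Q n) {r : X}
    (hr : Tendsto (x ∘ φ) atTop (𝓝 r)) : r ∉ D := by
  intro hrD
  obtain ⟨K, hK, hrK, hKD⟩ := exists_compact_subset hD hrD
  obtain ⟨j, hj⟩ := hex K hK hKD
  obtain ⟨n, hnK, hjn⟩ := ((hr.eventually (isOpen_interior.mem_nhds hrK)).and
    (eventually_ge_atTop j)).exists
  exact hx (φ n) (hQ (hjn.trans (hφ.id_le n)) (hj (interior_subset hnK)))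

variable {d : ℕ} {D : Set (Fin d → ℝ)} {Q : ℕ → Set (Fin d → ℝ)} {Φ : ℝ → Phase d → Phase d}

lemma accumulates_of_forall_exists_notMem (hD : IsOpen D) (hQ : Monotone Q)
    (hex : ∀ K, IsCompact K → K ⊆ D → ∃ j, K ⊆ Q j) {z : Phase d}
    (hz : ∀ j, ∃ t, action (Φ t z) ∉ Q j) :
    AccumulatesOn Φ z {w | action w ∉ D} ∨ AccumulatesAtInfinity Φ z := by
  choose t ht using hz
  by_cases hinf : Tendsto (fun j => ‖Φ (t j) z‖) atTop atTop
  · exact Or.inr ⟨t, hinf⟩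
  left
  obtain ⟨R, hR⟩ : ∃ R, ∃ᶠ j in atTop, Φ (t j) z ∈ Metric.closedBall (0 : Phase d) R := by
    rw [tendsto_atTop] at hinf
    push Not at hinf
    obtain ⟨R, hR⟩ := hinf
    exact ⟨R, hR.mono fun j hj => mem_closedBall_zero_iff.2 hj.le⟩
  obtain ⟨w, -, φ, hφ, hw⟩ := (isCompact_closedBall (0 : Phase d) R).tendsto_subseq' hR
  exact ⟨w, notMem_of_tendsto_of_forall_notMem hD hQ hex hφ ht
    ((continuous_action.tendsto w).comp hw), t ∘ φ, hw⟩

lemma exists_add_two_pi_mul_mem_Icc (x : ℝ) :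
    ∃ n : ℤ, x + 2 * Real.pi * n ∈ Set.Icc 0 (2 * Real.pi) := by
  obtain ⟨n, hn, -⟩ := existsUnique_add_zsmul_mem_Ico Real.two_pi_pos x 0
  refine ⟨n, Set.Ico_subset_Icc_self ?_⟩
  simpa [mul_comm] using hn

lemma IsInvariantLagrangianTorus.exists_tendsto_and_tendsto_neg {T : Set (Phase d)}
    (hT : IsInvariantLagrangianTorus Φ T) {z : Phase d} (hz : z ∈ T) (t : ℕ → ℝ) :
    ∃ w, ∃ ψ : ℕ → ℕ, StrictMono ψ ∧ Tendsto (fun j => Φ (t (ψ j)) z) atTop (𝓝 w) ∧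
      Tendsto (fun j => Φ (-t (ψ j)) w) atTop (𝓝 z) := by
  obtain ⟨φ, Ω, hφ, hper, -, -, hflow, rfl⟩ := hT
  obtain ⟨u, rfl⟩ := hz
  choose n hn using fun j i => exists_add_two_pi_mul_mem_Icc ((u + t j • Ω) i)
  let y : ℕ → EuclideanSpace ℝ (Fin d) := fun j =>
    WithLp.toLp 2 fun i => (u + t j • Ω) i + 2 * Real.pi * n j i
  have hcube : IsCompact (WithLp.toLp 2 '' Set.univ.pi
      fun _ : Fin d => Set.Icc (0 : ℝ) (2 * Real.pi)) :=
    (isCompact_univ_pi fun _ => isCompact_Icc).image (PiLp.continuous_toLp 2 _)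
  obtain ⟨v, -, ψ, hψ, hv⟩ := hcube.tendsto_subseq (x := y) fun j => ⟨_, fun i _ => hn j i, rfl⟩
  have hforth : ∀ j, Φ (t j) (φ u) = φ (y j) := fun j => by
    rw [hflow]
    exact (hper _ _).2 fun i => ⟨n j i, rfl⟩
  have hback : ∀ j, Φ (-t j) (φ v) = φ (u + (v - y j)) := fun j => by
    rw [hflow, hper]
    intro i
    refine ⟨-n j i, ?_⟩
    simp only [y, PiLp.add_apply, PiLp.sub_apply, PiLp.smul_apply, smul_eq_mul, Int.cast_neg]
    ring
  refine ⟨φ v, ψ, hψ, ?_, ?_⟩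
  · simp only [hforth]
    exact (hφ.continuous.tendsto v).comp hv
  · simp only [hback]
    have hcont : Continuous fun x => φ (u + (v - x)) := hφ.continuous.comp (by fun_prop)
    exact (hcont.tendsto' v (φ u) (by simp)).comp hv

-- A linear flow on a torus is recurrent: an orbit that comes close to a point `w` outside `D` can
-- be followed back from `w`. But the actions are constant along the orbit of `w`.
lemma IsInvariantLagrangianTorus.action_notMem (hD : IsOpen D) (hQ : Monotone Q)
    (hex : ∀ K, IsCompact K → K ⊆ D → ∃ j, K ⊆ Q j)
    (hexit : ∀ z, action z ∈ D → ∀ j, ∃ t, action (Φ t z) ∉ Q j)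
    (hinv : ∀ z, action z ∉ D → ∀ t, action (Φ t z) = action z) {T : Set (Phase d)}
    (hT : IsInvariantLagrangianTorus Φ T) {z : Phase d} (hz : z ∈ T) : action z ∉ D := by
  intro hzD
  choose t ht using hexit z hzD
  obtain ⟨w, ψ, hψ, hforth, hback⟩ := hT.exists_tendsto_and_tendsto_neg hz t
  have hwD : action w ∉ D := notMem_of_tendsto_of_forall_notMem hD hQ hex hψ ht
    ((continuous_action.tendsto w).comp hforth)
  have hlim := (continuous_action.tendsto z).comp hback
  simp only [Function.comp_def, hinv w hwD] at hlim
  rw [tendsto_nhds_unique hlim tendsto_const_nhds] at hzD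
  exact hwD hzD

end Consequences

section CellDomain

/-- The values `a_n` of the action `r_k` on the tori that survive. Any geometric sequence whose
ratio is close enough to `1` would do. -/
def level (n : ℤ) : ℝ := (9 / 8) ^ n

lemma level_pos (n : ℤ) : 0 < level n := zpow_pos (by norm_num) n

lemma level_succ (n : ℤ) : level (n + 1) = 9 / 8 * level n := by
  rw [level, zpow_add_one₀ (by norm_num), mul_comm]
  rfl

lemma strictMono_level : StrictMono level := zpow_right_strictMono₀ (by norm_num)

lemma exists_level_le {y : ℝ} (hy : 0 < y) : ∃ n, level n ≤ y ∧ y < level (n + 1) :=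
  exists_mem_Ico_zpow hy (by norm_num)

lemma tendsto_level_atTop : Tendsto level atTop atTop := by
  refine tendsto_atTop_atTop_of_monotone strictMono_level.monotone fun b => ?_
  obtain ⟨n, hn⟩ := pow_unbounded_of_one_lt b (show (1 : ℝ) < 9 / 8 by norm_num)
  exact ⟨n, by rw [level, zpow_natCast]; exact hn.le⟩

lemma tendsto_level_atBot : Tendsto level atBot (𝓝 0) := by
  have hinv : Tendsto (fun n : ℤ => (level (-n))⁻¹) atBot (𝓝 0) :=
    tendsto_inv_atTop_zero.comp (tendsto_level_atTop.comp tendsto_neg_atBot_atTop)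
  refine hinv.congr fun n => ?_
  rw [level, level, zpow_neg, inv_inv]

variable {d : ℕ} {k : Fin d}

variable (k) in
/-- The actions of the points outside the exceptional set of the theorem: they are positive and
`r_k` is not one of the levels. -/
def cellDomain : Set (Fin d → ℝ) := {r | (∀ i, 0 < r i) ∧ ∀ n, r k ≠ level n}

variable (k) in
/-- The connected component of `cellDomain k` on which `r_k` lies between the levels `n` and
`n + 1`. -/
def cell (n : ℤ) : Set (Fin d → ℝ) := {r | (∀ i, 0 < r i) ∧ level n < r k ∧ r k < level (n + 1)}

lemma isOpen_cell (n : ℤ) : IsOpen (cell k n) := by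
  have hpos : IsOpen {r : Fin d → ℝ | ∀ i, 0 < r i} := by
    simp only [Set.ofPred_forall]
    exact isOpen_iInter_of_finite fun i => isOpen_lt continuous_const (continuous_apply i)
  exact hpos.inter ((isOpen_lt continuous_const (continuous_apply k)).inter
    (isOpen_lt (continuous_apply k) continuous_const))

lemma cell_subset (n : ℤ) : cell k n ⊆ cellDomain k := by
  rintro r ⟨hpos, hlow, hhigh⟩
  refine ⟨hpos, fun m hm => ?_⟩
  rw [hm, strictMono_level.lt_iff_lt] at hlow hhigh
  omega

lemma exists_mem_cell {r : Fin d → ℝ} (hr : r ∈ cellDomain k) : ∃ n, r ∈ cell k n := by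
  obtain ⟨n, hlow, hhigh⟩ := exists_level_le (hr.1 k)
  exact ⟨n, hr.1, lt_of_le_of_ne hlow (Ne.symm (hr.2 n)), hhigh⟩

lemma cell_unique {r : Fin d → ℝ} {n n' : ℤ} (h : r ∈ cell k n) (h' : r ∈ cell k n') : n = n' := by
  have hle := strictMono_level.lt_iff_lt.1 (h.2.1.trans h'.2.2)
  have hge := strictMono_level.lt_iff_lt.1 (h'.2.1.trans h.2.2)
  omega

lemma isOpen_cellDomain : IsOpen (cellDomain k) := by
  have hunion : cellDomain k = ⋃ n, cell k n := by
    ext r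
    simp only [Set.mem_iUnion]
    exact ⟨exists_mem_cell, fun ⟨n, hn⟩ => cell_subset n hn⟩
  rw [hunion]
  exact isOpen_iUnion isOpen_cell

lemma add_smul_apply_mem_uIcc (κ : Fin d → ℤ) (ρ : Fin d → ℝ) {s t : ℝ} (hs : s ∈ Set.uIcc 0 t)
    (i : Fin d) : (ρ + s • (fun i => (κ i : ℝ))) i ∈
      Set.uIcc (ρ i) ((ρ + t • (fun i => (κ i : ℝ))) i) := by
  have hmem : ρ i + s * κ i ∈ (fun x => ρ i + x * κ i) '' Set.uIcc 0 t := ⟨s, hs, rfl⟩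
  have himage : (fun x => ρ i + x * κ i) '' Set.uIcc 0 t = Set.uIcc (ρ i) (ρ i + t * κ i) := by
    rw [← Set.image_image (fun x => ρ i + x) (fun x => x * (κ i : ℝ)), Set.image_mul_const_uIcc,
      Set.image_const_add_uIcc, zero_mul, add_zero]
  rwa [himage] at hmem

lemma lt_level_iff_of_lineIn {κ : Fin d → ℤ} {ρ : Fin d → ℝ} {t : ℝ}
    (h : LineIn (cellDomain k) κ ρ t) (n : ℤ) :
    ρ k < level n ↔ (ρ + t • (fun i => (κ i : ℝ))) k < level n := by
  have hcont : Continuous fun s : ℝ => (ρ + s • (fun i => (κ i : ℝ))) k := by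
    simp only [Pi.add_apply, Pi.smul_apply]
    fun_prop
  have himage := intermediate_value_uIcc (a := 0) (b := t) hcont.continuousOn
  simp only [zero_smul, add_zero] at himage
  have hnotMem : level n ∉ Set.uIcc (ρ k) ((ρ + t • (fun i => (κ i : ℝ))) k) := fun hn => by
    obtain ⟨s, hs, hlevel⟩ := himage hn
    exact (h s hs).2 n hlevel
  rw [Set.mem_uIcc] at hnotMem
  push Not at hnotMem
  refine ⟨fun hlt => hnotMem.1 hlt.le, fun hlt => ?_⟩
  by_contra hge
  exact hge (hnotMem.2 hlt.le)

lemma mem_cell_of_lineIn {κ : Fin d → ℤ} {ρ : Fin d → ℝ} {t : ℝ} (h : LineIn (cellDomain k) κ ρ t)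
    {n : ℤ} (hρ : ρ ∈ cell k n) : ρ + t • (fun i => (κ i : ℝ)) ∈ cell k n := by
  refine ⟨h.right_mem.1, ?_, (lt_level_iff_of_lineIn h (n + 1)).1 hρ.2.2⟩
  refine lt_of_le_of_ne (le_of_not_gt fun hlt => ?_) (Ne.symm (h.right_mem.2 n))
  exact hρ.2.1.not_gt ((lt_level_iff_of_lineIn h n).2 hlt)

variable (k) in
/-- The `j`-th set of an exhaustion of `cellDomain k` by compact sets. -/
def cellExhaustion (j : ℕ) : Set (Fin d → ℝ) :=
  {r | (∀ i, r i ∈ Set.Icc ((j : ℝ) + 1)⁻¹ ((j : ℝ) + 1)) ∧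
    ∀ n, ((j : ℝ) + 1)⁻¹ ≤ |r k - level n|}

lemma isCompact_cellExhaustion (j : ℕ) : IsCompact (cellExhaustion k j) := by
  have hbox : IsCompact {r : Fin d → ℝ | ∀ i, r i ∈ Set.Icc ((j : ℝ) + 1)⁻¹ ((j : ℝ) + 1)} :=
    isCompact_pi_infinite fun _ => isCompact_Icc
  have hlevel : IsClosed {r : Fin d → ℝ | ∀ n, ((j : ℝ) + 1)⁻¹ ≤ |r k - level n|} := by
    simp only [Set.ofPred_forall]
    exact isClosed_iInter fun n => isClosed_le continuous_const
      ((continuous_apply k).sub continuous_const).abs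
  exact hbox.inter_right hlevel

lemma cellExhaustion_subset (j : ℕ) : cellExhaustion k j ⊆ cellDomain k := by
  intro r hr
  have hj : 0 < ((j : ℝ) + 1)⁻¹ := by positivity
  refine ⟨fun i => hj.trans_le (hr.1 i).1, fun n hn => ?_⟩
  have hdist := hr.2 n
  rw [hn, sub_self, abs_zero] at hdist
  exact hj.not_ge hdist

lemma monotone_cellExhaustion : Monotone (cellExhaustion k) := by
  intro j j' hj r hr
  have hle : (j : ℝ) + 1 ≤ (j' : ℝ) + 1 := by gcongr
  have hinv : ((j' : ℝ) + 1)⁻¹ ≤ ((j : ℝ) + 1)⁻¹ := inv_anti₀ (by positivity) hle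
  exact ⟨fun i => ⟨hinv.trans (hr.1 i).1, (hr.1 i).2.trans hle⟩, fun n => hinv.trans (hr.2 n)⟩

lemma exists_forall_update_mem {K D : Set (Fin d → ℝ)} (hK : IsCompact K) (hD : IsOpen D)
    (hKD : K ⊆ D) :
    ∃ δ > 0, ∀ r ∈ K, ∀ i x, |r i - x| < δ → Function.update r i x ∈ D := by
  obtain ⟨δ, hδ, hsub⟩ := hK.exists_thickening_subset_open hD hKD
  refine ⟨δ, hδ, fun r hr i x hx => hsub (Metric.mem_thickening_iff.2 ⟨r, hr, ?_⟩)⟩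
  rw [dist_pi_lt_iff hδ]
  intro b
  by_cases hb : b = i
  · subst hb
    rwa [Function.update_self, Real.dist_eq, abs_sub_comm]
  · rw [Function.update_of_ne hb, dist_self]
    exact hδ

lemma exists_subset_cellExhaustion {K : Set (Fin d → ℝ)} (hK : IsCompact K)
    (hKD : K ⊆ cellDomain k) : ∃ j, K ⊆ cellExhaustion k j := by
  obtain ⟨δ, hδ, hupdate⟩ := exists_forall_update_mem hK isOpen_cellDomain hKD
  obtain ⟨R, hR⟩ := hK.isBounded.exists_norm_le
  obtain ⟨j, hj⟩ := exists_nat_ge (max R δ⁻¹)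
  have hjδ : ((j : ℝ) + 1)⁻¹ ≤ δ := by
    rw [inv_le_comm₀ (by positivity) hδ]
    linarith [le_max_right R δ⁻¹]
  refine ⟨j, fun r hr => ⟨fun i => ⟨hjδ.trans ?_, ?_⟩, fun n => hjδ.trans ?_⟩⟩
  · by_contra! hlt
    have hmem := hupdate r hr i 0 (by rwa [sub_zero, abs_of_pos ((hKD hr).1 i)])
    simpa using hmem.1 i
  · calc r i ≤ ‖r i‖ := Real.le_norm_self _
      _ ≤ ‖r‖ := norm_le_pi_norm r i
      _ ≤ R := hR r hr
      _ ≤ (j : ℝ) + 1 := by linarith [le_max_left R δ⁻¹]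
  · by_contra! hlt
    simpa using (hupdate r hr k (level n) hlt).2 n

lemma lineIn_cellExhaustion {j : ℕ} {κ : Fin d → ℤ} {ρ : Fin d → ℝ} {t : ℝ}
    (hρ : ρ ∈ cellExhaustion k j) (hρt : ρ + t • (fun i => (κ i : ℝ)) ∈ cellExhaustion k j)
    (hline : LineIn (cellDomain k) κ ρ t) : LineIn (cellExhaustion k j) κ ρ t := by
  intro s hs
  have hmem := add_smul_apply_mem_uIcc κ ρ hs
  refine ⟨fun i => Set.ordConnected_Icc.uIcc_subset (hρ.1 i) (hρt.1 i) (hmem i), fun n => ?_⟩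
  have hside := lt_level_iff_of_lineIn hline n
  have hdist := hρ.2 n
  have hdist' := hρt.2 n
  rcases lt_or_ge (ρ k) (level n) with hlt | hge
  · rw [abs_of_neg (sub_neg.2 hlt)] at hdist
    rw [abs_of_neg (sub_neg.2 (hside.1 hlt))] at hdist'
    have hle := (Set.ordConnected_Iic (a := level n - ((j : ℝ) + 1)⁻¹)).uIcc_subset
      (Set.mem_Iic.2 (by linarith)) (Set.mem_Iic.2 (by linarith)) (hmem k)
    exact le_abs.2 (Or.inr (by linarith [Set.mem_Iic.1 hle]))
  · rw [abs_of_nonneg (sub_nonneg.2 hge)] at hdist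
    rw [abs_of_nonneg (sub_nonneg.2 (not_lt.1 (mt hside.2 hge.not_gt)))] at hdist'
    have hle := (Set.ordConnected_Ici (a := level n + ((j : ℝ) + 1)⁻¹)).uIcc_subset
      (Set.mem_Ici.2 (by linarith)) (Set.mem_Ici.2 (by linarith)) (hmem k)
    exact le_abs.2 (Or.inl (by linarith [Set.mem_Ici.1 hle]))

end CellDomain

section DirectionalDerivative

variable {d : ℕ} {h : (Fin d → ℝ) → ℝ} {r v : Fin d → ℝ} {D : ℝ}

lemma sum_mul_grad_eq (hh : DifferentiableAt ℝ h r)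
    (hd : HasDerivAt (fun s : ℝ => h (r + s • v)) D 0) : ∑ i, v i * grad h r i = D := by
  rw [← fderiv_eq_sum_grad]
  have hline : HasDerivAt (fun s : ℝ => r + s • v) v 0 := by
    simpa using ((hasDerivAt_id (0 : ℝ)).smul_const v).const_add r
  have hfderiv : HasFDerivAt h (fderiv ℝ h r) (r + (0 : ℝ) • v) := by simpa using hh.hasFDerivAt
  exact (hfderiv.comp_hasDerivAt 0 hline).unique hd

lemma sum_mul_grad_eq_of_affine (hh : DifferentiableAt ℝ h r)
    (haff : ∀ s : ℝ, h (r + s • v) = h r + s * D) : ∑ i, v i * grad h r i = D := by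
  refine sum_mul_grad_eq hh ?_
  simp only [haff]
  simpa using ((hasDerivAt_id (0 : ℝ)).mul_const D).const_add (h r)

lemma sum_mul_add_smul (ω₀ r v : Fin d → ℝ) (s : ℝ) :
    ∑ x, ω₀ x * (r + s • v) x = ∑ x, ω₀ x * r x + s * ∑ x, v x * ω₀ x := by
  rw [Finset.mul_sum, ← Finset.sum_add_distrib]
  refine Finset.sum_congr rfl fun x _ => ?_
  simp only [Pi.add_apply, Pi.smul_apply, smul_eq_mul]
  ring

lemma sum_mul_grad_linear (ω₀ r v : Fin d → ℝ) :
    ∑ x, v x * grad (fun r => ∑ x, ω₀ x * r x) r x = ∑ x, v x * ω₀ x :=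
  sum_mul_grad_eq_of_affine (by fun_prop) (sum_mul_add_smul ω₀ r v)

lemma sum_mul_grad_perturbed {N : ℕ} {u : Fin N → (Fin d → ℝ) → ℝ} (hh : Differentiable ℝ h)
    (hu : ∀ m, Differentiable ℝ (u m)) (c : Fin N → ℝ) (r v : Fin d → ℝ) :
    ∑ x, v x * grad (perturbed h u c) r x =
      ∑ x, v x * grad h r x + ∑ m, c m * ∑ x, v x * grad (u m) r x := by
  simp only [grad_perturbed hh hu, Pi.add_apply, Finset.sum_apply, Pi.smul_apply, smul_eq_mul,
    mul_add, Finset.sum_add_distrib, Finset.mul_sum]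
  rw [Finset.sum_comm]
  simp only [mul_left_comm]

end DirectionalDerivative

section Degenerate

variable {d : ℕ} {ω₀ : Fin d → ℝ} {i j k : Fin d}

variable (ω₀ i j k) in
/-- The Hamiltonians that are used when `ω₀ i = ω₀ j = 0`: the quadratic term makes the frequencies
`ω_i = r_k` and `ω_j = t r_k` resonant for rational `t`. -/
def degenerateHam (t : ℝ) (r : Fin d → ℝ) : ℝ :=
  ∑ x, ω₀ x * r x + r k * (r i + t * r j)

variable (ω₀ j k) in
/-- The integer directions along which `degenerateHam` can be made resonant. -/
def degenerateDir : Set (Fin d → ℤ) := {κ | κ k = 0 ∧ κ j ≠ 0 ∧ ∑ x, κ x * ω₀ x = 0}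

lemma contDiff_degenerateHam (t : ℝ) : ContDiff ℝ ∞ (degenerateHam ω₀ i j k t) := by
  unfold degenerateHam
  fun_prop

lemma perturbed_degenerateHam (t t' : ℝ) :
    perturbed (degenerateHam ω₀ i j k t) (fun (_ : Fin 1) r => r k * r j) (fun _ => t' - t) =
      degenerateHam ω₀ i j k t' := by
  funext r
  simp only [perturbed, degenerateHam, Fin.sum_univ_one]
  ring

lemma sum_mul_grad_degenerateHam (t : ℝ) (r : Fin d → ℝ) {κ : Fin d → ℤ}
    (hκ : κ ∈ degenerateDir ω₀ j k) :
    ∑ x, κ x * grad (degenerateHam ω₀ i j k t) r x = r k * (κ i + t * κ j) := by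
  refine sum_mul_grad_eq_of_affine (v := fun x => (κ x : ℝ))
    ((contDiff_degenerateHam t).differentiable (by simp)).differentiableAt fun s => ?_
  rw [degenerateHam, sum_mul_add_smul, hκ.2.2, degenerateHam]
  simp only [Pi.add_apply, Pi.smul_apply, hκ.1, smul_eq_mul, Int.cast_zero]
  ring

lemma isBigO_mul_coord (i j : Fin d) :
    (fun r : Fin d → ℝ => r i * r j) =O[𝓝 0] fun r => ‖r‖ ^ 2 := by
  refine Asymptotics.IsBigO.of_bound 1 (Eventually.of_forall fun r => ?_)
  rw [norm_mul, norm_pow, norm_norm, one_mul, sq]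
  exact mul_le_mul (norm_le_pi_norm r i) (norm_le_pi_norm r j) (norm_nonneg _) (norm_nonneg _)

lemma hasSmallPerturbation_degenerateHam {P : ((Fin d → ℝ) → ℝ) → Prop} {t : ℝ}
    (hP : ∀ q : ℚ, t < q → P (degenerateHam ω₀ i j k q)) :
    HasSmallPerturbation (fun h => ∃ t, h = degenerateHam ω₀ i j k t) P
      (degenerateHam ω₀ i j k t) := by
  refine ⟨1, fun _ r => r k * r j, fun _ => by fun_prop, fun _ => isBigO_mul_coord k j,
    fun η hη => ?_⟩
  obtain ⟨q, htq, hqt⟩ := exists_rat_btwn (show t < t + η by linarith)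
  refine ⟨fun _ => q - t, ?_, ⟨q, perturbed_degenerateHam t q⟩, ?_⟩
  · rw [pi_norm_const, Real.norm_eq_abs, abs_lt]
    constructor <;> linarith
  · rw [perturbed_degenerateHam]
    exact hP q htq

lemma exists_isResonantOn_degenerateHam (hij : i ≠ j) (hik : i ≠ k) (hjk : j ≠ k) (hi : ω₀ i = 0)
    (hj : ω₀ j = 0) (q : ℚ) (O : Set (Fin d → ℝ)) :
    ∃ κ ∈ degenerateDir ω₀ j k, IsResonantOn κ (degenerateHam ω₀ i j k q) O := by
  let κ : Fin d → ℤ := fun x => if x = j then q.den else if x = i then -q.num else 0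
  have hκ : κ ∈ degenerateDir ω₀ j k := by
    refine ⟨by simp [κ, hik.symm, hjk.symm], by simp [κ], Finset.sum_eq_zero fun x _ => ?_⟩
    rcases eq_or_ne x j with rfl | hxj
    · rw [hj, mul_zero]
    · rcases eq_or_ne x i with rfl | hxi
      · rw [hi, mul_zero]
      · simp [κ, hxj, hxi]
  refine ⟨κ, hκ, fun r _ => ?_⟩
  have hq : (q : ℝ) * q.den = q.num := by exact_mod_cast Rat.mul_den_eq_num q
  rw [sum_mul_grad_degenerateHam _ _ hκ]
  simp [κ, hij, hq]

lemma sum_mul_grad_degenerateHam_ne_zero {t t' : ℝ} {κ : Fin d → ℤ}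
    (hκ : κ ∈ degenerateDir ω₀ j k) {r : Fin d → ℝ} (hr : 0 < r k) (ht : t < t')
    (hres : ∑ x, κ x * grad (degenerateHam ω₀ i j k t) r x = 0) :
    ∑ x, κ x * grad (degenerateHam ω₀ i j k t') r x ≠ 0 := by
  rw [sum_mul_grad_degenerateHam _ _ hκ] at hres ⊢
  have hdiff : r k * (κ i + t' * κ j) = r k * ((t' - t) * κ j) := by linear_combination hres
  rw [hdiff]
  exact mul_ne_zero hr.ne' (mul_ne_zero (sub_ne_zero.2 ht.ne') (by exact_mod_cast hκ.2.1))

/-- The zone system for a frequency vector with `ω₀ i = ω₀ j = 0`. The whole domain is a single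
zone, so the zones of nonzero index are empty. -/
def degenerateZones (hij : i ≠ j) (hik : i ≠ k) (hjk : j ≠ k) (hi : ω₀ i = 0) (hj : ω₀ j = 0) :
    ZoneSystem d where
  D := cellDomain k
  pos r hr := hr.1
  zero_notMem h := lt_irrefl _ (h.1 k)
  Q := cellExhaustion k
  isCompact_Q := isCompact_cellExhaustion
  Q_subset := cellExhaustion_subset
  monotone_Q := monotone_cellExhaustion
  exists_subset_Q _ hK hKD := exists_subset_cellExhaustion hK hKD
  lineIn_Q _ _ _ _ := lineIn_cellExhaustion
  O m := {r | m = 0 ∧ r ∈ cellDomain k}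
  C m := {r | m = 0 ∧ r ∈ cellDomain k}
  isOpen_O m := isOpen_const.inter isOpen_cellDomain
  O_subset _ _ hr := hr.2
  C_subset _ := subset_rfl
  isCompact_C_inter m K hK hKD := by
    by_cases hm : m = 0
    · convert hK using 1
      exact Set.inter_eq_right.2 fun r hr => ⟨hm, hKD hr⟩
    · convert isCompact_empty using 1
      exact Set.eq_empty_of_forall_notMem fun r hr => hm hr.1.1
  cover _ hr := ⟨0, rfl, hr⟩
  disjoint_O m m' hne _ := Set.disjoint_left.2 fun r hr hr' => hne (hr.1.trans hr'.1.symm)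
  finite_C _ _ _ := ⟨1, fun m ⟨r, hr⟩ => by rw [hr.1.1]; exact one_pos⟩
  dir _ := degenerateDir ω₀ j k
  dir_ne _ κ hκ h := hκ.2.1 (by rw [h]; rfl)
  inv_C _ κ _ ρ hρ t ht := ⟨hρ.1, ht.right_mem⟩
  Adm h := ∃ t, h = degenerateHam ω₀ i j k t
  contDiff_of_adm h := by
    rintro ⟨t, rfl⟩
    exact contDiff_degenerateHam t
  resonate := by
    rintro h ⟨t, rfl⟩ M
    refine hasSmallPerturbation_degenerateHam fun q _ => ?_
    obtain ⟨κ, hκ, hres⟩ := exists_isResonantOn_degenerateHam hij hik hjk hi hj q Set.univ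
    exact ⟨fun _ => κ, fun m _ => ⟨hκ, fun r _ => hres r trivial⟩⟩
  detune := by
    rintro h ⟨t, rfl⟩ M κ hκ
    exact hasSmallPerturbation_degenerateHam fun q htq m hm r hr =>
      sum_mul_grad_degenerateHam_ne_zero (hκ m hm).1 (hr.2.1 k) htq ((hκ m hm).2 r hr)

end Degenerate

section Conclusion

variable {d : ℕ} {k : Fin d} {Φ : ℝ → Phase d → Phase d} {a : ℤ → ℝ} {Ω : (Fin d → ℝ) → Fin d → ℝ}

lemma foliatedByInvariantTori_of_rotate {S : Set (Phase d)} (hsat : ∀ z ∈ S, flatTorus z ⊆ S)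
    (hrot : ∀ z ∈ S, ∀ t, Φ t z = rotate (t • Ω (action z)) z) : FoliatedByInvariantTori Φ S :=
  fun z hz => ⟨hsat z hz, Ω (action z), fun w hw t => by
    rw [hrot w (hsat z hz hw), show action w = action z from funext hw]⟩

lemma not_isKAMStable_of_forall_subset_exceptionalSet
    (hT : ∀ T : Set (Phase d), IsInvariantLagrangianTorus Φ T → T ⊆ exceptionalSet k a) :
    ¬ IsKAMStable Φ := fun hkam => by
  refine (hkam Set.univ univ_mem).ne' (measure_mono_null ?_ (volume_exceptionalSet k a))
  rintro z ⟨T, ⟨hTinv, -⟩, hz⟩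
  exact hT T hTinv hz

lemma ZoneSystem.exists_of_cellDomain (Z : ZoneSystem d) (hD : Z.D = cellDomain k)
    {h₀ : (Fin d → ℝ) → ℝ} {ω₀ : Fin d → ℝ} (hadm : Z.Adm h₀)
    (hh₀ : (fun r => h₀ r - ∑ i, ω₀ i * r i) =O[𝓝 0] fun r => ‖r‖ ^ 2) :
    ∃ (H : Phase d → ℝ) (Φ : ℝ → Phase d → Phase d),
      ContDiff ℝ ∞ H ∧
      IsEllipticWithFrequency ω₀ H ∧
      IsHamiltonianFlow H Φ ∧
      (∀ n, FoliatedByInvariantTori Φ {z | action z k = level n}) ∧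
      (∀ i, FoliatedByInvariantTori Φ {z | action z i = 0}) ∧
      (∀ z, z ∉ exceptionalSet k level →
        AccumulatesOn Φ z (exceptionalSet k level) ∨ AccumulatesAtInfinity Φ z) ∧
      ¬ IsKAMStable Φ ∧ (Z.Drift → IsDiffusive Φ) := by
  obtain ⟨H, Φ, hH, hell, hflow, ⟨Ω, hrot⟩, hexit, hdiff⟩ := Z.exists_hamiltonian hadm hh₀
  have hmem (z : Phase d) : action z ∉ Z.D ↔ z ∈ exceptionalSet k level := by
    rw [← not_iff_not, not_not, notMem_exceptionalSet_iff, hD]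
    rfl
  have hopen : IsOpen Z.D := hD ▸ isOpen_cellDomain
  have hexitQ (z) (hz : action z ∈ Z.D) (j) : ∃ t, action (Φ t z) ∉ Z.Q j :=
    hexit z hz _ (Z.isCompact_Q j) (Z.Q_subset j)
  refine ⟨H, Φ, hH, hell, hflow, fun n => ?_, fun i => ?_, fun z hz => ?_, ?_, hdiff⟩
  · exact foliatedByInvariantTori_of_rotate (fun z hz w hw => (hw k).trans hz)
      fun z hz => hrot z ((hmem z).2 (Or.inr ⟨n, hz⟩))
  · exact foliatedByInvariantTori_of_rotate (fun z hz w hw => (hw i).trans hz)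
      fun z hz => hrot z ((hmem z).2 (Or.inl ⟨i, hz⟩))
  · rw [← hmem, not_not] at hz
    rw [show exceptionalSet k level = {w | action w ∉ Z.D} from Set.ext fun w => (hmem w).symm]
    exact accumulates_of_forall_exists_notMem hopen Z.monotone_Q Z.exists_subset_Q (hexitQ z hz)
  · exact not_isKAMStable_of_forall_subset_exceptionalSet fun T hT z hz => (hmem z).1 <|
      hT.action_notMem hopen Z.monotone_Q Z.exists_subset_Q hexitQ
        (fun w hw t => by rw [hrot w hw, action_rotate]) hz

end Conclusion

section Ramp

/-- A smoothing of `max x 0` that agrees with it outside `(0, 1)`. It switches a linear function on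
across a hyperplane. -/
def ramp (x : ℝ) : ℝ := x * Real.smoothTransition x

lemma contDiff_ramp : ContDiff ℝ ∞ ramp := contDiff_id.mul Real.smoothTransition.contDiff

lemma ramp_of_nonpos {x : ℝ} (hx : x ≤ 0) : ramp x = 0 := by
  rw [ramp, Real.smoothTransition.zero_of_nonpos hx, mul_zero]

lemma ramp_of_one_le {x : ℝ} (hx : 1 ≤ x) : ramp x = x := by
  rw [ramp, Real.smoothTransition.one_of_one_le hx, mul_one]

lemma hasDerivAt_ramp_of_neg {x : ℝ} (hx : x < 0) : HasDerivAt ramp 0 x :=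
  (hasDerivAt_const x (0 : ℝ)).congr_of_eventuallyEq
    ((eventually_lt_nhds hx).mono fun _ hy => ramp_of_nonpos hy.le)

lemma hasDerivAt_ramp_of_one_lt {x : ℝ} (hx : 1 < x) : HasDerivAt ramp 1 x :=
  (hasDerivAt_id x).congr_of_eventuallyEq
    ((eventually_gt_nhds hx).mono fun _ hy => ramp_of_one_le hy.le)

end Ramp

section Zones

/-- The middle hyperplane `zoneCoord = 0` of the `m`-th zone meets the `n`-th cell. -/
def Active (m : ℕ) (n : ℤ) : Prop := (m : ℝ) + 10 < 2 ^ m * level (n + 1)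

/-- The infimum over the `n`-th cell of the distance `zoneCoord (m + 1) - zoneCoord m` between
consecutive zones. -/
def gap (m : ℕ) (n : ℤ) : ℝ := 2 ^ m * level n - 1

lemma Active.succ {m : ℕ} {n : ℤ} (h : Active m n) : Active (m + 1) n := by
  unfold Active at *
  rw [pow_succ]
  push_cast
  linarith [Nat.cast_nonneg (α := ℝ) m]

lemma Active.mono {m m' : ℕ} {n : ℤ} (h : Active m n) (hm : m ≤ m') : Active m' n := by
  induction hm with
  | refl => exact h
  | step _ ih => exact ih.succ

lemma Active.lt_gap {m : ℕ} {n : ℤ} (h : Active m n) : 7 < gap m n := by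
  unfold Active at h
  unfold gap
  rw [level_succ] at h
  linarith [Nat.cast_nonneg (α := ℝ) m]

variable {d : ℕ} (i k : Fin d)

/-- An affine function that is constant along the lines of direction `κ` with `κ i = 2 ^ m κ k`, and
whose zero set is the middle of the `m`-th zone. Because of the summand `m`, such a line starting
in the `m`-th zone near the origin stays in its cell until `r_i` has grown by a multiple of `m`. -/
def zoneCoord (m : ℕ) (r : Fin d → ℝ) : ℝ := 2 ^ m * r k - (m + 10) - r i

lemma contDiff_zoneCoord (m : ℕ) : ContDiff ℝ ∞ (zoneCoord i k m) := by
  unfold zoneCoord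
  fun_prop

lemma continuous_zoneCoord (m : ℕ) : Continuous (zoneCoord i k m) :=
  (contDiff_zoneCoord i k m).continuous

lemma zoneCoord_succ (m : ℕ) (r : Fin d → ℝ) :
    zoneCoord i k (m + 1) r = zoneCoord i k m r + (2 ^ m * r k - 1) := by
  unfold zoneCoord
  push_cast
  ring

lemma zoneCoord_line {p : ℕ} {κ : Fin d → ℤ} (hκ : κ i = 2 ^ p * κ k) (m : ℕ) (r : Fin d → ℝ)
    (s : ℝ) : zoneCoord i k m (r + s • fun x => (κ x : ℝ)) =
      zoneCoord i k m r + s * ((2 ^ m - 2 ^ p) * κ k) := by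
  simp only [zoneCoord, Pi.add_apply, Pi.smul_apply, smul_eq_mul, hκ]
  push_cast
  ring

/-- The `m`-th zone, a neighbourhood of its middle hyperplane that overlaps the neighbouring
zones. The bound towards the zone `m - 1` is void in the cells that the latter does not meet; it is
written with `m' + 1 = m` to avoid a truncated subtraction. -/
def openZone (m : ℕ) : Set (Fin d → ℝ) :=
  {r | ∃ n, r ∈ cell k n ∧ Active m n ∧ -(7 / 10 * gap m n) < zoneCoord i k m r ∧
    ∀ m', m' + 1 = m → Active m' n → zoneCoord i k m r < 7 / 10 * gap m' n}

/-- The cores of the zones, which still cover `cellDomain k`. -/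
def closedZone (m : ℕ) : Set (Fin d → ℝ) :=
  {r | ∃ n, r ∈ cell k n ∧ Active m n ∧ -(13 / 20 * gap m n) ≤ zoneCoord i k m r ∧
    ∀ m', m' + 1 = m → Active m' n → zoneCoord i k m r ≤ 13 / 20 * gap m' n}

variable {i k}

lemma two_pow_mul_lt_of_mem_cell {m : ℕ} {n : ℤ} {r : Fin d → ℝ} (hr : r ∈ cell k n) :
    2 ^ m * r k < 2 ^ m * level (n + 1) := mul_lt_mul_of_pos_left hr.2.2 (by positivity)

lemma gap_lt_of_mem_cell {m : ℕ} {n : ℤ} {r : Fin d → ℝ} (hr : r ∈ cell k n) :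
    gap m n < 2 ^ m * r k - 1 := by
  have hlt : (2 : ℝ) ^ m * level n < 2 ^ m * r k := mul_lt_mul_of_pos_left hr.2.1 (by positivity)
  unfold gap
  linarith

lemma lt_gap_of_mem_cell {m : ℕ} {n : ℤ} {r : Fin d → ℝ} (hr : r ∈ cell k n) :
    2 ^ m * r k - 1 < 9 / 8 * gap m n + 1 / 8 := by
  have hlt := two_pow_mul_lt_of_mem_cell (m := m) hr
  rw [level_succ] at hlt
  unfold gap
  linarith

lemma zoneCoord_mono {m m' : ℕ} {n : ℤ} {r : Fin d → ℝ} (hr : r ∈ cell k n) (hm : Active m n)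
    (h : m ≤ m') : zoneCoord i k m r ≤ zoneCoord i k m' r := by
  induction m', h using Nat.le_induction with
  | base => exact le_rfl
  | succ m' h ih =>
    rw [zoneCoord_succ]
    linarith [gap_lt_of_mem_cell (m := m') hr, (hm.mono h).lt_gap]

lemma zoneCoord_neg_of_not_active {m : ℕ} {n : ℤ} {r : Fin d → ℝ} (hr : r ∈ cell k n)
    (hm : ¬ Active m n) : zoneCoord i k m r < 0 := by
  have hlt := two_pow_mul_lt_of_mem_cell (m := m) hr
  unfold Active at hm
  unfold zoneCoord
  linarith [hr.1 i]

lemma one_lt_zoneCoord {p m : ℕ} {r : Fin d → ℝ} (hr : r ∈ openZone i k p) (h : p < m) :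
    1 < zoneCoord i k m r := by
  obtain ⟨n, hn, hact, hlow, -⟩ := hr
  have hmono := zoneCoord_mono (i := i) hn hact.succ h
  rw [zoneCoord_succ] at hmono
  linarith [gap_lt_of_mem_cell (m := p) hn, hact.lt_gap]

lemma zoneCoord_neg {p m : ℕ} {r : Fin d → ℝ} (hr : r ∈ openZone i k p) (h : m < p) :
    zoneCoord i k m r < 0 := by
  obtain ⟨n, hn, -, -, hup⟩ := hr
  by_cases hact : Active m n
  · obtain ⟨p, rfl⟩ : ∃ q, p = q + 1 := ⟨p - 1, by omega⟩
    have hp : Active p n := hact.mono (by omega)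
    have hsucc := hup p rfl hp
    rw [zoneCoord_succ] at hsucc
    have hmono := zoneCoord_mono (i := i) hn hact (show m ≤ p by omega)
    linarith [gap_lt_of_mem_cell (m := p) hn, hp.lt_gap]
  · exact zoneCoord_neg_of_not_active hn hact

lemma closedZone_subset (m : ℕ) : closedZone i k m ⊆ openZone i k m := by
  rintro r ⟨n, hn, hact, hlow, hup⟩
  refine ⟨n, hn, hact, by linarith [hact.lt_gap], fun m' hm' hact' => ?_⟩
  linarith [hup m' hm' hact', hact'.lt_gap]

lemma openZone_subset (m : ℕ) : openZone i k m ⊆ cellDomain k := by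
  rintro r ⟨n, hn, -⟩
  exact cell_subset n hn

lemma isOpen_openZone (m : ℕ) : IsOpen (openZone i k m) := by
  have hunion : openZone i k m = ⋃ n, cell k n ∩ ({_r | Active m n} ∩
      ({r | -(7 / 10 * gap m n) < zoneCoord i k m r} ∩
        {r | ∀ m', m' + 1 = m → Active m' n → zoneCoord i k m r < 7 / 10 * gap m' n})) := by
    ext r
    simp only [openZone, Set.mem_iUnion, Set.mem_inter_iff, Set.mem_ofPred_eq]
  rw [hunion]
  refine isOpen_iUnion fun n => (isOpen_cell n).inter (isOpen_const.inter
    ((isOpen_lt continuous_const (continuous_zoneCoord i k m)).inter ?_))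
  rcases m with _ | m
  · simp
  · by_cases h : Active m n
    · simpa [h] using isOpen_lt (continuous_zoneCoord i k (m + 1)) continuous_const
    · simp [h]

lemma isCompact_closedZone_inter (m : ℕ) {K : Set (Fin d → ℝ)} (hK : IsCompact K)
    (hKD : K ⊆ cellDomain k) : IsCompact (closedZone i k m ∩ K) := by
  let F : ℤ → Set (Fin d → ℝ) := fun n => {_r | Active m n} ∩
      ({r | -(13 / 20 * gap m n) ≤ zoneCoord i k m r} ∩
        {r | ∀ m', m' + 1 = m → Active m' n → zoneCoord i k m r ≤ 13 / 20 * gap m' n})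
  have hF : ∀ n, IsClosed (F n) := fun n => by
    refine isClosed_const.inter ((isClosed_le continuous_const
      (continuous_zoneCoord i k m)).inter ?_)
    simp only [Set.ofPred_forall]
    exact isClosed_iInter fun m' => isClosed_iInter fun _ => isClosed_iInter fun _ =>
      isClosed_le (continuous_zoneCoord i k m) continuous_const
  have hdiff : closedZone i k m ∩ K = K \ ⋃ n, cell k n \ F n := by
    ext r
    constructor
    · rintro ⟨⟨n, hn, hr⟩, hrK⟩
      refine ⟨hrK, fun hr' => ?_⟩
      obtain ⟨n', hn', hF'⟩ := Set.mem_iUnion.1 hr'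
      rw [← cell_unique hn hn'] at hF'
      exact hF' hr
    · rintro ⟨hrK, hr⟩
      obtain ⟨n, hn⟩ := exists_mem_cell (hKD hrK)
      refine ⟨⟨n, hn, ?_⟩, hrK⟩
      by_contra h
      exact hr (Set.mem_iUnion.2 ⟨n, hn, h⟩)
  rw [hdiff]
  exact hK.diff (isOpen_iUnion fun n => (isOpen_cell n).sdiff (hF n))

lemma exists_add_lt_two_pow {δ : ℝ} (hδ : 0 < δ) (R : ℝ) :
    ∃ M : ℕ, ∀ m ≥ M, (m : ℝ) + R < 2 ^ m * δ := by
  have hid : Tendsto (fun m : ℕ => (m : ℝ) / 2 ^ m) atTop (𝓝 0) := by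
    simpa using tendsto_pow_const_div_const_pow_of_one_lt 1 (show (1 : ℝ) < 2 by norm_num)
  have hconst : Tendsto (fun m : ℕ => R / (2 : ℝ) ^ m) atTop (𝓝 0) :=
    tendsto_const_nhds.div_atTop (tendsto_pow_atTop_atTop_of_one_lt (by norm_num))
  have hadd := hid.add hconst
  rw [add_zero] at hadd
  obtain ⟨M, hM⟩ := eventually_atTop.1 (hadd.eventually (eventually_lt_nhds hδ))
  refine ⟨M, fun m hm => ?_⟩
  have hlt := hM m hm
  rw [← add_div, div_lt_iff₀ (by positivity)] at hlt
  linarith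

lemma exists_active_and_le_zoneCoord {r : Fin d → ℝ} {n : ℤ} (hr : r ∈ cell k n) :
    ∃ m, Active m n ∧ -(13 / 20 * gap m n) ≤ zoneCoord i k m r := by
  obtain ⟨m, hm⟩ := exists_add_lt_two_pow (hr.1 k) (10 + r i)
  have hlt := hm m le_rfl
  have hact : Active m n := by
    unfold Active
    linarith [hr.1 i, two_pow_mul_lt_of_mem_cell (m := m) hr]
  refine ⟨m, hact, ?_⟩
  have hgap := hact.lt_gap
  unfold zoneCoord
  linarith

-- The first zone whose lower bound is satisfied works.
lemma exists_mem_closedZone {r : Fin d → ℝ} (hr : r ∈ cellDomain k) :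
    ∃ m, r ∈ closedZone i k m := by
  classical
  obtain ⟨n, hn⟩ := exists_mem_cell hr
  have hex := exists_active_and_le_zoneCoord (i := i) hn
  obtain ⟨hact, hlow⟩ := Nat.find_spec hex
  refine ⟨Nat.find hex, n, hn, hact, hlow, fun m' hm' hact' => ?_⟩
  have hlt : zoneCoord i k m' r < -(13 / 20 * gap m' n) :=
    not_le.1 fun hle => Nat.find_min hex (show m' < Nat.find hex by omega) ⟨hact', hle⟩
  rw [← hm', zoneCoord_succ]
  linarith [lt_gap_of_mem_cell (m := m') hn, hact'.lt_gap]

lemma disjoint_openZone {m m' : ℕ} (h : m + 2 ≤ m') :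
    Disjoint (openZone i k m) (openZone i k m') := by
  refine Set.disjoint_left.2 fun r hr hr' => ?_
  linarith [one_lt_zoneCoord hr (show m < m + 1 by omega),
    zoneCoord_neg hr' (show m + 1 < m' by omega)]

lemma exists_bound_closedZone {K : Set (Fin d → ℝ)} (hK : IsCompact K) (hKD : K ⊆ cellDomain k) :
    ∃ M, ∀ m, (closedZone i k m ∩ K).Nonempty → m < M := by
  obtain ⟨j, hj⟩ := exists_subset_cellExhaustion hK hKD
  obtain ⟨M, hM⟩ := exists_add_lt_two_pow (show 0 < ((j : ℝ) + 1)⁻¹ by positivity)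
    (10 + ((j : ℝ) + 1))
  refine ⟨M + 1, fun m ⟨r, hr, hrK⟩ => ?_⟩
  by_contra h
  have hlarge := hM (m - 1) (by omega)
  have hneg := zoneCoord_neg (closedZone_subset m hr) (show m - 1 < m by omega)
  have hIcc := (hj hrK).1
  have hk := mul_le_mul_of_nonneg_left (hIcc k).1 (show (0 : ℝ) ≤ 2 ^ (m - 1) by positivity)
  unfold zoneCoord at hneg
  linarith [(hIcc i).2]

lemma lineInvariant_closedZone {m : ℕ} {κ : Fin d → ℤ} (hκ : κ i = 2 ^ m * κ k) :
    LineInvariant (cellDomain k) κ (closedZone i k m) := by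
  rintro ρ ⟨n, hn, h⟩ t ht
  refine ⟨n, mem_cell_of_lineIn ht hn, ?_⟩
  rw [zoneCoord_line i k hκ, sub_self, zero_mul, mul_zero, add_zero]
  exact h

end Zones

section ZoneHamiltonians

variable {d : ℕ} (i k : Fin d)

/-- The elementary perturbation. Along the lines of direction `κ` of the `p`-th zone its slope is
`κ k` if `p ≤ m`, and `0` if `m < p`. -/
def zoneStep (m : ℕ) (r : Fin d → ℝ) : ℝ :=
  (ramp (zoneCoord i k (m + 1) r) - ramp (zoneCoord i k m r)) / 2 ^ m

lemma contDiff_zoneStep (m : ℕ) : ContDiff ℝ ∞ (zoneStep i k m) :=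
  ((contDiff_ramp.comp (contDiff_zoneCoord i k (m + 1))).sub
    (contDiff_ramp.comp (contDiff_zoneCoord i k m))).div_const _

lemma zoneStep_eventually_eq_zero (m : ℕ) : ∀ᶠ r in 𝓝 0, zoneStep i k m r = 0 := by
  have hramp (m : ℕ) : ∀ᶠ r in 𝓝 0, ramp (zoneCoord i k m r) = 0 := by
    have hneg : zoneCoord i k m 0 < 0 := by
      simp only [zoneCoord, Pi.zero_apply]
      linarith [Nat.cast_nonneg (α := ℝ) m]
    exact ((continuous_zoneCoord i k m).tendsto 0).eventually (eventually_lt_nhds hneg) |>.mono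
      fun r hr => ramp_of_nonpos hr.le
  filter_upwards [hramp m, hramp (m + 1)] with r hm hsucc
  rw [zoneStep, hm, hsucc, sub_zero, zero_div]

variable {i k}

lemma hasDerivAt_ramp_zoneCoord {p : ℕ} {κ : Fin d → ℤ} (hκ : κ i = 2 ^ p * κ k) {r : Fin d → ℝ}
    (hr : r ∈ openZone i k p) (m : ℕ) :
    HasDerivAt (fun s : ℝ => ramp (zoneCoord i k m (r + s • fun x => (κ x : ℝ))))
      (if p ≤ m then (2 ^ m - 2 ^ p) * κ k else 0) 0 := by
  simp only [zoneCoord_line i k hκ]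
  have hcoord : HasDerivAt (fun s : ℝ => zoneCoord i k m r + s * ((2 ^ m - 2 ^ p) * κ k))
      ((2 ^ m - 2 ^ p) * κ k) 0 := by
    simpa using ((hasDerivAt_id (0 : ℝ)).mul_const (((2 : ℝ) ^ m - 2 ^ p) * κ k)).const_add
      (zoneCoord i k m r)
  have hzero : zoneCoord i k m r + 0 * ((2 ^ m - 2 ^ p) * κ k) = zoneCoord i k m r := by ring
  rcases lt_trichotomy m p with h | h | h
  · rw [if_neg (by omega)]
    have hramp := hasDerivAt_ramp_of_neg (zoneCoord_neg hr h)
    rw [← hzero] at hramp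
    simpa [Function.comp_def] using hramp.comp 0 hcoord
  · subst h
    simpa using hasDerivAt_const (0 : ℝ) (ramp (zoneCoord i k m r))
  · rw [if_pos h.le]
    have hramp := hasDerivAt_ramp_of_one_lt (one_lt_zoneCoord hr h)
    rw [← hzero] at hramp
    simpa [Function.comp_def] using hramp.comp 0 hcoord

lemma sum_mul_grad_zoneStep {p : ℕ} {κ : Fin d → ℤ} (hκ : κ i = 2 ^ p * κ k) {r : Fin d → ℝ}
    (hr : r ∈ openZone i k p) (m : ℕ) :
    ∑ x, κ x * grad (zoneStep i k m) r x = if p ≤ m then (κ k : ℝ) else 0 := by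
  refine sum_mul_grad_eq (v := fun x => (κ x : ℝ))
    ((contDiff_zoneStep i k m).differentiable (by simp)).differentiableAt ?_
  have hval : (if p ≤ m then (κ k : ℝ) else 0) =
      ((if p ≤ m + 1 then (2 ^ (m + 1) - 2 ^ p) * (κ k : ℝ) else 0) -
        if p ≤ m then (2 ^ m - 2 ^ p) * (κ k : ℝ) else 0) / 2 ^ m := by
    rcases Nat.lt_or_ge m p with h | h
    · rcases Nat.lt_or_ge (m + 1) p with h' | h'
      · simp [h.not_ge, h'.not_ge]
      · obtain rfl : p = m + 1 := by omega
        simp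
    · rw [if_pos h, if_pos (by omega), if_pos h, pow_succ]
      field_simp
      ring
  rw [hval]
  exact ((hasDerivAt_ramp_zoneCoord hκ hr (m + 1)).sub
    (hasDerivAt_ramp_zoneCoord hκ hr m)).div_const ((2 : ℝ) ^ m)

variable (i k)

/-- The Hamiltonians from which the resonances are made. The coefficients are differences so that,
by telescoping, `T m` is the shift of the frequency `ω_k` that is felt along the lines of the `m`-th
zone. -/
def zoneHam (ω₀ : Fin d → ℝ) (N : ℕ) (T : ℕ → ℝ) (r : Fin d → ℝ) : ℝ :=
  ∑ x, ω₀ x * r x + ∑ m ∈ Finset.range N, (T m - T (m + 1)) * zoneStep i k m r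

variable {i k} {ω₀ : Fin d → ℝ}

lemma zoneHam_eq_perturbed (N : ℕ) (T : ℕ → ℝ) :
    zoneHam i k ω₀ N T = perturbed (fun r => ∑ x, ω₀ x * r x)
      (fun m : Fin N => zoneStep i k m) (fun m => T m - T (m + 1)) := by
  funext r
  rw [zoneHam, perturbed, Fin.sum_univ_eq_sum_range
    (fun m => (T m - T (m + 1)) * zoneStep i k m r) N]

lemma contDiff_zoneHam (N : ℕ) (T : ℕ → ℝ) : ContDiff ℝ ∞ (zoneHam i k ω₀ N T) := by
  rw [zoneHam_eq_perturbed]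
  exact contDiff_perturbed (by fun_prop) (fun m : Fin N => contDiff_zoneStep i k m) _

lemma zoneHam_of_le {N N' : ℕ} {T : ℕ → ℝ} (hT : ∀ m ≥ N, T m = 0) (hN : N ≤ N') :
    zoneHam i k ω₀ N T = zoneHam i k ω₀ N' T := by
  funext r
  rw [zoneHam, zoneHam]
  congr 1
  refine Finset.sum_subset (Finset.range_mono hN) fun m _ hm => ?_
  rw [Finset.mem_range, not_lt] at hm
  rw [hT m hm, hT (m + 1) (by omega), sub_self, zero_mul]

lemma sum_range_sub_ite (T : ℕ → ℝ) (p N : ℕ) :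
    ∑ m ∈ Finset.range N, (if p ≤ m then T m - T (m + 1) else 0) =
      if p ≤ N then T p - T N else 0 := by
  induction N with
  | zero =>
    split_ifs with h
    · obtain rfl : p = 0 := by omega
      simp
    · simp
  | succ N ih =>
    rw [Finset.sum_range_succ, ih]
    rcases lt_trichotomy p (N + 1) with h | h | h
    · rw [if_pos (by omega), if_pos (by omega), if_pos h.le]
      ring
    · subst h
      simp
    · rw [if_neg (by omega), if_neg (by omega), if_neg (by omega), add_zero]

lemma sum_mul_grad_zoneHam {N : ℕ} {T : ℕ → ℝ} (hT : ∀ m ≥ N, T m = 0) {p : ℕ}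
    {κ : Fin d → ℤ} (hκ : κ i = 2 ^ p * κ k) {r : Fin d → ℝ} (hr : r ∈ openZone i k p) :
    ∑ x, κ x * grad (zoneHam i k ω₀ N T) r x = ∑ x, κ x * ω₀ x + κ k * T p := by
  have hterm (m : ℕ) : (T m - T (m + 1)) * ∑ x, κ x * grad (zoneStep i k m) r x =
      κ k * (if p ≤ m then T m - T (m + 1) else 0) := by
    rw [sum_mul_grad_zoneStep hκ hr]
    split_ifs <;> ring
  have hTp : (if p ≤ N then T p - T N else 0) = T p := by
    split_ifs with hpN
    · rw [hT N le_rfl, sub_zero]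
    · exact (hT p (by omega)).symm
  rw [zoneHam_eq_perturbed, sum_mul_grad_perturbed (v := fun x => (κ x : ℝ)) (by fun_prop)
    (fun m => (contDiff_zoneStep i k m).differentiable (by simp)),
    sum_mul_grad_linear (v := fun x => (κ x : ℝ))]
  simp only [hterm]
  rw [← Finset.mul_sum, Fin.sum_univ_eq_sum_range
    (fun m => if p ≤ m then T m - T (m + 1) else 0) N, sum_range_sub_ite, hTp]

/-- The sequences of shifts that occur in the construction. The bound keeps the direction of the
resonances under control. -/
structure IsShift (N : ℕ) (T : ℕ → ℝ) : Prop where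
  abs_lt_one : ∀ m, |T m| < 1
  eq_zero : ∀ m ≥ N, T m = 0

lemma IsShift.mono {N N' : ℕ} {T : ℕ → ℝ} (hT : IsShift N T) (hN : N ≤ N') : IsShift N' T :=
  ⟨hT.abs_lt_one, fun m hm => hT.eq_zero m (hN.trans hm)⟩

lemma exists_resonant_shift {a w t η : ℝ} (hw : w ≠ 0) (ht : |t| < 1) (hη : 0 < η) :
    ∃ t', |t' - t| < η ∧ |t'| < 1 ∧ t' ≠ t ∧ ∃ q : ℚ, w * q = a + t' := by
  obtain ⟨htlow, hthigh⟩ := abs_lt.1 ht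
  have hlt : t < min (t + η) 1 := lt_min (by linarith) hthigh
  have hsurj : Function.Surjective fun x : ℝ => w * x - a := fun y =>
    ⟨(y + a) / w, by simp only [mul_div_cancel₀ _ hw, add_sub_cancel_right]⟩
  obtain ⟨q, hqlow, hqhigh⟩ := (hsurj.denseRange.comp (Rat.denseRange_cast (𝕜 := ℝ))
    (by fun_prop)).exists_mem_open isOpen_Ioo (Set.nonempty_Ioo.2 hlt)
  simp only [Function.comp_apply, lt_min_iff] at hqlow hqhigh
  refine ⟨w * q - a, ?_, ?_, hqlow.ne', q, by ring⟩
  · rw [abs_lt]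
    constructor <;> linarith [hqhigh.1]
  · rw [abs_lt]
    constructor <;> linarith [hqhigh.2]

lemma IsShift.exists_resonant {w : ℝ} (hw : w ≠ 0) (a : ℕ → ℝ) {N : ℕ} {T : ℕ → ℝ}
    (hT : IsShift N T) {η : ℝ} (hη : 0 < η) :
    ∃ T', IsShift N T' ∧ (∀ m, |T' m - T m| < η) ∧
      ∀ m < N, T' m ≠ T m ∧ ∃ q : ℚ, w * q = a m + T' m := by
  choose T' hdist hlt hne hres using fun m =>
    exists_resonant_shift (a := a m) hw (hT.abs_lt_one m) hη
  refine ⟨fun m => if m < N then T' m else 0, ⟨fun m => ?_, fun m hm => if_neg hm.not_gt⟩,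
    fun m => ?_, fun m hm => ?_⟩
  · by_cases hm : m < N
    · simp only [if_pos hm, hlt]
    · simp [if_neg hm]
  · by_cases hm : m < N
    · simp only [if_pos hm, hdist]
    · simpa only [if_neg hm, hT.eq_zero m (not_lt.1 hm), sub_zero, abs_zero]
  · simp only [if_pos hm]
    exact ⟨hne m, hres m⟩

end ZoneHamiltonians

section Resonant

variable {d : ℕ} {i j k : Fin d} {ω₀ : Fin d → ℝ} {m N : ℕ} {T : ℕ → ℝ}

variable (i j k ω₀ m) in
/-- The integer directions that are used in the `m`-th zone. They are nonnegative if `ω_i` and `ω_j`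
have opposite signs and `2 ^ m ω_i` dominates `ω_k`, so that the orbits can drift away from `0`. -/
def zoneDir : Set (Fin d → ℤ) :=
  {κ | 0 < κ k ∧ κ i = 2 ^ m * κ k ∧
    (ω₀ i * ω₀ j < 0 → |ω₀ k| + 1 ≤ 2 ^ m * |ω₀ i| → ∀ x, 0 ≤ κ x)}

variable (i j k m) in
/-- The element of `zoneDir` that annihilates the frequencies when `q ω_j = 2 ^ m ω_i + ω_k`, up to
the shift of `ω_k`. -/
def resonance (q : ℚ) : Fin d → ℤ :=
  Pi.single k (q.den : ℤ) + Pi.single i (2 ^ m * (q.den : ℤ)) - Pi.single j q.num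

lemma sum_resonance_mul (q : ℚ) (f : Fin d → ℝ) :
    ∑ x, resonance i j k m q x * f x = q.den * f k + 2 ^ m * q.den * f i - q.num * f j := by
  simp [resonance, Pi.single_apply, sub_mul, add_mul, Finset.sum_add_distrib]

-- If `a` and `b` have opposite signs, then so do `b` and `2 ^ m * a + c + t`, in which the first
-- summand dominates.
lemma nonpos_of_mul_eq_two_pow_mul_add {a b c t : ℝ} {q : ℚ} (hab : a * b < 0) (ht : |t| < 1)
    (hm : |c| + 1 ≤ 2 ^ m * |a|) (hq : b * q = 2 ^ m * a + c + t) : q ≤ 0 := by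
  obtain ⟨htlow, hthigh⟩ := abs_lt.1 ht
  by_contra hpos
  have hq0 : (0 : ℝ) < q := by exact_mod_cast not_le.1 hpos
  rcases mul_neg_iff.1 hab with ⟨ha, hb⟩ | ⟨ha, hb⟩
  · rw [abs_of_pos ha] at hm
    linarith [mul_neg_of_neg_of_pos hb hq0, neg_abs_le c]
  · rw [abs_of_neg ha] at hm
    linarith [mul_pos hb hq0, le_abs_self c]

lemma resonance_mem_zoneDir (hij : i ≠ j) (hik : i ≠ k) (hjk : j ≠ k) {t : ℝ} {q : ℚ}
    (ht : |t| < 1) (hq : ω₀ j * q = 2 ^ m * ω₀ i + ω₀ k + t) :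
    resonance i j k m q ∈ zoneDir i j k ω₀ m := by
  have hk : resonance i j k m q k = q.den := by simp [resonance, hik.symm, hjk.symm]
  refine ⟨?_, ?_, fun hneg hdom => ?_⟩
  · rw [hk]
    exact_mod_cast q.den_pos
  · rw [hk]
    simp [resonance, hij, hik]
  · have hnum : q.num ≤ 0 := Rat.num_nonpos.2 (nonpos_of_mul_eq_two_pow_mul_add hneg ht hdom hq)
    have hsingle : (0 : Fin d → ℤ) ≤ Pi.single j (-q.num) := Pi.single_nonneg.2 (by omega)
    rw [resonance, sub_eq_add_neg, ← Pi.single_neg]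
    exact add_nonneg (add_nonneg (Pi.single_nonneg.2 (by positivity))
      (Pi.single_nonneg.2 (by positivity))) hsingle

lemma isResonantOn_resonance_zoneHam (hij : i ≠ j) (hik : i ≠ k) (hjk : j ≠ k) (hT : IsShift N T)
    {q : ℚ} (hq : ω₀ j * q = 2 ^ m * ω₀ i + ω₀ k + T m) :
    IsResonantOn (resonance i j k m q) (zoneHam i k ω₀ N T) (openZone i k m) := by
  intro r hr
  have hk : resonance i j k m q k = q.den := by simp [resonance, hik.symm, hjk.symm]
  have hden : (q : ℝ) * q.den = q.num := by exact_mod_cast Rat.mul_den_eq_num q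
  rw [sum_mul_grad_zoneHam hT.eq_zero
    (resonance_mem_zoneDir hij hik hjk (hT.abs_lt_one m) hq).2.1 hr, sum_resonance_mul, hk]
  push_cast
  linear_combination ω₀ j * hden - q.den * hq

lemma sum_mul_grad_zoneHam_ne_zero {T' : ℕ → ℝ} {κ : Fin d → ℤ} (hT : IsShift N T)
    (hT' : IsShift N T') (hne : T' m ≠ T m) (hκ : κ ∈ zoneDir i j k ω₀ m) {r : Fin d → ℝ}
    (hr : r ∈ openZone i k m) (hres : ∑ x, κ x * grad (zoneHam i k ω₀ N T) r x = 0) :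
    ∑ x, κ x * grad (zoneHam i k ω₀ N T') r x ≠ 0 := by
  rw [sum_mul_grad_zoneHam hT.eq_zero hκ.2.1 hr] at hres
  rw [sum_mul_grad_zoneHam hT'.eq_zero hκ.2.1 hr]
  have hdiff : ∑ x, (κ x : ℝ) * ω₀ x + κ k * T' m = κ k * (T' m - T m) := by
    linear_combination hres
  rw [hdiff]
  exact mul_ne_zero (by exact_mod_cast hκ.1.ne') (sub_ne_zero.2 hne)

lemma perturbed_zoneHam (N : ℕ) (T T' : ℕ → ℝ) :
    perturbed (zoneHam i k ω₀ N T) (fun m : Fin N => zoneStep i k m)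
      (fun m => (T' m - T m) - (T' (m + 1) - T (m + 1))) = zoneHam i k ω₀ N T' := by
  funext r
  rw [zoneHam_eq_perturbed, zoneHam_eq_perturbed]
  simp only [perturbed]
  rw [add_assoc, ← Finset.sum_add_distrib]
  congr 1
  exact Finset.sum_congr rfl fun m _ => by ring

variable (i k ω₀) in
/-- The integrable Hamiltonians that occur in the construction. -/
def IsZoneHam (h : (Fin d → ℝ) → ℝ) : Prop := ∃ N T, IsShift N T ∧ h = zoneHam i k ω₀ N T

lemma IsZoneHam.exists_le {h : (Fin d → ℝ) → ℝ} (hh : IsZoneHam i k ω₀ h) (M : ℕ) :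
    ∃ N ≥ M, ∃ T, IsShift N T ∧ h = zoneHam i k ω₀ N T := by
  obtain ⟨N, T, hT, rfl⟩ := hh
  exact ⟨max M N, le_max_left _ _, T, hT.mono (le_max_right _ _),
    zoneHam_of_le hT.eq_zero (le_max_right _ _)⟩

lemma hasSmallPerturbation_zoneHam (hω : ω₀ j ≠ 0) (hT : IsShift N T)
    {P : ((Fin d → ℝ) → ℝ) → Prop}
    (hP : ∀ T', IsShift N T' →
      (∀ m < N, T' m ≠ T m ∧ ∃ q : ℚ, ω₀ j * q = 2 ^ m * ω₀ i + ω₀ k + T' m) →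
      P (zoneHam i k ω₀ N T')) :
    HasSmallPerturbation (IsZoneHam i k ω₀) P (zoneHam i k ω₀ N T) := by
  refine ⟨N, fun m => zoneStep i k m, fun m => contDiff_zoneStep i k m, fun m => ?_,
    fun η hη => ?_⟩
  · exact (Asymptotics.isBigO_zero _ _).congr'
      ((zoneStep_eventually_eq_zero i k m).mono fun r hr => hr.symm) EventuallyEq.rfl
  obtain ⟨T', hT', hdist, hres⟩ := hT.exists_resonant hω (fun m => 2 ^ m * ω₀ i + ω₀ k)
    (half_pos hη)
  refine ⟨fun m => (T' m - T m) - (T' (m + 1) - T (m + 1)), ?_, ?_⟩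
  · rw [pi_norm_lt_iff hη]
    intro m
    rw [Real.norm_eq_abs]
    exact (abs_sub _ _).trans_lt (by linarith [hdist m, hdist (m + 1)])
  · rw [perturbed_zoneHam]
    exact ⟨⟨N, T', hT', rfl⟩, hP T' hT' hres⟩

lemma hasSmallPerturbation_isResonantOn (hij : i ≠ j) (hik : i ≠ k) (hjk : j ≠ k) (hω : ω₀ j ≠ 0)
    {h : (Fin d → ℝ) → ℝ} (hh : IsZoneHam i k ω₀ h) (M : ℕ) :
    HasSmallPerturbation (IsZoneHam i k ω₀) (fun h' => ∃ κ : ℕ → Fin d → ℤ, ∀ m < M,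
      κ m ∈ zoneDir i j k ω₀ m ∧ IsResonantOn (κ m) h' (openZone i k m)) h := by
  obtain ⟨N, hMN, T, hT, rfl⟩ := hh.exists_le M
  refine hasSmallPerturbation_zoneHam hω hT fun T' hT' hres => ?_
  choose! q hq using fun m hm => (hres m hm).2
  exact ⟨fun m => resonance i j k m (q m), fun m hm =>
    ⟨resonance_mem_zoneDir hij hik hjk (hT'.abs_lt_one m) (hq m (hm.trans_le hMN)),
      isResonantOn_resonance_zoneHam hij hik hjk hT' (hq m (hm.trans_le hMN))⟩⟩

lemma hasSmallPerturbation_sum_mul_grad_ne_zero (hω : ω₀ j ≠ 0) {h : (Fin d → ℝ) → ℝ}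
    (hh : IsZoneHam i k ω₀ h) (M : ℕ) {κ : ℕ → Fin d → ℤ}
    (hκ : ∀ m < M, κ m ∈ zoneDir i j k ω₀ m ∧ IsResonantOn (κ m) h (openZone i k m)) :
    HasSmallPerturbation (IsZoneHam i k ω₀)
      (fun h' => ∀ m < M, ∀ r ∈ closedZone i k m, ∑ x, κ m x * grad h' r x ≠ 0) h := by
  obtain ⟨N, hMN, T, hT, rfl⟩ := hh.exists_le M
  refine hasSmallPerturbation_zoneHam hω hT fun T' hT' hres m hm r hr => ?_
  have hrO := closedZone_subset m hr
  exact sum_mul_grad_zoneHam_ne_zero hT hT' (hres m (hm.trans_le hMN)).1 (hκ m hm).1 hrO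
    ((hκ m hm).2 r hrO)

variable (i k) in
/-- The zone system for a frequency vector with `ω₀ j ≠ 0`. -/
def resonantZones (hij : i ≠ j) (hik : i ≠ k) (hjk : j ≠ k) (hω : ω₀ j ≠ 0) : ZoneSystem d where
  D := cellDomain k
  pos r hr := hr.1
  zero_notMem h := lt_irrefl _ (h.1 k)
  Q := cellExhaustion k
  isCompact_Q := isCompact_cellExhaustion
  Q_subset := cellExhaustion_subset
  monotone_Q := monotone_cellExhaustion
  exists_subset_Q _ hK hKD := exists_subset_cellExhaustion hK hKD
  lineIn_Q _ _ _ _ := lineIn_cellExhaustion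
  O := openZone i k
  C := closedZone i k
  isOpen_O := isOpen_openZone
  O_subset := openZone_subset
  C_subset := closedZone_subset
  isCompact_C_inter m _ hK hKD := isCompact_closedZone_inter m hK hKD
  cover _ hr := exists_mem_closedZone hr
  disjoint_O m m' hne hmod := by
    rcases lt_or_gt_of_ne hne with hlt | hgt
    · exact disjoint_openZone (by omega)
    · exact (disjoint_openZone (by omega)).symm
  finite_C _ hK hKD := exists_bound_closedZone hK hKD
  dir := zoneDir i j k ω₀
  dir_ne m κ hκ h := hκ.1.ne' (by rw [h]; rfl)
  inv_C m κ hκ := lineInvariant_closedZone hκ.2.1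
  Adm := IsZoneHam i k ω₀
  contDiff_of_adm h := by
    rintro ⟨N, T, -, rfl⟩
    exact contDiff_zoneHam N T
  resonate _ hh M := hasSmallPerturbation_isResonantOn hij hik hjk hω hh M
  detune _ hh M _ hκ := hasSmallPerturbation_sum_mul_grad_ne_zero hω hh M hκ

end Resonant

section Drift

variable {d : ℕ} {i j k : Fin d} {m : ℕ} {n : ℤ} {A : ℝ}

lemma exists_level_active (m : ℕ) : ∃ n, 2 ^ m * level n ≤ m + 10 ∧ Active m n := by
  have hpow : (0 : ℝ) < 2 ^ m := by positivity
  obtain ⟨n, hlow, hhigh⟩ := exists_level_le (show 0 < ((m : ℝ) + 10) / 2 ^ m by positivity)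
  rw [le_div_iff₀ hpow] at hlow
  rw [div_lt_iff₀ hpow] at hhigh
  refine ⟨n, by linarith, ?_⟩
  unfold Active
  linarith

lemma not_active_of_two_pow_succ_mul_level_le (hn : 2 ^ (m + 1) * level n ≤ (m + 1 : ℕ) + 10) :
    ¬ Active m n := fun hact => by
  unfold Active at hact
  rw [pow_succ] at hn
  rw [level_succ] at hact
  push_cast at hn
  linarith [Nat.cast_nonneg (α := ℝ) m]

variable (k n) in
/-- A point of the `n`-th cell near its corner, from which the orbits drift to infinity. -/
def driftPoint (x : Fin d) : ℝ := if x = k then 17 / 16 * level n else level n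

lemma driftPoint_self : driftPoint k n k = 17 / 16 * level n := if_pos rfl

lemma driftPoint_of_ne {x : Fin d} (hx : x ≠ k) : driftPoint k n x = level n := if_neg hx

lemma driftPoint_mem_cell : driftPoint k n ∈ cell k n := by
  have hpos := level_pos n
  refine ⟨fun x => ?_, ?_, ?_⟩
  · unfold driftPoint
    split_ifs <;> positivity
  · rw [driftPoint_self]
    linarith
  · rw [driftPoint_self, level_succ]
    linarith

lemma sum_driftPoint_le : ∑ x, driftPoint k n x ≤ 17 / 16 * d * level n := by
  have hle (x : Fin d) : driftPoint k n x ≤ 17 / 16 * level n := by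
    unfold driftPoint
    split_ifs <;> linarith [level_pos n]
  calc ∑ x, driftPoint k n x ≤ ∑ _x : Fin d, 17 / 16 * level n := Finset.sum_le_sum fun x _ => hle x
    _ = 17 / 16 * d * level n := by
      rw [Finset.sum_const, Finset.card_univ, Fintype.card_fin, nsmul_eq_mul]
      ring

lemma driftPoint_mem_closedZone (hik : i ≠ k) (hact : Active m n)
    (hn : 2 ^ m * level n ≤ m + 10) (hle : level n ≤ 1) : driftPoint k n ∈ closedZone i k m := by
  refine ⟨n, driftPoint_mem_cell, hact, ?_, fun m' hm' hact' => ?_⟩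
  · have hgap : (m : ℝ) + 10 < 2 ^ m * level (n + 1) := hact
    rw [level_succ] at hgap
    simp only [zoneCoord, driftPoint_self, driftPoint_of_ne hik, gap]
    linarith [Nat.cast_nonneg (α := ℝ) m]
  · subst hm'
    exact absurd hact' (not_active_of_two_pow_succ_mul_level_le hn)

variable (k m n A) in
/-- The box in which the lines from `driftPoint k n` stay until the sum of the actions reaches
`A ^ 2`. -/
def driftBox : Set (Fin d → ℝ) :=
  Set.Icc (driftPoint k n)
    (fun x => if x = k then driftPoint k n k + A ^ 2 / 2 ^ m else A ^ 2)

lemma driftBox_subset_cell (hact : Active m n) (hm : 18 * A ^ 2 < m) :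
    driftBox k m n A ⊆ cell k n := by
  intro r hr
  have hpow : (0 : ℝ) < 2 ^ m := by positivity
  have hgap : (m : ℝ) + 10 < 2 ^ m * level (n + 1) := hact
  have hsmall : A ^ 2 / 2 ^ m < level n / 16 := by
    rw [level_succ] at hgap
    rw [div_lt_iff₀ hpow]
    linarith
  refine ⟨fun x => (driftPoint_mem_cell.1 x).trans_le (hr.1 x),
    driftPoint_mem_cell.2.1.trans_le (hr.1 k), (hr.2 k).trans_lt ?_⟩
  change (if k = k then _ else _) < _
  rw [if_pos rfl, driftPoint_self, level_succ]
  linarith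

lemma add_smul_mem_driftBox {κ : Fin d → ℤ} (hik : i ≠ k) (hκ : ∀ x, 0 ≤ κ x)
    (hκi : κ i = 2 ^ m * κ k) {t : ℝ} (ht : 0 ≤ t)
    (hsum : ∑ x, (driftPoint k n + t • (fun x => (κ x : ℝ))) x < A ^ 2) :
    driftPoint k n + t • (fun x => (κ x : ℝ)) ∈ driftBox k m n A := by
  have hge (x : Fin d) : 0 ≤ t * κ x := mul_nonneg ht (by exact_mod_cast hκ x)
  have hpos (x : Fin d) : 0 < driftPoint k n x := driftPoint_mem_cell.1 x
  have hle (x : Fin d) : driftPoint k n x + t * κ x ≤ A ^ 2 :=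
    (Finset.single_le_sum (f := driftPoint k n + t • (fun x => (κ x : ℝ)))
      (fun y _ => (add_pos_of_pos_of_nonneg (hpos y) (hge y)).le) (Finset.mem_univ x)).trans hsum.le
  refine ⟨fun x => le_add_of_nonneg_right (hge x), fun x => ?_⟩
  change driftPoint k n x + t * κ x ≤ if x = k then _ else _
  split_ifs with hx
  · subst hx
    rw [add_le_add_iff_left, le_div_iff₀ (by positivity)]
    calc t * κ x * 2 ^ m = t * κ i := by rw [hκi]; push_cast; ring
      _ ≤ A ^ 2 := by linarith [hle i, hpos i]
  · exact hle x

lemma isDriftPoint_driftPoint {ω₀ : Fin d → ℝ} (hij : i ≠ j) (hik : i ≠ k) (hjk : j ≠ k)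
    (hω : ω₀ j ≠ 0) (hneg : ω₀ i * ω₀ j < 0) {K : Set (Fin d → ℝ)} (hact : Active m n)
    (hn : 2 ^ m * level n ≤ m + 10) (hle : level n ≤ 1) (hdom : |ω₀ k| + 1 ≤ 2 ^ m * |ω₀ i|)
    (hA : 3 * d * level n < A⁻¹ ^ 2) (hK : ∀ r ∈ K, level (n + 1) ≤ r k) :
    (resonantZones i k hij hik hjk hω).IsDriftPoint A K (driftBox k m n A) m (driftPoint k n) where
  mem := driftPoint_mem_closedZone hik hact hn hle
  sum_lt := by
    have hnonneg : 0 ≤ d * level n := by have := level_pos n; positivity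
    linarith [sum_driftPoint_le (k := k) (n := n)]
  dir_nonneg κ hκ := hκ.2.2 hneg hdom
  notMem κ _ t hline hmem :=
    (hK _ hmem).not_gt (mem_cell_of_lineIn hline driftPoint_mem_cell).2.2
  mem_of_sum_lt κ hκ t ht _ hsum :=
    add_smul_mem_driftBox hik (hκ.2.2 hneg hdom) hκ.2.1 ht hsum

lemma exists_active_of_parity {c ε : ℝ} (hc : 0 < c) (hε : 0 < ε) (R R' : ℝ) (m₀ : ℕ) :
    ∃ m n, m % 2 = m₀ % 2 ∧ 2 ^ m * level n ≤ m + 10 ∧ Active m n ∧ level n < ε ∧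
      R ≤ 2 ^ m * c ∧ R' < m := by
  obtain ⟨M₁, hM₁⟩ := exists_add_lt_two_pow hε 10
  obtain ⟨M₂, hM₂⟩ := exists_add_lt_two_pow hc R
  obtain ⟨M₃, hM₃⟩ := exists_nat_gt R'
  obtain ⟨m, hmod, hm₁, hm₂, hm₃⟩ : ∃ m, m % 2 = m₀ % 2 ∧ M₁ ≤ m ∧ M₂ ≤ m ∧ M₃ ≤ m :=
    ⟨m₀ + 2 * (M₁ + M₂ + M₃), by omega, by omega, by omega, by omega⟩
  obtain ⟨n, hn, hact⟩ := exists_level_active m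
  refine ⟨m, n, hmod, hn, hact, ?_, ?_, hM₃.trans_le (by exact_mod_cast hm₃)⟩
  · exact lt_of_mul_lt_mul_left (hn.trans_lt (hM₁ m hm₁)) (by positivity)
  · linarith [hM₂ m hm₂, Nat.cast_nonneg (α := ℝ) m]

lemma drift_resonantZones {ω₀ : Fin d → ℝ} (hij : i ≠ j) (hik : i ≠ k) (hjk : j ≠ k)
    (hω : ω₀ j ≠ 0) (hneg : ω₀ i * ω₀ j < 0) : (resonantZones i k hij hik hjk hω).Drift := by
  intro A hA K hK hKD m₀
  obtain ⟨j₀, hj₀⟩ := exists_subset_cellExhaustion hK hKD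
  have hd : (0 : ℝ) < d := by exact_mod_cast k.pos
  have hε : 0 < min (A⁻¹ ^ 2 / (3 * d)) (((j₀ : ℝ) + 1)⁻¹ / 2) := by positivity
  obtain ⟨m, n, hmod, hn, hact, hlt, hdom, hm⟩ := exists_active_of_parity
    (abs_pos.2 (left_ne_zero_of_mul hneg.ne)) hε (|ω₀ k| + 1) (18 * A ^ 2) m₀
  rw [lt_min_iff, lt_div_iff₀' (by positivity)] at hlt
  have hle : level n ≤ 1 := by
    have hinv : ((j₀ : ℝ) + 1)⁻¹ ≤ 1 := inv_le_one_of_one_le₀ (by simp)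
    linarith
  refine ⟨m, hmod, driftPoint k n, driftBox k m n A, isCompact_Icc,
    (driftBox_subset_cell hact hm).trans (cell_subset n),
    isDriftPoint_driftPoint hij hik hjk hω hneg hact hn hle hdom hlt.1 fun r hr => ?_⟩
  rw [level_succ]
  linarith [((hj₀ hr).1 k).1, level_pos n]

end Drift

section Existence

variable {d : ℕ} {i j k : Fin d} {ω₀ : Fin d → ℝ}

lemma isZoneHam_zero : IsZoneHam i k ω₀ (zoneHam i k ω₀ 0 0) :=
  ⟨0, 0, ⟨by simp, by simp⟩, rfl⟩

lemma isBigO_zoneHam_zero :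
    (fun r => zoneHam i k ω₀ 0 0 r - ∑ x, ω₀ x * r x) =O[𝓝 0] fun r => ‖r‖ ^ 2 := by
  simpa [zoneHam] using Asymptotics.isBigO_zero _ _

lemma isBigO_degenerateHam_zero :
    (fun r => degenerateHam ω₀ i j k 0 r - ∑ x, ω₀ x * r x) =O[𝓝 0] fun r => ‖r‖ ^ 2 := by
  simpa [degenerateHam] using isBigO_mul_coord k i

lemma exists_zoneSystem (hd : 3 ≤ d) (ω₀ : Fin d → ℝ) (k : Fin d) :
    ∃ (Z : ZoneSystem d) (h₀ : (Fin d → ℝ) → ℝ), Z.D = cellDomain k ∧ Z.Adm h₀ ∧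
      (fun r => h₀ r - ∑ x, ω₀ x * r x) =O[𝓝 0] (fun r => ‖r‖ ^ 2) ∧
      ((∃ i j, i ≠ k ∧ j ≠ k ∧ ω₀ i * ω₀ j < 0) → Z.Drift) := by
  by_cases hneg : ∃ i j, i ≠ k ∧ j ≠ k ∧ ω₀ i * ω₀ j < 0
  · obtain ⟨i, j, hik, hjk, hlt⟩ := hneg
    have hij : i ≠ j := fun h => (h ▸ mul_self_nonneg (ω₀ i) : 0 ≤ ω₀ i * ω₀ j).not_gt hlt
    have hj : ω₀ j ≠ 0 := right_ne_zero_of_mul hlt.ne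
    exact ⟨resonantZones i k hij hik hjk hj, _, rfl, isZoneHam_zero, isBigO_zoneHam_zero,
      fun _ => drift_resonantZones hij hik hjk hj hlt⟩
  obtain ⟨i, hi, j, hj, hij⟩ : ∃ i ∈ Finset.univ.erase k, ∃ j ∈ Finset.univ.erase k, i ≠ j := by
    rw [← Finset.one_lt_card, Finset.card_erase_of_mem (Finset.mem_univ k), Finset.card_univ,
      Fintype.card_fin]
    omega
  have hik := Finset.ne_of_mem_erase hi
  have hjk := Finset.ne_of_mem_erase hj
  by_cases hωj : ω₀ j = 0
  · by_cases hωi : ω₀ i = 0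
    · exact ⟨degenerateZones hij hik hjk hωi hωj, _, rfl, ⟨0, rfl⟩, isBigO_degenerateHam_zero,
        fun h => absurd h hneg⟩
    · exact ⟨resonantZones j k hij.symm hjk hik hωi, _, rfl, isZoneHam_zero, isBigO_zoneHam_zero,
        fun h => absurd h hneg⟩
  · exact ⟨resonantZones i k hij hik hjk hωj, _, rfl, isZoneHam_zero, isBigO_zoneHam_zero,
      fun h => absurd h hneg⟩

end Existence

end

theorem theoremB_general {d : ℕ} (hd : 3 ≤ d) (ω₀ : Fin d → ℝ) (k : Fin d) :
    ∃ (H : Phase d → ℝ) (Φ : ℝ → Phase d → Phase d) (a : ℤ → ℝ),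
      ContDiff ℝ ∞ H ∧
      IsEllipticWithFrequency ω₀ H ∧
      IsHamiltonianFlow H Φ ∧
      StrictMono a ∧ (∀ n, 0 < a n) ∧
      Tendsto a atBot (𝓝 0) ∧ Tendsto a atTop atTop ∧
      (∀ n, FoliatedByInvariantTori Φ {z | action z k = a n}) ∧
      (∀ i, FoliatedByInvariantTori Φ {z | action z i = 0}) ∧
      (∀ z, z ∉ exceptionalSet k a →
        AccumulatesOn Φ z (exceptionalSet k a) ∨ AccumulatesAtInfinity Φ z) ∧
      ¬ IsKAMStable Φ ∧
      ((∃ i j, i ≠ k ∧ j ≠ k ∧ ω₀ i * ω₀ j < 0) → IsDiffusive Φ) := by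
  obtain ⟨Z, h₀, hD, hadm, hh₀, hdrift⟩ := exists_zoneSystem hd ω₀ k
  obtain ⟨H, Φ, hsmooth, helliptic, hflow, hlevel, hzero, haccum, hKAM, hdiff⟩ :=
    Z.exists_of_cellDomain hD hadm hh₀
  exact ⟨H, Φ, level, hsmooth, helliptic, hflow, strictMono_level, level_pos, tendsto_level_atBot,
    tendsto_level_atTop, hlevel, hzero, haccum, hKAM, fun hneg => hdiff (hdrift hneg)⟩

theorem theoremB (ω₀ : Fin 3 → ℝ) (k : Fin 3) :
    ∃ (H : Phase 3 → ℝ) (Φ : ℝ → Phase 3 → Phase 3) (a : ℤ → ℝ),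
      ContDiff ℝ ∞ H ∧
      IsEllipticWithFrequency ω₀ H ∧
      IsHamiltonianFlow H Φ ∧
      StrictMono a ∧ (∀ n, 0 < a n) ∧
      Tendsto a atBot (𝓝 0) ∧ Tendsto a atTop atTop ∧
      (∀ n, FoliatedByInvariantTori Φ {z | action z k = a n}) ∧
      (∀ i, FoliatedByInvariantTori Φ {z | action z i = 0}) ∧
      (∀ z, z ∉ exceptionalSet k a →
        AccumulatesOn Φ z (exceptionalSet k a) ∨ AccumulatesAtInfinity Φ z) ∧
      ¬ IsKAMStable Φ ∧
      ((∃ i j, i ≠ k ∧ j ≠ k ∧ ω₀ i * ω₀ j < 0) → IsDiffusive Φ) :=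
  theoremB_general le_rfl ω₀ k
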